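/- Let $k$ be an algebraically closed field of characteristic $0$ and $\omega\in k$ a primitive cube root of unity. Let $C_1: y_1^2=x_1^3-x_1$, $C_2: y_2^2=x_2^3-1$, and let $S=\operatorname{Km}(C_1\times C_2)$ be the Kummer surface, with function field $k(S)=k(x_1,x_2,t)\subset k(C_1\times C_2)$, $t=y_1/y_2$. An elliptic curve $E$ over the rational function field $k(u)$ such that $k(u)(E)\cong k(S)$ over $k$ is the generic fibre of an elliptic fibration with section $S\to\mathbf P^1$. Two such fibrations are isomorphic if there is a $k$-isomorphism of the function fields $k(u)(E)\to k(u)(E')$ that maps $k(u)$ onto $k(u)$. A fibration is of type $\mathscr J_n$ if its reducible singular fibres are, in Kodaira's notation: $\mathscr J_1$: $2\mathrm I_8$; $\mathscr J_2$: $\mathrm I_4+\mathrm I_{12}$; $\mathscr J_3$: $2\mathrm{IV}^*$; $\mathscr J_4$: $4\mathrm I_0^*$; $\mathscr J_5$: $\mathrm I_6^*+6\mathrm I_2$; $\mathscr J_6$: $2\mathrm I_2^*+4\mathrm I_2$; $\mathscr J_7$: $\mathrm I_4^*+2\mathrm I_0^*$; $\mathscr J_8$: $\mathrm{III}^*+\mathrm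 I_2^*+3\mathrm I_2$; $\mathscr J_9$: $\mathrm{II}^*+2\mathrm I_0^*$; $\mathscr J_{10}$: $\mathrm I_8^*+\mathrm I_0^*$; $\mathscr J_{11}$: $2\mathrm I_4^*$. Let $J=j/1728$. Each of the following sixteen equations defines an elliptic curve over $k(u)$ whose function field $k(x,y,u)$ is isomorphic to $k(S)$ over $k$; the corresponding fibration on $S$ has the indicated type, and $J$ is as stated (where it is given). * $\mathscr J_1$(a): $y^2=x\bigl(x^2+(u^4+1)x+4u^4\bigr)$, $J=\frac1{108}\frac{(u^8-10u^4+1)^3}{u^8(u^8-14u^4+1)}$. * $\mathscr J_1$(b): $y^2=x\bigl(x^2+(u^4+6(2\omega+1)u^2+1)x-32u^4\bigr)$, $J=\frac1{6912}\frac{(u^8+12(2\omega+1)u^6-10u^4+12(2\omega+1)u^2+1)^3}{u^8(u^8+12(2\omega+1)u^6+22u^4+12(2\omega+1)u^2+1)}$. * $\mathscr J_2$: $y^2=x\bigl(x^2-(3u^4+6u^2-1)x+32u^6\bigr)$, $J=\frac1{6912}\frac{(9u^8-60u^6+30u^4-12u^2+1)^3}{u^{12}(u^4-10u^2+1)(9u^4-2u^2+1)}$.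 * $\mathscr J_3$: $y^2=x^3+u^4(u^4+1)$, $J=0$. * $\mathscr J_4$(a): $y^2=x^3-(u^3-1)^2x$, $J=1$. * $\mathscr J_4$(b): $y^2=x^3-(u^3-u)^3$, $J=0$. * $\mathscr J_5$: $y^2=x(x-4)\bigl(x+2u(u^2+3u+3)\bigr)$, $J=\frac1{27}\frac{(u^6+6u^5+15u^4+20u^3+15u^2+6u+4)^3}{u^2(u+2)^2(u^2+u+1)^2(u^2+3u+3)^2}$. * $\mathscr J_6$(a): $y^2=x(x+2u^2)\bigl(x-u(u^2-u+1)\bigr)$, $J=\frac1{27}\frac{(u^4+5u^2+1)^3}{u^2(u^4+u^2+1)^2}$. * $\mathscr J_6$(b): $y^2=x(x-\omega u^2)\bigl(x+u(2u-1)(u+\omega^2)\bigr)$, $J=\frac4{27}\frac{\omega(2u^2-(\omega+2)u-\omega^2)^3(2u^2-2(\omega+2)u-\omega^2)^3}{u^2(u-1)^2(2u-1)^2(u+\omega^2)^2(2u+\omega^2)^2}$. * $\mathscr J_7$(a): $y^2=x\bigl(x^2-u(u+1)(u+2)x+u^2(u+2)^2\bigr)$, $J=\frac4{27}\frac{(u^2+2u-2)^3}{(u-1)(u+3)}$.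 * $\mathscr J_7$(b): $y^2=x\bigl(x^2+\omega u(u-1)(u-3\omega-2)x-2\omega^2u^2(u-1)^2\bigr)$, $J=\frac1{27}\frac{(u^2-2(3\omega+2)u+3\omega+1)^3}{u^2-2(3\omega+2)u+3\omega+3}$. * $\mathscr J_8$: $y^2=x\bigl(x^2+u(3u+2)x+u^2(1+3u+3u^2+2u^3)\bigr)$, $J=\frac4{27}\frac{(6u^3-3u-1)^3}{u^2(2u+1)^2(u^2+u+1)^2(8u+3)}$. * $\mathscr J_9$: $y^2=x^3+u(u^2-4)^3$, $J=0$. * $\mathscr J_{10}$: $y^2=x^3+u^2(u+3)x^2+u^2(-2u^2-2u+3)x+u^4(u-1)$. * $\mathscr J_{11}$(a): $y^2=x^3-27u^2(u^4+6u^3+5u^2-6u+1)x-54u^3(u^2+1)(u^4+9u^3+20u^2-9u+1)$. * $\mathscr J_{11}$(b): $y^2=x^3-27u^2(4u^4-12u^3+10(\omega+1)u^2-6\omega u+\omega)x+27u^3\bigl(16u^6-72u^5+6(19+10\omega)u^4-63(1+2\omega)u^3+3(-9+10\omega)u^2+18u-2\bigr)$. Moreover: both fibrations of type $\mathscr J_1$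 have $\mathrm I_8$ fibres at $u=0$ and $u=\infty$, exactly eight $\mathrm I_1$ fibres, and no other singular fibre. The isomorphism of function fields can be chosen with $u\mapsto x_2$ for $\mathscr J_4$(a) and with $u\mapsto x_1$ for $\mathscr J_4$(b), so these fibrations are induced by the two projections of $C_1\times C_2$. The sixteen fibrations are mutually non-isomorphic; in particular, for each of the types $\mathscr J_1,\mathscr J_4,\mathscr J_6,\mathscr J_7,\mathscr J_{11}$ the two equations (a), (b) define non-isomorphic fibrations. -/

import Mathlib

noncomputable section

namespace KummerFibrations

/-! ### The Kummer surface of the product of `y² = x³ - x` and `y² = x³ - 1`, through its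
function field -/

section Kummer

variable (k : Type*) [Field k]

/-- The elliptic curve `C₁ : y² = x³ - x`. -/
def curveOne : WeierstrassCurve k := ⟨0, 0, 0, -1, 0⟩

/-- The elliptic curve `C₂ : y² = x³ - 1`. -/
def curveTwo : WeierstrassCurve k := ⟨0, 0, 0, 0, -1⟩

/-- The function field `k(C₁) = k(x₁, y₁)`. -/
abbrev CurveOneField := (curveOne k).toAffine.FunctionField

/-- The curve `C₂` over the field `k(C₁)`: the generic fibre of the first projection
`C₁ × C₂ → C₁`. -/
def curveTwoGeneric : WeierstrassCurve (CurveOneField k) :=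
  (curveTwo k).map (algebraMap k (CurveOneField k))

/-- The function field `k(C₁ × C₂) = k(x₁, y₁, x₂, y₂)`. -/
abbrev ProductField := (curveTwoGeneric k).toAffine.FunctionField

open Polynomial in
/-- The function `x₁` on `C₁ × C₂`. -/
def xOne : ProductField k :=
  algebraMap (CurveOneField k) (ProductField k)
    (algebraMap (curveOne k).toAffine.CoordinateRing (CurveOneField k)
      (WeierstrassCurve.Affine.CoordinateRing.mk (curveOne k).toAffine (C X)))

open Polynomial in
/-- The function `y₁` on `C₁ × C₂`. -/
def yOne : ProductField k :=
  algebraMap (CurveOneField k) (ProductField k)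
    (algebraMap (curveOne k).toAffine.CoordinateRing (CurveOneField k)
      (WeierstrassCurve.Affine.CoordinateRing.mk (curveOne k).toAffine X))

open Polynomial in
/-- The function `x₂` on `C₁ × C₂`. -/
def xTwo : ProductField k :=
  algebraMap (curveTwoGeneric k).toAffine.CoordinateRing (ProductField k)
    (WeierstrassCurve.Affine.CoordinateRing.mk (curveTwoGeneric k).toAffine (C X))

open Polynomial in
/-- The function `y₂` on `C₁ × C₂`. -/
def yTwo : ProductField k :=
  algebraMap (curveTwoGeneric k).toAffine.CoordinateRing (ProductField k)
    (WeierstrassCurve.Affine.CoordinateRing.mk (curveTwoGeneric k).toAffine X)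

/-- The function field `k(S)` of the Kummer surface `S = Km(C₁ × C₂)`: the subfield
`k(x₁, x₂, t)`, `t = y₁ / y₂`, of `k(C₁ × C₂)`. It is the field of the functions that are invariant
under the inversion `(x₁, y₁, x₂, y₂) ↦ (x₁, -y₁, x₂, -y₂)`. -/
def kummerField : IntermediateField k (ProductField k) :=
  IntermediateField.adjoin k {xOne k, xTwo k, yOne k / yTwo k}

end Kummer

/-! ### Elliptic curves over `k(u)` and their singular fibres -/

/-- Kodaira's symbols for the fibres of a relatively minimal elliptic fibration
(`I 0` is a smooth fibre). -/
inductive KodairaSymbol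
  | I (n : ℕ)
  | IStar (n : ℕ)
  | II
  | III
  | IV
  | IVStar
  | IIIStar
  | IIStar
  deriving DecidableEq

/-- A fibre is reducible unless it is smooth, nodal (`I 1`) or cuspidal (`II`). -/
def KodairaSymbol.IsReducible : KodairaSymbol → Prop
  | .I n => 2 ≤ n
  | .II => False
  | _ => True

section Fibres

variable {k : Type*} [Field k]

open scoped Classical in
/-- The order of vanishing of a rational function `f ∈ k(u)` at a point of
`ℙ¹(k) = k ∪ {∞}`; it is `⊤` for `f = 0`. -/
def ordAt (p : OnePoint k) (f : RatFunc k) : WithTop ℤ :=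
  if f = 0 then ⊤
  else ((p.elim (-f.intDegree)
    (fun a => (f.num.rootMultiplicity a : ℤ) - (f.denom.rootMultiplicity a : ℤ)) : ℤ) : WithTop ℤ)

/-- The table of Tate's algorithm in residue characteristic zero: the Kodaira symbol of the
fibre of a minimal Weierstrass equation is read off from the orders `a`, `b`, `d` of `c₄`, `c₆`
and of the discriminant. -/
def TateTable (a b d : WithTop ℤ) : KodairaSymbol → Prop
  | .I 0 => 0 ≤ a ∧ 0 ≤ b ∧ d = 0
  | .I (n + 1) => a = 0 ∧ b = 0 ∧ d = ((n + 1 : ℤ) : WithTop ℤ)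
  | .II => 1 ≤ a ∧ b = 1 ∧ d = 2
  | .III => a = 1 ∧ 2 ≤ b ∧ d = 3
  | .IV => 2 ≤ a ∧ b = 2 ∧ d = 4
  | .IStar 0 => 2 ≤ a ∧ 3 ≤ b ∧ d = 6
  | .IStar (n + 1) => a = 2 ∧ b = 3 ∧ d = ((n + 7 : ℤ) : WithTop ℤ)
  | .IVStar => 3 ≤ a ∧ b = 4 ∧ d = 8
  | .IIIStar => a = 3 ∧ 5 ≤ b ∧ d = 9
  | .IIStar => 4 ≤ a ∧ b = 5 ∧ d = 10

/-- The elliptic fibration with generic fibre `W` over `k(u)` has a fibre of type `T` at `p`: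
some Weierstrass equation of `W` over `k(u)` has the orders at `p` listed in the table. (All the
entries of the table belong to equations that are minimal at `p`.) -/
def HasFibre (W : WeierstrassCurve (RatFunc k)) (p : OnePoint k) (T : KodairaSymbol) : Prop :=
  ∃ v : WeierstrassCurve.VariableChange (RatFunc k),
    TateTable (ordAt p (v • W).c₄) (ordAt p (v • W).c₆) (ordAt p (v • W).Δ) T

/-- `W` and `W'` are the generic fibres of isomorphic elliptic fibrations: there is a
`k`-isomorphism of the function fields of the two surfaces that carries the subfield `k(u)` onto
the subfield `k(u)` (by a linear fractional transformation `τ` of `u`). The isomorphism is not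
required to respect the zero sections. -/
def IsomorphicFibrations (W W' : WeierstrassCurve (RatFunc k)) : Prop :=
  ∃ (σ : W.toAffine.FunctionField ≃ₐ[k] W'.toAffine.FunctionField)
    (τ : RatFunc k ≃ₐ[k] RatFunc k),
    ∀ f : RatFunc k, σ (algebraMap (RatFunc k) W.toAffine.FunctionField f) =
      algebraMap (RatFunc k) W'.toAffine.FunctionField (τ f)

end Fibres

/-! ### Oguiso's types -/

/-- The eleven types of elliptic fibrations on the Kummer surface of a product of two
non-isogenous elliptic curves. -/
inductive OguisoType
  | J1 | J2 | J3 | J4 | J5 | J6 | J7 | J8 | J9 | J10 | J11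

open KodairaSymbol in
/-- The reducible fibres of an elliptic fibration of the given type. -/
def OguisoType.reducibleFibres : OguisoType → Multiset KodairaSymbol
  | J1 => {I 8, I 8}
  | J2 => {I 4, I 12}
  | J3 => {IVStar, IVStar}
  | J4 => {IStar 0, IStar 0, IStar 0, IStar 0}
  | J5 => {IStar 6, I 2, I 2, I 2, I 2, I 2, I 2}
  | J6 => {IStar 2, IStar 2, I 2, I 2, I 2, I 2}
  | J7 => {IStar 4, IStar 0, IStar 0}
  | J8 => {IIIStar, IStar 2, I 2, I 2, I 2}
  | J9 => {IIStar, IStar 0, IStar 0}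
  | J10 => {IStar 8, IStar 0}
  | J11 => {IStar 4, IStar 4}

/-- The elliptic fibration with generic fibre `W` is of type `n`: for each reducible Kodaira
symbol, it has as many fibres with this symbol as the list for the type `n` contains. -/
def HasType {k : Type*} [Field k] (W : WeierstrassCurve (RatFunc k)) (n : OguisoType) : Prop :=
  ∀ T : KodairaSymbol, T.IsReducible →
    {p : OnePoint k | HasFibre W p T}.encard = (n.reducibleFibres.count T : ℕ∞)

/-! ### The list of Weierstrass equations -/

/-- Names for the sixteen equations; `a` and `b` distinguish two equations of the same type. -/
inductive Label
  | j1a | j1b | j2 | j3 | j4a | j4b | j5 | j6a | j6b | j7a | j7b | j8 | j9 | j10 | j11a | j11b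

/-- The Oguiso type of each of the equations. -/
def Label.type : Label → OguisoType
  | j1a | j1b => .J1
  | j2 => .J2
  | j3 => .J3
  | j4a | j4b => .J4
  | j5 => .J5
  | j6a | j6b => .J6
  | j7a | j7b => .J7
  | j8 => .J8
  | j9 => .J9
  | j10 => .J10
  | j11a | j11b => .J11

/-- The curve `y² = x³ + a x² + b x + c`. -/
def cubicModel {F : Type*} [Field F] (a b c : F) : WeierstrassCurve F := ⟨0, a, 0, b, c⟩

/-- The curve `y² = x (x - e) (x - f)`. -/
def splitModel {F : Type*} [Field F] (e f : F) : WeierstrassCurve F :=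
  cubicModel (-(e + f)) (e * f) 0

section Equations

variable {k : Type*} [Field k]

/-- The Weierstrass equations over `k(u)`; `ω` is a primitive cube root of unity. -/
def equation (ω : k) (i : Label) : WeierstrassCurve (RatFunc k) :=
  let u : RatFunc k := RatFunc.X
  let w : RatFunc k := RatFunc.C ω
  match i with
  | .j1a => cubicModel (u ^ 4 + 1) (4 * u ^ 4) 0
  | .j1b => cubicModel (u ^ 4 + 6 * (2 * w + 1) * u ^ 2 + 1) (-32 * u ^ 4) 0
  | .j2 => cubicModel (-(3 * u ^ 4 + 6 * u ^ 2 - 1)) (32 * u ^ 6) 0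
  | .j3 => cubicModel 0 0 (u ^ 4 * (u ^ 4 + 1))
  | .j4a => cubicModel 0 (-(u ^ 3 - 1) ^ 2) 0
  | .j4b => cubicModel 0 0 (-(u ^ 3 - u) ^ 3)
  | .j5 => splitModel 4 (-(2 * u * (u ^ 2 + 3 * u + 3)))
  | .j6a => splitModel (-(2 * u ^ 2)) (u * (u ^ 2 - u + 1))
  | .j6b => splitModel (w * u ^ 2) (-(u * (2 * u - 1) * (u + w ^ 2)))
  | .j7a => cubicModel (-(u * (u + 1) * (u + 2))) (u ^ 2 * (u + 2) ^ 2) 0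
  | .j7b => cubicModel (w * u * (u - 1) * (u - 3 * w - 2)) (-(2 * w ^ 2 * u ^ 2 * (u - 1) ^ 2)) 0
  | .j8 => cubicModel (u * (3 * u + 2)) (u ^ 2 * (1 + 3 * u + 3 * u ^ 2 + 2 * u ^ 3)) 0
  | .j9 => cubicModel 0 0 (u * (u ^ 2 - 4) ^ 3)
  | .j10 => cubicModel (u ^ 2 * (u + 3)) (u ^ 2 * (-2 * u ^ 2 - 2 * u + 3)) (u ^ 4 * (u - 1))
  | .j11a => cubicModel 0 (-27 * u ^ 2 * (u ^ 4 + 6 * u ^ 3 + 5 * u ^ 2 - 6 * u + 1))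
      (-54 * u ^ 3 * (u ^ 2 + 1) * (u ^ 4 + 9 * u ^ 3 + 20 * u ^ 2 - 9 * u + 1))
  | .j11b => cubicModel 0
      (-27 * u ^ 2 * (4 * u ^ 4 - 12 * u ^ 3 + 10 * (w + 1) * u ^ 2 - 6 * w * u + w))
      (27 * u ^ 3 * (16 * u ^ 6 - 72 * u ^ 5 + 6 * (19 + 10 * w) * u ^ 4
        - 63 * (1 + 2 * w) * u ^ 3 + 3 * (-9 + 10 * w) * u ^ 2 + 18 * u - 2))

/-- The absolute invariants `J = j / 1728` of the equations, for those equations for which the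
invariant is listed. -/
def absoluteInvariant (ω : k) (i : Label) : Option (RatFunc k) :=
  let u : RatFunc k := RatFunc.X
  let w : RatFunc k := RatFunc.C ω
  match i with
  | .j1a => some (1 / 108 * ((u ^ 8 - 10 * u ^ 4 + 1) ^ 3 / (u ^ 8 * (u ^ 8 - 14 * u ^ 4 + 1))))
  | .j1b => some (1 / 6912 *
      ((u ^ 8 + 12 * (2 * w + 1) * u ^ 6 - 10 * u ^ 4 + 12 * (2 * w + 1) * u ^ 2 + 1) ^ 3 /
        (u ^ 8 *
          (u ^ 8 + 12 * (2 * w + 1) * u ^ 6 + 22 * u ^ 4 + 12 * (2 * w + 1) * u ^ 2 + 1))))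
  | .j2 => some (1 / 6912 *
      ((9 * u ^ 8 - 60 * u ^ 6 + 30 * u ^ 4 - 12 * u ^ 2 + 1) ^ 3 /
        (u ^ 12 * (u ^ 4 - 10 * u ^ 2 + 1) * (9 * u ^ 4 - 2 * u ^ 2 + 1))))
  | .j3 => some 0
  | .j4a => some 1
  | .j4b => some 0
  | .j5 => some (1 / 27 *
      ((u ^ 6 + 6 * u ^ 5 + 15 * u ^ 4 + 20 * u ^ 3 + 15 * u ^ 2 + 6 * u + 4) ^ 3 /
        (u ^ 2 * (u + 2) ^ 2 * (u ^ 2 + u + 1) ^ 2 * (u ^ 2 + 3 * u + 3) ^ 2)))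
  | .j6a => some (1 / 27 * ((u ^ 4 + 5 * u ^ 2 + 1) ^ 3 / (u ^ 2 * (u ^ 4 + u ^ 2 + 1) ^ 2)))
  | .j6b => some (4 / 27 *
      (w * (2 * u ^ 2 - (w + 2) * u - w ^ 2) ^ 3 * (2 * u ^ 2 - 2 * (w + 2) * u - w ^ 2) ^ 3 /
        (u ^ 2 * (u - 1) ^ 2 * (2 * u - 1) ^ 2 * (u + w ^ 2) ^ 2 * (2 * u + w ^ 2) ^ 2)))
  | .j7a => some (4 / 27 * ((u ^ 2 + 2 * u - 2) ^ 3 / ((u - 1) * (u + 3))))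
  | .j7b => some (1 / 27 *
      ((u ^ 2 - 2 * (3 * w + 2) * u + 3 * w + 1) ^ 3 /
        (u ^ 2 - 2 * (3 * w + 2) * u + 3 * w + 3)))
  | .j8 => some (4 / 27 *
      ((6 * u ^ 3 - 3 * u - 1) ^ 3 /
        (u ^ 2 * (2 * u + 1) ^ 2 * (u ^ 2 + u + 1) ^ 2 * (8 * u + 3))))
  | .j9 => some 0
  | .j10 | .j11a | .j11b => none

/-- The element `u` of the function field `k(x, y, u)` of an equation over `k(u)`. -/
def parameter (W : WeierstrassCurve (RatFunc k)) : W.toAffine.FunctionField :=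
  algebraMap (RatFunc k) W.toAffine.FunctionField RatFunc.X

end Equations

end KummerFibrations

end

/-!
The function field of the Kummer surface is `K = k(x, z, t)` with `x³ - x = t² (z³ - 1)`, a double
cover of the `(x, z)`-plane (`isDoublePlane_kummer`, `kummer_relation`). The proof has three parts,
each of which works with explicit elements of `K` and explicit Weierstrass equations.

**The fibrations live on the surface.** For each equation a function `u ∈ K` is given, together with
generators of `K` over `k(u)` that satisfy the equation. As a rule `K` is first presented as a double
cover `v² = f(x')` of a line over `k(u)`, with `f` a cubic or a quartic whose leading coefficient is
a square; `IsDoublePlane.of_cubic` and `IsDoublePlane.of_quartic` turn this into a Weierstrass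
equation, and `IsDoublePlane.rescale` adjusts it, by roots of constants, to the equation in question.
The parameters of the types `J₁` to `J₆` and `J₈` come from pencils of lines, conics and cubics in
the plane or on the double plane. The remaining ones are quotients of the Weierstrass coordinate `x`
of the fibration of type `J₈` by a polynomial in its parameter. Since `K` has transcendence degree
two over `k`, a Weierstrass equation satisfied by generators of `K` presents `K` as the function
field of the curve (`IsDoublePlane.exists_algEquiv`).

**Singular fibres.** The fibres at the points of the affine line are read off from factorizations of
the coefficients and of the discriminant, by Tate's table; a simple zero of the discriminant gives
`I₁` or `II`. The fibre at infinity is the fibre at `0` of the equation transformed by `u ↦ 1 / u`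
(`hasFibre_infty`). Nothing else occurs at these points, since different entries of the table are not
related by a change of coordinates (`HasFibre.unique`).

**No two fibrations are isomorphic.** An isomorphism of fibrations induces an automorphism of `k(u)`
and an isomorphism between the function fields of the generic fibres. The latter need not respect the
origins. However, `x` has a pole at only one place of the function field of a cubic
(`IsGenericPoint.valuationSubring_unique`). This place of the second curve is carried to the place of
a rational point of the first curve, and after a translation by this point, by means of the group
law, it becomes the place at infinity (`IsGenericPoint.exists_not_mem`). The functions `x` and `y` of
both curves then have poles of order two and three at the same place and no others, and so differ by
a change of Weierstrass coordinates (`IsGenericPoint.exists_variableChange`). As an automorphism of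
`k(u)` comes from a projectivity of the line, which preserves the orders of functions
(`exists_smul_ordAt`), the fibres of isomorphic fibrations are matched by a projectivity
(`IsomorphicFibrations.exists_hasFibre_iff`). In particular the types agree. The
absolute invariants `1728` and `0` separate the two fibrations of type `J₄`; for the other pairs of
the same type, no projectivity matches the positions of the singular fibres.
-/

noncomputable section

open Polynomial

namespace KummerFibrations

/-! ### Generic points of plane cubics -/

/-- `(x, y)` is a generic point, with coordinates in the extension `K` of `F`, of the curve
`y² = x³ + a x² + b x + c` over `F`, and `K` is its function field: `K = F(x, y)`. -/
structure IsGenericPoint {F K : Type*} [Field F] [Field K] [Algebra F K] (a b c : F) (x y : K) :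
    Prop where
  equation : y ^ 2 = x ^ 3 + algebraMap F K a * x ^ 2 + algebraMap F K b * x + algebraMap F K c
  transcendental : Transcendental F x
  adjoin_eq_top : IntermediateField.adjoin F {x, y} = ⊤

namespace IsGenericPoint

variable {F K : Type*} [Field F] [Field K] [Algebra F K] {a b c : F} {x y : K}

/-- The polynomial on the right hand side of the equation of a cubic. -/
def cubicPoly (a b c : F) : F[X] := X ^ 3 + C a * X ^ 2 + C b * X + C c

lemma natDegree_cubicPoly (a b c : F) : (cubicPoly a b c).natDegree = 3 := by
  unfold cubicPoly; compute_degree!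

lemma cubicPoly_ne_zero (a b c : F) : cubicPoly a b c ≠ 0 := by
  intro h
  simpa [h] using natDegree_cubicPoly a b c

lemma sq_eq (h : IsGenericPoint a b c x y) : y ^ 2 = aeval x (cubicPoly a b c) := by
  rw [h.equation]; simp [cubicPoly]

lemma aeval_eq_zero (h : IsGenericPoint a b c x y) {p : F[X]} (hp : aeval x p = 0) : p = 0 :=
  (transcendental_iff.mp h.transcendental) p hp

/-- `p² = q² f` is impossible for reasons of degree if `f` is a cubic. -/
lemma eq_zero_of_sq_eq {p q f : F[X]} (hf : f.natDegree = 3) (h : p ^ 2 = q ^ 2 * f) :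
    p = 0 ∧ q = 0 := by
  have hf0 : f ≠ 0 := by rintro rfl; simp at hf
  by_cases hq : q = 0
  · subst hq; simpa using h
  · exfalso
    have := congrArg natDegree h
    rw [natDegree_pow, natDegree_mul (pow_ne_zero _ hq) hf0, natDegree_pow, hf] at this
    omega

lemma eq_zero_of_add_eq_zero (h : IsGenericPoint a b c x y) {p q : F[X]}
    (hpq : aeval x p + aeval x q * y = 0) : p = 0 ∧ q = 0 := by
  refine eq_zero_of_sq_eq (natDegree_cubicPoly a b c) ?_
  rw [← sub_eq_zero]
  apply h.aeval_eq_zero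
  simp only [map_sub, map_mul, map_pow]
  rw [← h.sq_eq]
  linear_combination (aeval x p - aeval x q * y) * hpq

/-- Every element of `F(x, y)` is of the form `(p(x) + q(x) y) / r(x)`. -/
lemma exists_eq_div (h : IsGenericPoint a b c x y) (z : K) :
    ∃ p q r : F[X], r ≠ 0 ∧ z * aeval x r = aeval x p + aeval x q * y := by
  let M : IntermediateField F K :=
    { carrier := {z | ∃ p q r : F[X], r ≠ 0 ∧ z * aeval x r = aeval x p + aeval x q * y}
      mul_mem' := by
        rintro z z' ⟨p, q, r, hr, e⟩ ⟨p', q', r', hr', e'⟩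
        refine ⟨p * p' + q * q' * cubicPoly a b c, p * q' + q * p', r * r', mul_ne_zero hr hr', ?_⟩
        simp only [map_mul, map_add, ← h.sq_eq]
        linear_combination (z' * aeval x r') * e + (aeval x p + aeval x q * y) * e'
      add_mem' := by
        rintro z z' ⟨p, q, r, hr, e⟩ ⟨p', q', r', hr', e'⟩
        refine ⟨p * r' + r * p', q * r' + r * q', r * r', mul_ne_zero hr hr', ?_⟩
        simp only [map_mul, map_add]
        linear_combination aeval x r' * e + aeval x r * e'
      algebraMap_mem' := fun t => ⟨C t, 0, 1, one_ne_zero, by simp⟩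
      inv_mem' := by
        rintro z ⟨p, q, r, hr, e⟩
        by_cases hz : z = 0
        · subst hz; exact ⟨0, 0, 1, one_ne_zero, by simp⟩
        · have hr' : aeval x r ≠ 0 := fun h0 => hr (h.aeval_eq_zero h0)
          have hn : p ^ 2 - q ^ 2 * cubicPoly a b c ≠ 0 := by
            intro h0
            obtain ⟨rfl, rfl⟩ := eq_zero_of_sq_eq (natDegree_cubicPoly a b c) (sub_eq_zero.mp h0)
            simp [hz, hr'] at e
          refine ⟨r * p, -(r * q), p ^ 2 - q ^ 2 * cubicPoly a b c, hn, ?_⟩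
          simp only [map_mul, map_sub, map_neg, map_pow, ← h.sq_eq]
          field_simp
          linear_combination -(aeval x p - aeval x q * y) * e }
  have hM : M = ⊤ := by
    rw [eq_top_iff, ← h.adjoin_eq_top, IntermediateField.adjoin_le_iff]
    rintro t (rfl | rfl)
    · exact ⟨X, 0, 1, one_ne_zero, by simp⟩
    · exact ⟨0, 1, 1, one_ne_zero, by simp⟩
  exact (hM ▸ IntermediateField.mem_top : z ∈ M)

/-! ### The function field of a cubic as an abstract field -/

lemma eval_polynomial (h : IsGenericPoint a b c x y) :
    (cubicModel a b c).toAffine.polynomial.eval₂ ((aeval x : F[X] →ₐ[F] K) : F[X] →+* K) y = 0 := by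
  have := h.equation
  simp only [WeierstrassCurve.Affine.polynomial, cubicModel, eval₂_sub, eval₂_add, eval₂_mul,
    eval₂_pow, eval₂_C, eval₂_X, eval₂_zero, RingHom.coe_coe, map_add, map_mul, map_pow, map_zero,
        aeval_C,
    aeval_X]
  linear_combination this

/-- Evaluation of regular functions at a generic point. -/
def evalHom (h : IsGenericPoint a b c x y) :
    (cubicModel a b c).toAffine.CoordinateRing →ₐ[F] K :=
  { AdjoinRoot.lift ((aeval x : F[X] →ₐ[F] K) : F[X] →+* K) y h.eval_polynomial with
    commutes' := fun r => by
      change AdjoinRoot.lift _ _ _ (algebraMap F (cubicModel a b c).toAffine.CoordinateRing r) = _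
      rw [show algebraMap F (cubicModel a b c).toAffine.CoordinateRing r =
        AdjoinRoot.of _ (C r) from rfl, AdjoinRoot.lift_of]
      simp }

lemma evalHom_mk (h : IsGenericPoint a b c x y) (p : F[X][X]) :
    h.evalHom (WeierstrassCurve.Affine.CoordinateRing.mk _ p) =
      p.eval₂ ((aeval x : F[X] →ₐ[F] K) : F[X] →+* K) y :=
  AdjoinRoot.lift_mk h.eval_polynomial p

lemma evalHom_injective (h : IsGenericPoint a b c x y) : Function.Injective h.evalHom := by
  rw [injective_iff_map_eq_zero]
  intro z hz
  obtain ⟨p, q, rfl⟩ := WeierstrassCurve.Affine.CoordinateRing.exists_smul_basis_eq z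
  rw [WeierstrassCurve.Affine.CoordinateRing.smul, WeierstrassCurve.Affine.CoordinateRing.smul,
    map_add, map_mul, map_mul, map_one, h.evalHom_mk, h.evalHom_mk, h.evalHom_mk] at hz
  simp only [eval₂_C, eval₂_X, mul_one, RingHom.coe_coe] at hz
  obtain ⟨rfl, rfl⟩ := h.eq_zero_of_add_eq_zero hz
  simp

/-- The function field of a cubic is identified with any field generated by a generic point. -/
def functionFieldEquiv (h : IsGenericPoint a b c x y) :
    (cubicModel a b c).toAffine.FunctionField ≃ₐ[F] K :=
  AlgEquiv.ofBijective
    (IsFractionRing.liftAlgHom (K := (cubicModel a b c).toAffine.FunctionField)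
      (g := h.evalHom) h.evalHom_injective) <| by
    refine ⟨RingHom.injective _, ?_⟩
    rw [← AlgHom.fieldRange_eq_top, eq_top_iff, ← h.adjoin_eq_top,
      IntermediateField.adjoin_le_iff]
    rintro _ (rfl | rfl)
    · refine ⟨algebraMap (cubicModel a b c).toAffine.CoordinateRing _
        (WeierstrassCurve.Affine.CoordinateRing.mk _ (C X)), ?_⟩
      refine (IsFractionRing.lift_algebraMap h.evalHom_injective _).trans ?_
      refine (h.evalHom_mk _).trans ?_
      simp
    · refine ⟨algebraMap (cubicModel a b c).toAffine.CoordinateRing _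
        (WeierstrassCurve.Affine.CoordinateRing.mk _ X), ?_⟩
      refine (IsFractionRing.lift_algebraMap h.evalHom_injective _).trans ?_
      refine (h.evalHom_mk _).trans ?_
      simp

end IsGenericPoint

lemma aeval_mem {F K : Type*} [Field F] [Field K] [Algebra F K] (M : IntermediateField F K) {x : K}
    (hx : x ∈ M) (p : F[X]) : aeval x p ∈ M := by
  rw [aeval_eq_sum_range]
  exact sum_mem fun i _ => M.smul_mem (pow_mem hx i)

/-- The coordinate functions are a generic point with coordinates in the function field. -/
lemma isGenericPoint_functionField {F : Type*} [Field F] (a b c : F) :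
    IsGenericPoint (K := (cubicModel a b c).toAffine.FunctionField) a b c
      (algebraMap (cubicModel a b c).toAffine.CoordinateRing _
        (WeierstrassCurve.Affine.CoordinateRing.mk _ (C X)))
      (algebraMap (cubicModel a b c).toAffine.CoordinateRing _
        (WeierstrassCurve.Affine.CoordinateRing.mk _ X)) := by
  set W := (cubicModel a b c).toAffine with hW
  set ξ := algebraMap W.CoordinateRing W.FunctionField
    (WeierstrassCurve.Affine.CoordinateRing.mk W (C X)) with hξ
  set η := algebraMap W.CoordinateRing W.FunctionField
    (WeierstrassCurve.Affine.CoordinateRing.mk W X) with hη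
  have hC : ∀ p : F[X], aeval ξ p = algebraMap W.CoordinateRing W.FunctionField
        (WeierstrassCurve.Affine.CoordinateRing.mk W (C p)) := by
    intro p
    rw [hξ, aeval_algebraMap_apply]
    congr 1
    have : (aeval (WeierstrassCurve.Affine.CoordinateRing.mk W (C X)) : F[X] →ₐ[F] _) =
      Algebra.algHom F F[X] W.CoordinateRing := by
      ext; simp
    rw [this]; rfl
  refine ⟨?_, ?_, ?_⟩
  · have e : WeierstrassCurve.Affine.CoordinateRing.mk W
        (X ^ 2 - C (X ^ 3 + C a * X ^ 2 + C b * X + C c)) = 0 := by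
      have : (X ^ 2 - C (X ^ 3 + C a * X ^ 2 + C b * X + C c) : F[X][X]) = W.polynomial := by
        simp [WeierstrassCurve.Affine.polynomial, hW, cubicModel]
      rw [this]; exact AdjoinRoot.mk_self
    rw [map_sub, sub_eq_zero, map_pow] at e
    rw [hη, ← map_pow, e, ← hC]
    simp
  · rw [transcendental_iff]
    intro p hp
    rw [hC] at hp
    have h1 := (IsFractionRing.injective W.CoordinateRing W.FunctionField)
      (hp.trans (map_zero _).symm)
    have h2 : p • (1 : W.CoordinateRing) + (0 : F[X]) •
        WeierstrassCurve.Affine.CoordinateRing.mk W X = 0 := by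
      rw [WeierstrassCurve.Affine.CoordinateRing.smul, zero_smul, add_zero, mul_one, h1]
    exact (WeierstrassCurve.Affine.CoordinateRing.smul_basis_eq_zero h2).1
  · rw [eq_top_iff]
    intro z _
    obtain ⟨n, d, hd, rfl⟩ := IsFractionRing.div_surjective (A := W.CoordinateRing) z
    have hx : ξ ∈ IntermediateField.adjoin F {ξ, η} :=
      IntermediateField.subset_adjoin F _ (Set.mem_insert _ _)
    have hy : η ∈ IntermediateField.adjoin F {ξ, η} :=
      IntermediateField.subset_adjoin F _ (Set.mem_insert_of_mem _ (Set.mem_singleton _))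
    have key : ∀ f : W.CoordinateRing, algebraMap W.CoordinateRing W.FunctionField f ∈
        IntermediateField.adjoin F {ξ, η} := by
      intro f
      obtain ⟨p, q, rfl⟩ := WeierstrassCurve.Affine.CoordinateRing.exists_smul_basis_eq f
      rw [WeierstrassCurve.Affine.CoordinateRing.smul, WeierstrassCurve.Affine.CoordinateRing.smul,
        mul_one, map_add, map_mul, ← hC, ← hC]
      exact add_mem (aeval_mem _ hx p) (mul_mem (aeval_mem _ hx q) hy)
    exact div_mem (key n) (key d)

/-! ### The place at infinity of a cubic -/

namespace IsGenericPoint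

variable {F K : Type*} [Field F] [Field K] [Algebra F K] {a b c : F} {x y : K}

lemma isTrivialOn {V : ValuationSubring K} (hV : ∀ t : F, algebraMap F K t ∈ V) :
    V.valuation.IsTrivialOn F := by
  refine ⟨fun t ht => le_antisymm ((V.valuation_le_one_iff _).mpr (hV t)) ?_⟩
  have h1 := (V.valuation_le_one_iff _).mpr (hV t⁻¹)
  rw [map_inv₀, map_inv₀] at h1
  have h0 : V.valuation (algebraMap F K t) ≠ 0 := by simpa using ht
  exact (inv_le_one₀ (zero_lt_iff.mpr h0)).mp h1

lemma one_lt_valuation {V : ValuationSubring K} (hx : x ∉ V) : 1 < V.valuation x := by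
  rwa [← not_le, V.valuation_le_one_iff]

lemma valuation_y_sq (h : IsGenericPoint a b c x y) {V : ValuationSubring K}
    (hV : ∀ t : F, algebraMap F K t ∈ V) (hx : x ∉ V) :
    V.valuation y ^ 2 = V.valuation x ^ 3 := by
  have := isTrivialOn hV
  rw [← map_pow, h.sq_eq, valuation_aeval_eq_valuation_X_pow_natDegree_of_one_lt_valuation_X _
    (one_lt_valuation hx) (cubicPoly_ne_zero a b c), natDegree_cubicPoly]

open scoped Classical in
/-- The order of the pole of `p(x) + q(x) y` at infinity, where `x` and `y` have poles of order two
and three; it is `0` for `p = q = 0`. -/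
def poleOrder (p q : F[X]) : ℕ :=
  if q = 0 then 2 * p.natDegree else if p = 0 then 2 * q.natDegree + 3
    else max (2 * p.natDegree) (2 * q.natDegree + 3)

/-- At a place where `x` has a pole, the order of a regular function is its pole order at infinity;
since `x` has order two, the square of the value is compared with the powers of the value of `x`. -/
lemma valuation_sq (h : IsGenericPoint a b c x y) {V : ValuationSubring K}
    (hV : ∀ t : F, algebraMap F K t ∈ V) (hx : x ∉ V) (p q : F[X]) (hpq : p ≠ 0 ∨ q ≠ 0) :
    V.valuation (aeval x p + aeval x q * y) ^ 2 = V.valuation x ^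
      poleOrder p q := by
  unfold poleOrder
  have := isTrivialOn hV
  have hx1 := one_lt_valuation hx
  have hx0 : V.valuation x ≠ 0 := (zero_lt_one.trans hx1).ne'
  have hp : p ≠ 0 → V.valuation (aeval x p) ^ 2 = V.valuation x ^ (2 * p.natDegree) := fun h0 => by
    rw [valuation_aeval_eq_valuation_X_pow_natDegree_of_one_lt_valuation_X _ hx1 h0, ← pow_mul,
      mul_comm]
  have hq : q ≠ 0 → V.valuation (aeval x q * y) ^ 2 = V.valuation x ^ (2 * q.natDegree + 3) :=
    fun h0 => by
      rw [map_mul, mul_pow, h.valuation_y_sq hV hx,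
        valuation_aeval_eq_valuation_X_pow_natDegree_of_one_lt_valuation_X _ hx1 h0, ← pow_mul,
        mul_comm q.natDegree, ← pow_add]
  by_cases hq0 : q = 0
  · subst hq0
    simp only [map_zero, zero_mul, add_zero, if_true]
    exact hp (by simpa using hpq)
  by_cases hp0 : p = 0
  · subst hp0
    simp only [map_zero, zero_add, if_true, if_neg hq0]
    exact hq hq0
  simp only [if_neg hq0, if_neg hp0]
  rcases lt_or_gt_of_ne (show 2 * p.natDegree ≠ 2 * q.natDegree + 3 by omega) with hlt | hlt
  · have hlt' : V.valuation (aeval x p) < V.valuation (aeval x q * y) := by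
      refine lt_of_pow_lt_pow_left₀ 2 (by exact zero_le) ?_
      rw [hp hp0, hq hq0]
      exact pow_lt_pow_right₀ hx1 hlt
    rw [max_eq_right hlt.le, ← hq hq0, V.valuation.map_add_of_distinct_val hlt'.ne,
      max_eq_right hlt'.le]
  · have hlt' : V.valuation (aeval x q * y) < V.valuation (aeval x p) := by
      refine lt_of_pow_lt_pow_left₀ 2 (by exact zero_le) ?_
      rw [hp hp0, hq hq0]
      exact pow_lt_pow_right₀ hx1 hlt
    rw [max_eq_left hlt.le, ← hp hp0, V.valuation.map_add_of_distinct_val hlt'.ne',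
      max_eq_left hlt'.le]

lemma exists_valuation_sq (h : IsGenericPoint a b c x y) (z : K) (hz : z ≠ 0) :
    ∃ m n : ℕ, ∀ V : ValuationSubring K, (∀ t : F, algebraMap F K t ∈ V) → x ∉ V →
      V.valuation z ^ 2 * V.valuation x ^ n = V.valuation x ^ m := by
  obtain ⟨p, q, r, hr, e⟩ := h.exists_eq_div z
  have hr0 : aeval x r ≠ 0 := fun h0 => hr (h.aeval_eq_zero h0)
  have hpq : p ≠ 0 ∨ q ≠ 0 := by
    by_contra! hcon
    obtain ⟨rfl, rfl⟩ := hcon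
    simp [hz, hr0] at e
  refine ⟨poleOrder p q, 2 * r.natDegree, fun V hV hx => ?_⟩
  rw [← h.valuation_sq hV hx p q hpq, ← e, map_mul, mul_pow]
  have := isTrivialOn hV
  rw [valuation_aeval_eq_valuation_X_pow_natDegree_of_one_lt_valuation_X _
    (one_lt_valuation hx) hr, ← pow_mul, mul_comm r.natDegree]

/-- A cubic has only one place at infinity: the value of a function is determined by its pole
order. -/
lemma valuationSubring_unique (h : IsGenericPoint a b c x y) {V V' : ValuationSubring K}
    (hV : ∀ t : F, algebraMap F K t ∈ V) (hV' : ∀ t : F, algebraMap F K t ∈ V')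
    (hx : x ∉ V) (hx' : x ∉ V') : V = V' := by
  ext z
  by_cases hz : z = 0
  · subst hz; simp [zero_mem]
  obtain ⟨m, n, hmn⟩ := h.exists_valuation_sq z hz
  have key : ∀ V : ValuationSubring K, (∀ t : F, algebraMap F K t ∈ V) → x ∉ V →
      (z ∈ V ↔ m ≤ n) := by
    intro V hV hx
    have e := hmn V hV hx
    have h1 := one_lt_valuation hx
    have hpos : 0 < V.valuation x ^ n := pow_pos (zero_lt_one.trans h1) n
    rw [← V.valuation_le_one_iff, ← pow_le_one_iff_of_nonneg zero_le two_ne_zero,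
      ← mul_le_mul_iff_left₀ hpos, one_mul, e, pow_le_pow_iff_right₀ h1]
  rw [key V hV hx, key V' hV' hx']

/-- The residue field of the place at infinity is the field of constants. -/
lemma exists_valuation_sub_lt_one (h : IsGenericPoint a b c x y) {V : ValuationSubring K}
    (hV : ∀ t : F, algebraMap F K t ∈ V) (hx : x ∉ V) {z : K} (hz : z ∈ V) :
    ∃ t : F, V.valuation (z - algebraMap F K t) < 1 := by
  obtain ⟨p, q, r, hr, e⟩ := h.exists_eq_div z
  have htr := isTrivialOn hV
  have hx1 := one_lt_valuation hx
  have hvr := valuation_aeval_eq_valuation_X_pow_natDegree_of_one_lt_valuation_X x hx1 hr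
  have hr0 : 0 < V.valuation (aeval x r) := by rw [hvr]; exact pow_pos (zero_lt_one.trans hx1) _
  -- it suffices to lower the pole order of the numerator below that of the denominator
  have key : ∀ (w : K) (p : F[X]), w * aeval x r = aeval x p + aeval x q * y →
      (p = 0 ∨ p.degree < r.degree) → (q = 0 ∨ 2 * q.natDegree + 3 < 2 * r.natDegree) →
      V.valuation w < 1 := by
    intro w p e hp hq
    rw [← mul_lt_mul_iff_left₀ hr0, one_mul, ← map_mul, e]
    refine (V.valuation.map_add _ _).trans_lt (max_lt ?_ ?_)
    · rcases eq_or_ne p 0 with rfl | hp0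
      · simpa using hr0
      · rw [hvr, valuation_aeval_eq_valuation_X_pow_natDegree_of_one_lt_valuation_X _ hx1 hp0]
        exact pow_lt_pow_right₀ hx1
          (natDegree_lt_natDegree hp0 (hp.resolve_left hp0))
    · rcases eq_or_ne q 0 with rfl | hq0
      · simpa using hr0
      · refine lt_of_pow_lt_pow_left₀ 2 zero_le ?_
        have := h.valuation_sq hV hx 0 q (Or.inr hq0)
        rw [map_zero, zero_add, poleOrder, if_neg hq0, if_pos rfl] at this
        rw [this, hvr, ← pow_mul]
        exact pow_lt_pow_right₀ hx1 (by have := hq.resolve_left hq0; omega)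
  by_cases h0 : p = 0 ∧ q = 0
  · refine ⟨0, ?_⟩
    rw [map_zero, sub_zero]
    exact key z p e (Or.inl h0.1) (Or.inl h0.2)
  have hle : V.valuation (aeval x p + aeval x q * y) ^ 2 ≤ V.valuation (aeval x r) ^ 2 := by
    rw [← e, map_mul, mul_pow]
    exact mul_le_of_le_one_left' (pow_le_one' ((V.valuation_le_one_iff z).mpr hz) 2)
  rw [h.valuation_sq hV hx p q (by tauto), hvr, ← pow_mul, pow_le_pow_iff_right₀ hx1,
    poleOrder] at hle
  have hq : q = 0 ∨ 2 * q.natDegree + 3 < 2 * r.natDegree := by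
    by_cases hq : q = 0
    · exact Or.inl hq
    · right
      rw [if_neg hq] at hle
      split_ifs at hle
      · omega
      · have := (le_max_right _ _).trans hle; omega
  have hp : p.natDegree ≤ r.natDegree := by
    by_cases hq : q = 0
    · rw [if_pos hq] at hle; omega
    · rw [if_neg hq] at hle
      split_ifs at hle with h1
      · simp [h1]
      · have := (le_max_left _ _).trans hle; omega
  refine ⟨p.coeff r.natDegree / r.leadingCoeff, key _ (p - C (p.coeff r.natDegree / r.leadingCoeff)
    * r) ?_ (Or.inr ?_) hq⟩
  · rw [sub_mul, e]; simp; ring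
  · rw [degree_eq_natDegree hr, degree_lt_iff_coeff_zero]
    intro m hm
    rw [coeff_sub, coeff_C_mul]
    rcases hm.eq_or_lt with rfl | hlt
    · rw [coeff_natDegree, div_mul_cancel₀ _ (leadingCoeff_ne_zero.mpr hr), sub_self]
    · rw [coeff_eq_zero_of_natDegree_lt hlt, coeff_eq_zero_of_natDegree_lt (hp.trans_lt hlt)]
      simp

/-- The integral closure of a subring is the intersection of the valuation rings containing it. -/
lemma exists_valuationSubring_of_not_isIntegral {s : Set K} {z : K}
    (hz : ¬ IsIntegral (Subring.closure s) z) : ∃ V : ValuationSubring K, s ⊆ V ∧ z ∉ V := by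
  by_contra! hcon
  apply hz
  have : z ∈ (integralClosure (Subring.closure s) K).toSubring := by
    rw [← iInf_valuationSubring_superset, Subring.mem_iInf]
    rintro ⟨V, hV⟩
    exact hcon V hV
  exact this

end IsGenericPoint

/-! ### Regular functions on the affine cubic -/

/-- The discriminant of the cubic `x³ + a x² + b x + c`. -/
def cubicDisc {R : Type*} [CommRing R] (a b c : R) : R :=
  a ^ 2 * b ^ 2 - 4 * b ^ 3 - 4 * a ^ 3 * c - 27 * c ^ 2 + 18 * a * b * c

lemma Δ_cubicModel {F : Type*} [Field F] (a b c : F) :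
    (cubicModel a b c).Δ = 16 * cubicDisc a b c := by
  simp only [WeierstrassCurve.Δ, WeierstrassCurve.b₂, WeierstrassCurve.b₄, WeierstrassCurve.b₆,
    WeierstrassCurve.b₈, cubicModel, cubicDisc]
  ring

namespace IsGenericPoint

variable {F K : Type*} [Field F] [Field K] [Algebra F K] {a b c : F} {x y : K}

lemma separable_cubicPoly [CharZero F] (hd : cubicDisc a b c ≠ 0) :
    (cubicPoly a b c).Separable := by
  rw [Separable]
  have h9 : (-9 * cubicDisc a b c) ≠ 0 := mul_ne_zero (by norm_num) hd
  -- two steps of Euclid's algorithm for the cubic and its derivative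
  refine ⟨C (-9 * cubicDisc a b c)⁻¹ * (-9 * (3 * C (6 * b - 2 * a ^ 2) * X +
      C (2 * a * (6 * b - 2 * a ^ 2) - 3 * (9 * c - a * b)))),
    C (-9 * cubicDisc a b c)⁻¹ * (C (6 * b - 2 * a ^ 2) ^ 2 + (3 * X + C a) *
      (3 * C (6 * b - 2 * a ^ 2) * X +
        C (2 * a * (6 * b - 2 * a ^ 2) - 3 * (9 * c - a * b)))), ?_⟩
  have e : (-9 * (3 * C (6 * b - 2 * a ^ 2) * X +
      C (2 * a * (6 * b - 2 * a ^ 2) - 3 * (9 * c - a * b)))) * cubicPoly a b c +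
    (C (6 * b - 2 * a ^ 2) ^ 2 + (3 * X + C a) *
      (3 * C (6 * b - 2 * a ^ 2) * X +
        C (2 * a * (6 * b - 2 * a ^ 2) - 3 * (9 * c - a * b)))) * derivative (cubicPoly a b c) =
      C (-9 * cubicDisc a b c) := by
    simp only [cubicPoly, cubicDisc, derivative_add, derivative_mul, derivative_X_pow, derivative_C,
      derivative_X, C_mul, C_sub, C_add, C_pow, C_neg, map_ofNat]
    simp only [Nat.cast_ofNat, Nat.add_one_sub_one, map_ofNat]
    ring
  rw [mul_assoc (C _), mul_assoc (C _), ← mul_add, e, ← C_mul, inv_mul_cancel₀ h9, C_1]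

lemma dvd_of_sq_dvd_mul_squarefree {r q f : F[X]} (hr : r ≠ 0) (hf : Squarefree f)
    (h : r * r ∣ q * q * f) : r ∣ q := by
  classical
  have hg : EuclideanDomain.gcd r q ≠ 0 := fun h0 => hr (EuclideanDomain.gcd_eq_zero_iff.mp h0).1
  have h3 := EuclideanDomain.gcd_eq_gcd_ab r q
  obtain ⟨r₁, hr₁⟩ := EuclideanDomain.gcd_dvd_left r q
  obtain ⟨q₁, hq₁⟩ := EuclideanDomain.gcd_dvd_right r q
  generalize EuclideanDomain.gcd r q = g at hg h3 hr₁ hq₁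
  generalize EuclideanDomain.gcdA r q = A at h3
  generalize EuclideanDomain.gcdB r q = B at h3
  subst hr₁ hq₁
  have hcop : IsCoprime r₁ q₁ := by
    refine ⟨A, B, mul_left_cancel₀ hg ?_⟩
    linear_combination -h3
  have hsq1 : r₁ * r₁ ∣ q₁ * q₁ * f := by
    obtain ⟨t, ht⟩ := h
    refine ⟨t, mul_left_cancel₀ (mul_ne_zero hg hg) ?_⟩
    linear_combination ht
  have hcop2 : IsCoprime (r₁ * r₁) (q₁ * q₁) := by
    have := hcop.pow (m := 2) (n := 2)
    rwa [pow_two, pow_two] at this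
  exact mul_dvd_mul_left _ (hf r₁ (hcop2.dvd_of_dvd_mul_left hsq1)).dvd

/-- The hyperelliptic involution. -/
lemma neg (h : IsGenericPoint a b c x y) : IsGenericPoint a b c x (-y) := by
  refine ⟨by rw [neg_sq, h.equation], h.transcendental, ?_⟩
  rw [eq_top_iff, ← h.adjoin_eq_top, IntermediateField.adjoin_le_iff]
  rintro t (rfl | rfl)
  · exact IntermediateField.subset_adjoin F _ (Set.mem_insert _ _)
  · rw [SetLike.mem_coe, ← neg_mem_iff]
    exact IntermediateField.subset_adjoin F _ (Set.mem_insert_of_mem _ (Set.mem_singleton _))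

lemma functionFieldEquiv_algebraMap (h : IsGenericPoint a b c x y)
    (z : (cubicModel a b c).toAffine.CoordinateRing) :
    h.functionFieldEquiv (algebraMap _ _ z) = h.evalHom z :=
  IsFractionRing.lift_algebraMap h.evalHom_injective z

lemma functionFieldEquiv_x (h : IsGenericPoint a b c x y) :
    h.functionFieldEquiv (algebraMap (cubicModel a b c).toAffine.CoordinateRing _
      (WeierstrassCurve.Affine.CoordinateRing.mk _ (C X))) = x := by
  rw [functionFieldEquiv_algebraMap, evalHom_mk]; simp

lemma functionFieldEquiv_y (h : IsGenericPoint a b c x y) :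
    h.functionFieldEquiv (algebraMap (cubicModel a b c).toAffine.CoordinateRing _
      (WeierstrassCurve.Affine.CoordinateRing.mk _ X)) = y := by
  rw [functionFieldEquiv_algebraMap, evalHom_mk]; simp

/-- The hyperelliptic involution, as an automorphism of the function field. -/
lemma exists_involution (h : IsGenericPoint a b c x y) : ∃ φ : K ≃ₐ[F] K, φ x = x ∧ φ y = -y := by
  refine ⟨h.functionFieldEquiv.symm.trans h.neg.functionFieldEquiv, ?_, ?_⟩
  · rw [AlgEquiv.trans_apply, (AlgEquiv.symm_apply_eq _).mpr h.functionFieldEquiv_x.symm,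
      functionFieldEquiv_x]
  · rw [AlgEquiv.trans_apply, (AlgEquiv.symm_apply_eq _).mpr h.functionFieldEquiv_y.symm,
      functionFieldEquiv_y]

/-- A rational function of `x` that is integral over `F[x]` is a polynomial in `x`. -/
lemma exists_eq_aeval_of_isIntegral (hx : Transcendental F x) {w : K} {p r : F[X]} (hr : r ≠ 0)
    (e : w * aeval x r = aeval x p)
    (hw : ∃ P : F[X][X], P.Monic ∧ P.eval₂ ((aeval x : F[X] →ₐ[F] K) : F[X] →+* K) w = 0) :
    ∃ P : F[X], w = aeval x P := by
  have hinj : Function.Injective ((aeval x : F[X] →ₐ[F] K) : F[X] →+* K) :=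
    transcendental_iff_injective.mp hx
  let ι : FractionRing F[X] →+* K := IsFractionRing.lift hinj
  have hι : ∀ p : F[X], ι (algebraMap F[X] _ p) = aeval x p :=
    fun p => IsFractionRing.lift_algebraMap hinj p
  let g : FractionRing F[X] := algebraMap F[X] _ p / algebraMap F[X] _ r
  have hr0 : aeval x r ≠ 0 := fun h0 => hr (hinj (h0.trans (map_zero _).symm))
  have hg : ι g = w := by
    rw [map_div₀, hι, hι, ← e, mul_div_cancel_right₀ _ hr0]
  have hint : IsIntegral F[X] g := by
    obtain ⟨P, hP, hPw⟩ := hw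
    refine ⟨P, hP, ι.injective ?_⟩
    rw [map_zero, hom_eval₂, hg, ← hPw]
    congr 1
    ext p
    · simp [hι]
    · simp [hι]
  obtain ⟨P, hP⟩ := IsIntegrallyClosed.isIntegral_iff.mp hint
  exact ⟨P, by rw [← hg, ← hP, hι]⟩

/-- The coordinate ring of a smooth affine cubic is integrally closed: functions
that are integral over `F[x]` are of the form `p(x) + q(x) y`. -/
lemma exists_eq_add_of_isIntegral [CharZero F] (h : IsGenericPoint a b c x y)
    (hd : cubicDisc a b c ≠ 0) {z : K}
    (hz : ∃ P : F[X][X], P.Monic ∧ P.eval₂ ((aeval x : F[X] →ₐ[F] K) : F[X] →+* K) z = 0) :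
    ∃ p q : F[X], z = aeval x p + aeval x q * y := by
  let _ : Algebra F[X] K := ((aeval x : F[X] →ₐ[F] K) : F[X] →+* K).toAlgebra
  have halg : ∀ p : F[X], algebraMap F[X] K p = aeval x p := fun _ => rfl
  have hz' : IsIntegral F[X] z := hz
  obtain ⟨φ, hφx, hφy⟩ := h.exists_involution
  have hφa : ∀ p : F[X], φ (aeval x p) = aeval x p := fun p => by
    rw [← aeval_algHom_apply, hφx]
  let φ' : K →ₐ[F[X]] K := { (φ : K →+* K) with commutes' := fun p => hφa p }
  have hφz : IsIntegral F[X] (φ z) := hz'.map φ'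
  obtain ⟨p, q, r, hr, e⟩ := h.exists_eq_div z
  have hr0 : aeval x r ≠ 0 := fun h0 => hr (h.aeval_eq_zero h0)
  have e' : φ z * aeval x r = aeval x p - aeval x q * y := by
    have := congrArg φ e
    rw [map_mul, map_add, map_mul, hφa, hφa, hφa, hφy] at this
    rw [this]; ring
  obtain ⟨P, hP⟩ := exists_eq_aeval_of_isIntegral h.transcendental (w := z + φ z) (p := 2 * p) hr
    (by rw [add_mul, e, e', map_mul, map_ofNat]; ring) (hz'.add hφz)
  have h2 : (2 : K) ≠ 0 := by
    have := (_root_.map_ne_zero (algebraMap F K)).mpr (two_ne_zero (α := F))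
    rwa [map_ofNat] at this
  have hPi : IsIntegral F[X] (algebraMap F[X] K (C 2⁻¹ * P)) := isIntegral_algebraMap
  -- the part of `z` that is anti-invariant under the involution
  set w := z - aeval x (C 2⁻¹ * P) with hw
  have hPz : aeval x (C 2⁻¹ * P) = (z + φ z) / 2 := by
    rw [hP, map_mul, aeval_C, map_inv₀, map_ofNat]; field_simp
  have hwr : w * aeval x r = aeval x q * y := by
    rw [hw, hPz]
    have : (2:K) * ((z - (z + φ z) / 2) * aeval x r) = 2 * (aeval x q * y) := by
      have : (2:K) * ((z - (z + φ z) / 2) * aeval x r) = z * aeval x r - φ z * aeval x r := by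
        field_simp; ring
      rw [this, e, e']; ring
    exact mul_left_cancel₀ h2 this
  have hwi : IsIntegral F[X] w := hz'.sub hPi
  have hf : cubicPoly a b c ≠ 0 := cubicPoly_ne_zero a b c
  have hw2 : w ^ 2 * aeval x (r ^ 2) = aeval x (q ^ 2 * cubicPoly a b c) := by
    rw [map_pow, map_mul, map_pow, ← h.sq_eq, ← mul_pow, hwr, mul_pow]
  obtain ⟨N, hN⟩ := exists_eq_aeval_of_isIntegral h.transcendental (pow_ne_zero 2 hr) hw2
    (hwi.pow 2)
  have hpoly : N * r ^ 2 = q ^ 2 * cubicPoly a b c := by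
    rw [hN, ← map_mul] at hw2
    exact transcendental_iff_injective.mp h.transcendental hw2
  have hdvd : r ∣ q := dvd_of_sq_dvd_mul_squarefree hr (separable_cubicPoly hd).squarefree
    ⟨N, by linear_combination -hpoly⟩
  obtain ⟨Q, rfl⟩ := hdvd
  refine ⟨C 2⁻¹ * P, Q, ?_⟩
  have : w = aeval x Q * y := by
    apply mul_right_cancel₀ hr0
    rw [hwr, map_mul]; ring
  rw [← this, hw]; ring

end IsGenericPoint

/-! ### Translations and isomorphisms of function fields -/

namespace IsGenericPoint

variable {F K : Type*} [Field F] [Field K] [Algebra F K] {a b c : F} {x y : K}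

open WeierstrassCurve in
lemma nonsingular_map [CharZero F] (hd : cubicDisc a b c ≠ 0) {M : Type*} [Field M] [Algebra F M]
    {x y : M}
    (e : y ^ 2 = x ^ 3 + algebraMap F M a * x ^ 2 + algebraMap F M b * x + algebraMap F M c) :
    ((cubicModel a b c).baseChange M).toAffine.Nonsingular x y := by
  rw [← Affine.equation_iff_nonsingular_of_Δ_ne_zero]
  · rw [Affine.equation_iff]
    simp [cubicModel, WeierstrassCurve.baseChange, e]
  · rw [WeierstrassCurve.baseChange, map_Δ, Δ_cubicModel]
    simpa using hd

lemma isAlgebraic_of_isAlgebraic (e : y ^ 2 = x ^ 3 + algebraMap F K a * x ^ 2 +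
      algebraMap F K b * x + algebraMap F K c) (hx : IsAlgebraic F x) : IsAlgebraic F y := by
  rw [isAlgebraic_iff_isIntegral] at hx ⊢
  refine IsIntegral.of_pow two_pos ?_
  rw [e]
  exact (((hx.pow 3).add (isIntegral_algebraMap.mul (hx.pow 2))).add
    (isIntegral_algebraMap.mul hx)).add isIntegral_algebraMap

/-- A solution of the equation with coordinates that generate `F(x, y)` is a generic point. -/
lemma of_mem_adjoin (h : IsGenericPoint a b c x y) {a' b' c' : F} {X Y : K}
    (e : Y ^ 2 = X ^ 3 + algebraMap F K a' * X ^ 2 + algebraMap F K b' * X + algebraMap F K c')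
    (hx : x ∈ IntermediateField.adjoin F {X, Y}) (hy : y ∈ IntermediateField.adjoin F {X, Y}) :
    IsGenericPoint a' b' c' X Y := by
  refine ⟨e, ?_, ?_⟩
  · by_contra hX
    rw [Transcendental, not_not] at hX
    have hY := isAlgebraic_of_isAlgebraic e hX
    have : Algebra.IsAlgebraic F (IntermediateField.adjoin F {X, Y}) := by
      apply IntermediateField.isAlgebraic_adjoin
      rintro t (rfl | rfl)
      · exact hX.isIntegral
      · exact hY.isIntegral
    exact h.transcendental ((isAlgebraic_algebraMap_iff
      (IntermediateField.adjoin F {X, Y}).val.injective).mpr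
        (this.isAlgebraic ⟨x, hx⟩))
  · rw [eq_top_iff, ← h.adjoin_eq_top, IntermediateField.adjoin_le_iff]
    rintro t (rfl | rfl)
    exacts [hx, hy]

open WeierstrassCurve in
/-- Translation by the rational point `(x₀, -y₀)`. The translated point still generates the function
field, because translating back recovers `(x, y)`. -/
lemma translate [CharZero F] (h : IsGenericPoint a b c x y) (hd : cubicDisc a b c ≠ 0) {x₀ y₀ : F}
    (h₀ : y₀ ^ 2 = x₀ ^ 3 + a * x₀ ^ 2 + b * x₀ + c) : ∃ X Y : K, IsGenericPoint a b c X Y ∧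
      X = ((y + algebraMap F K y₀) / (x - algebraMap F K x₀)) ^ 2 - algebraMap F K a - x
        - algebraMap F K x₀ := by
  classical
  let W := cubicModel a b c
  have hxne : x ≠ algebraMap F K x₀ := by
    rintro rfl
    exact h.transcendental (isAlgebraic_algebraMap x₀)
  have hQ : ∀ (M : Type _) [Field M] [Algebra F M], (algebraMap F M y₀) ^ 2 =
      (algebraMap F M x₀) ^ 3 + algebraMap F M a * (algebraMap F M x₀) ^ 2 +
        algebraMap F M b * (algebraMap F M x₀) + algebraMap F M c := fun M _ _ => by
    rw [← map_pow, h₀]; simp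
  let G : (W.baseChange K).toAffine.Point := .some x y (nonsingular_map hd h.equation)
  let Q : (W.baseChange K).toAffine.Point :=
    .some (algebraMap F K x₀) (algebraMap F K y₀) (nonsingular_map hd (hQ K))
  have hneg : (-Q) = .some (algebraMap F K x₀) (algebraMap F K (-y₀))
      (nonsingular_map hd (by rw [map_neg, neg_sq]; exact hQ K)) := by
    rw [Affine.Point.neg_some]
    congr 1
    simp [Affine.negY, W, cubicModel, WeierstrassCurve.baseChange]
  obtain ⟨X, Y, hXY, hX, hsum⟩ : ∃ (X Y : K) (hXY : (W.baseChange K).toAffine.Nonsingular X Y),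
      X = ((y + algebraMap F K y₀) / (x - algebraMap F K x₀)) ^ 2 - algebraMap F K a - x
        - algebraMap F K x₀ ∧ G + -Q = .some X Y hXY := by
    rw [hneg]
    refine ⟨_, _, _, ?_, Affine.Point.add_of_X_ne hxne⟩
    rw [Affine.slope_of_X_ne hxne]
    simp [Affine.addX, W, cubicModel, WeierstrassCurve.baseChange]
  have e : Y ^ 2 = X ^ 3 + algebraMap F K a * X ^ 2 + algebraMap F K b * X + algebraMap F K c := by
    have := (Affine.equation_iff ..).mp hXY.1
    simpa [W, cubicModel, WeierstrassCurve.baseChange] using this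
  -- the same addition, performed over the field generated by the translated point
  let M := IntermediateField.adjoin F {X, Y}
  have hXM : X ∈ M := IntermediateField.subset_adjoin F _ (Set.mem_insert _ _)
  have hYM : Y ∈ M :=
    IntermediateField.subset_adjoin F _ (Set.mem_insert_of_mem _ (Set.mem_singleton _))
  let GM : (W.baseChange M).toAffine.Point := .some ⟨X, hXM⟩ ⟨Y, hYM⟩
    (nonsingular_map hd (Subtype.ext (by simpa using e)))
  let QM : (W.baseChange M).toAffine.Point :=
    .some (algebraMap F M x₀) (algebraMap F M y₀) (nonsingular_map hd (hQ M))
  have hmap : Affine.Point.map (W' := W) (S := F) M.val (GM + QM) = G := by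
    rw [map_add]
    have h1 : Affine.Point.map (W' := W) (S := F) M.val GM = G + -Q := by
      rw [hsum]; rfl
    have h2 : Affine.Point.map (W' := W) (S := F) M.val QM = Q := rfl
    rw [h1, h2, neg_add_cancel_right]
  have hmem : x ∈ M ∧ y ∈ M := by
    rcases hs : GM + QM with _ | ⟨x₁, y₁, h₁⟩
    · rw [hs] at hmap
      exact absurd hmap.symm (Affine.Point.some_ne_zero _)
    · rw [hs, Affine.Point.map_some] at hmap
      have hG := Affine.Point.some.inj hmap
      exact ⟨hG.1 ▸ x₁.2, hG.2 ▸ y₁.2⟩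
  exact ⟨X, Y, h.of_mem_adjoin e hmem.1 hmem.2, hX⟩

lemma eq_zero_of_valuation_lt_one {V : ValuationSubring K} (hV : ∀ t : F, algebraMap F K t ∈ V)
    {t : F} (ht : V.valuation (algebraMap F K t) < 1) : t = 0 := by
  by_contra h0
  have := isTrivialOn hV
  rw [this.eq_one t h0] at ht
  exact lt_irrefl _ ht

/-- Every place with residue field `F` is moved to infinity by a translation: it is the place at
infinity already, or it reduces `(x, y)` to a rational point `(x₀, y₀)`. -/
lemma exists_not_mem [CharZero F] (h : IsGenericPoint a b c x y) (hd : cubicDisc a b c ≠ 0)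
    {V : ValuationSubring K} (hV : ∀ t : F, algebraMap F K t ∈ V)
    (hres : ∀ z ∈ V, ∃ t : F, V.valuation (z - algebraMap F K t) < 1) :
    ∃ X Y : K, IsGenericPoint a b c X Y ∧ X ∉ V := by
  by_cases hx : x ∉ V
  · exact ⟨x, y, h, hx⟩
  rw [not_not] at hx
  have hsq : ∀ z : K, z ^ 2 ∈ V → z ∈ V := fun z hz => by
    rw [← V.valuation_le_one_iff, map_pow] at hz
    rw [← V.valuation_le_one_iff]
    exact (pow_le_one_iff_of_nonneg (by exact zero_le) two_ne_zero).mp hz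
  have hy : y ∈ V := hsq y <| by
    rw [h.equation]
    exact add_mem (add_mem (add_mem (pow_mem hx 3) (mul_mem (hV a) (pow_mem hx 2)))
      (mul_mem (hV b) hx)) (hV c)
  obtain ⟨x₀, hx₀⟩ := hres x hx
  obtain ⟨y₀, hy₀⟩ := hres y hy
  have hmul : ∀ {s t : K}, s ∈ V → V.valuation t < 1 → V.valuation (s * t) < 1 := by
    intro s t hs ht
    rw [map_mul]
    exact (mul_le_of_le_one_left' ((V.valuation_le_one_iff s).mpr hs)).trans_lt ht
  have hadd : ∀ {s t : K}, V.valuation s < 1 → V.valuation t < 1 → V.valuation (s + t) < 1 :=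
    fun hs ht => (V.valuation.map_add _ _).trans_lt (max_lt hs ht)
  have h₀ : y₀ ^ 2 = x₀ ^ 3 + a * x₀ ^ 2 + b * x₀ + c := by
    rw [← sub_eq_zero]
    apply eq_zero_of_valuation_lt_one hV
    have e : algebraMap F K (y₀ ^ 2 - (x₀ ^ 3 + a * x₀ ^ 2 + b * x₀ + c)) =
        (-(y + algebraMap F K y₀)) * (y - algebraMap F K y₀) +
        (x ^ 2 + x * algebraMap F K x₀ + algebraMap F K x₀ ^ 2 +
          algebraMap F K a * (x + algebraMap F K x₀) + algebraMap F K b) *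
          (x - algebraMap F K x₀) := by
      simp only [map_sub, map_add, map_mul, map_pow]
      linear_combination h.equation
    rw [e]
    exact hadd (hmul (neg_mem (add_mem hy (hV _))) hy₀) (hmul (add_mem (add_mem (add_mem (add_mem
      (pow_mem hx 2) (mul_mem hx (hV _))) (pow_mem (hV _) 2))
      (mul_mem (hV _) (add_mem hx (hV _)))) (hV _)) hx₀)
  obtain ⟨X, Y, hXY, hX⟩ := h.translate hd h₀
  -- if `X` had no pole, the slope `l` would have none, so both `y₀` and the derivative would vanish
  refine ⟨X, Y, hXY, fun hXV => ?_⟩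
  have hxne : x - algebraMap F K x₀ ≠ 0 := by
    rw [sub_ne_zero]
    rintro rfl
    exact h.transcendental (isAlgebraic_algebraMap x₀)
  set l := (y + algebraMap F K y₀) / (x - algebraMap F K x₀) with hl
  have hl2 : l ^ 2 ∈ V := by
    have : l ^ 2 = X + algebraMap F K a + x + algebraMap F K x₀ := by rw [hX]; ring
    rw [this]
    exact add_mem (add_mem (add_mem hXV (hV _)) hx) (hV _)
  have hlV := hsq l hl2
  have hle : l * (x - algebraMap F K x₀) = y + algebraMap F K y₀ := div_mul_cancel₀ _ hxne
  have hy0 : y₀ = 0 := by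
    have : (2 * y₀) = 0 := by
      apply eq_zero_of_valuation_lt_one hV
      have e : algebraMap F K (2 * y₀) =
          l * (x - algebraMap F K x₀) + (-1) * (y - algebraMap F K y₀) := by
        rw [hle, map_mul, map_ofNat]; ring
      rw [e]
      exact hadd (hmul hlV hx₀) (hmul (neg_mem (one_mem _)) hy₀)
    simpa using this
  subst hy0
  have hder : 3 * x₀ ^ 2 + 2 * a * x₀ + b = 0 := by
    apply eq_zero_of_valuation_lt_one hV
    have e : algebraMap F K (3 * x₀ ^ 2 + 2 * a * x₀ + b) =
        (l ^ 2 - (x + 2 * algebraMap F K x₀ + algebraMap F K a)) * (x - algebraMap F K x₀) := by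
      apply mul_right_cancel₀ hxne
      have h0 := congrArg (algebraMap F K) h₀
      simp only [map_add, map_mul, map_pow, map_zero, map_ofNat] at h0 hle ⊢
      linear_combination -h.equation + h0 - (l * (x - algebraMap F K x₀) + y) * hle
    rw [e]
    exact hmul (sub_mem hl2 (add_mem (add_mem hx (mul_mem (by exact_mod_cast natCast_mem V 2)
      (hV _))) (hV _))) hx₀
  have h1 : (cubicPoly a b c).eval x₀ = 0 := by
    simp only [cubicPoly, eval_add, eval_mul, eval_pow, eval_X, eval_C]
    linear_combination -h₀
  have h2 : (derivative (cubicPoly a b c)).eval x₀ = 0 := by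
    simp only [cubicPoly, derivative_add, derivative_mul, derivative_X_pow, derivative_C,
      derivative_X, eval_add, eval_mul, eval_pow, eval_X, eval_C, eval_zero, eval_one,
      Nat.cast_ofNat, Nat.add_one_sub_one, map_ofNat, eval_ofNat]
    linear_combination hder
  exact (separable_cubicPoly hd).eval₂_derivative_ne_zero (RingHom.id F) h1 h2

end IsGenericPoint

namespace IsGenericPoint

variable {F K : Type*} [Field F] [Field K] [Algebra F K] {a b c a' b' c' : F} {x y x' y' : K}

/-- Functions without poles away from infinity are of the form `p(x) + q(x) y`. -/
lemma exists_eq_add_of_forall_mem [CharZero F] (h : IsGenericPoint a b c x y)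
    (hd : cubicDisc a b c ≠ 0) {z : K}
    (hz : ∀ V : ValuationSubring K, (∀ t : F, algebraMap F K t ∈ V) → x ∈ V → z ∈ V) :
    ∃ p q : F[X], z = aeval x p + aeval x q * y := by
  apply h.exists_eq_add_of_isIntegral hd
  by_contra hcon
  have hint : ¬ IsIntegral (Subring.closure (Set.range (algebraMap F K) ∪ {x})) z := by
    rintro ⟨P, hP, hPz⟩
    apply hcon
    have hmem : ∀ s : Subring.closure (Set.range (algebraMap F K) ∪ {x}),
        (s : K) ∈ ((aeval x : F[X] →ₐ[F] K) : F[X] →+* K).range := by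
      rintro ⟨s, hs⟩
      revert s
      change Subring.closure _ ≤ _
      rw [Subring.closure_le]
      rintro _ (⟨t, rfl⟩ | rfl)
      · exact ⟨C t, by simp⟩
      · exact ⟨X, by simp⟩
    have hlift : P.map (algebraMap _ K) ∈ lifts ((aeval x : F[X] →ₐ[F] K) : F[X] →+* K) := by
      rw [lifts_iff_coeff_lifts]
      intro n
      rw [coeff_map]
      exact hmem _
    obtain ⟨Q, hQ, -, hQm⟩ := lifts_and_natDegree_eq_and_monic hlift (hP.map _)
    refine ⟨Q, hQm, ?_⟩
    rw [eval₂_eq_eval_map, hQ, ← eval₂_eq_eval_map]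
    exact hPz
  obtain ⟨V, hV, hzV⟩ := exists_valuationSubring_of_not_isIntegral hint
  exact hzV (hz V (fun t => hV (Or.inl ⟨t, rfl⟩)) (hV (Or.inr rfl)))

/-- The function `x` has a pole at some place. -/
lemma exists_not_mem_valuationSubring (h : IsGenericPoint a b c x y) :
    ∃ V : ValuationSubring K, (∀ t : F, algebraMap F K t ∈ V) ∧ x ∉ V := by
  have hint : ¬ IsIntegral (Subring.closure (Set.range (algebraMap F K))) x := by
    rintro ⟨P, hP, hPz⟩
    apply h.transcendental
    rw [isAlgebraic_iff_isIntegral]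
    have hmem : ∀ s : Subring.closure (Set.range (algebraMap F K)),
        (s : K) ∈ (algebraMap F K).range := by
      rintro ⟨s, hs⟩
      revert s
      change Subring.closure _ ≤ _
      rw [Subring.closure_le]
      exact subset_rfl
    have hlift : P.map (algebraMap _ K) ∈ lifts (algebraMap F K) := by
      rw [lifts_iff_coeff_lifts]
      intro n
      rw [coeff_map]
      exact hmem _
    obtain ⟨Q, hQ, -, hQm⟩ := lifts_and_natDegree_eq_and_monic hlift (hP.map _)
    refine ⟨Q, hQm, ?_⟩
    rw [eval₂_eq_eval_map, hQ, ← eval₂_eq_eval_map]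
    exact hPz
  obtain ⟨V, hV, hzV⟩ := exists_valuationSubring_of_not_isIntegral hint
  exact ⟨V, fun t => hV ⟨t, rfl⟩, hzV⟩

/-- Comparison of two generic points that are at infinity at the same place: the pole orders, two
and three, leave only affine linear expressions. -/
lemma exists_linear [CharZero F] (h : IsGenericPoint a b c x y) (h' : IsGenericPoint a' b' c' x' y')
    (hd : cubicDisc a b c ≠ 0) (hd' : cubicDisc a' b' c' ≠ 0) {V : ValuationSubring K}
    (hV : ∀ t : F, algebraMap F K t ∈ V) (hx : x ∉ V) (hx' : x' ∉ V) :
    ∃ r s t l m : F, x' = algebraMap F K r * x + algebraMap F K s ∧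
      y' = algebraMap F K t * y + algebraMap F K l * x + algebraMap F K m := by
  -- the coordinates of each point are regular functions of the other one
  have hreg : ∀ {a b c a' b' c' : F} {x y x' y' : K}, IsGenericPoint a b c x y →
      IsGenericPoint a' b' c' x' y' → cubicDisc a b c ≠ 0 → x ∉ V → x' ∉ V →
      ∃ p q : F[X], x' = aeval x p + aeval x q * y := by
    intro a b c a' b' c' x y x' y' h h' hd hx hx'
    refine h.exists_eq_add_of_forall_mem hd fun V' hV' hxV' => ?_
    by_contra hcon
    have := h'.valuationSubring_unique hV hV' hx' hcon
    subst this
    exact hx hxV'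
  obtain ⟨p, q, hpq⟩ := hreg h h' hd hx hx'
  obtain ⟨p', q', hpq'⟩ := hreg h' h hd' hx' hx
  have hx1 := one_lt_valuation hx
  have hne : ∀ {x y z : K} {p q : F[X]}, x ∉ V → x = aeval z p + aeval z q * y → p ≠ 0 ∨ q ≠ 0 := by
    intro x y z p q hx e
    by_contra! hcon
    obtain ⟨rfl, rfl⟩ := hcon
    apply hx
    rw [e]; simp [zero_mem]
  have e := h.valuation_sq hV hx p q (hne hx' hpq)
  have e' := h'.valuation_sq hV hx' p' q' (hne hx hpq')
  rw [← hpq] at e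
  rw [← hpq'] at e'
  -- the pole orders of `x` and `x'` at the common place at infinity divide each other
  have hmul : poleOrder p q * poleOrder p' q' = 4 := by
    have : V.valuation x ^ (poleOrder p q * poleOrder p' q') = V.valuation x ^ 4 := by
      rw [pow_mul, ← e, ← pow_mul, mul_comm, pow_mul, ← e', ← pow_mul]
    exact pow_right_injective₀ (zero_lt_one.trans hx1) hx1.ne' this
  have hone : ∀ p q : F[X], poleOrder p q ≠ 1 := by
    intro p q h1
    unfold poleOrder at h1
    split_ifs at h1
    · omega
    · omega
    · rcases max_choice (2 * p.natDegree) (2 * q.natDegree + 3) with h2 | h2 <;> omega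
  have hdiv : poleOrder p q ∣ 4 := ⟨_, hmul.symm⟩
  have hp2 : poleOrder p q = 2 := by
    have h1 := hone p q
    have h1' := hone p' q'
    have hle := Nat.le_of_dvd (by norm_num) hdiv
    interval_cases hN : poleOrder p q <;> omega
  have hval : V.valuation x' = V.valuation x := by
    rw [hp2] at e
    exact (pow_left_inj₀ (by exact zero_le) (by exact zero_le) two_ne_zero).mp e
  obtain ⟨hq0, hdeg⟩ : q = 0 ∧ p.natDegree ≤ 1 := by
    unfold poleOrder at hp2
    split_ifs at hp2 with h1 h2
    · exact ⟨h1, by omega⟩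
    · omega
    · have := le_max_right (2 * p.natDegree) (2 * q.natDegree + 3)
      omega
  subst hq0
  obtain ⟨P, Q, hPQ⟩ : ∃ P Q : F[X], y' = aeval x P + aeval x Q * y := by
    refine h.exists_eq_add_of_forall_mem hd fun V' hV' hxV' => ?_
    have hx'V' : x' ∈ V' := by
      rw [hpq, map_zero, zero_mul, add_zero, aeval_eq_sum_range]
      exact sum_mem fun i _ => by
        rw [Algebra.smul_def]; exact mul_mem (hV' _) (pow_mem hxV' i)
    have hsq : y' ^ 2 ∈ V' := by
      rw [h'.equation]
      exact add_mem (add_mem (add_mem (pow_mem hx'V' 3) (mul_mem (hV' _) (pow_mem hx'V' 2)))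
        (mul_mem (hV' _) hx'V')) (hV' _)
    rw [← V'.valuation_le_one_iff, map_pow] at hsq
    rw [← V'.valuation_le_one_iff]
    exact (pow_le_one_iff_of_nonneg (by exact zero_le) two_ne_zero).mp hsq
  have hyV := h'.valuation_y_sq hV hx'
  have hPQ0 : P ≠ 0 ∨ Q ≠ 0 := by
    by_contra! hcon
    obtain ⟨rfl, rfl⟩ := hcon
    rw [map_zero, zero_mul, add_zero] at hPQ
    rw [hPQ, map_zero, hval, zero_pow two_ne_zero] at hyV
    exact (pow_ne_zero 3 (zero_lt_one.trans hx1).ne') hyV.symm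
  have hP3 : poleOrder P Q = 3 := by
    have := h.valuation_sq hV hx P Q hPQ0
    rw [← hPQ, hyV, hval] at this
    exact (pow_right_injective₀ (zero_lt_one.trans hx1) hx1.ne' this).symm
  obtain ⟨hQ, hP⟩ : Q.natDegree = 0 ∧ P.natDegree ≤ 1 := by
    unfold poleOrder at hP3
    split_ifs at hP3 with h1 h2
    · omega
    · exact ⟨by omega, by simp [h2]⟩
    · have h3 := le_max_right (2 * P.natDegree) (2 * Q.natDegree + 3)
      have h4 := le_max_left (2 * P.natDegree) (2 * Q.natDegree + 3)
      omega
  refine ⟨p.coeff 1, p.coeff 0, Q.coeff 0, P.coeff 1, P.coeff 0, ?_, ?_⟩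
  · rw [hpq, eq_X_add_C_of_natDegree_le_one hdeg]; simp
  · rw [hPQ, eq_C_of_natDegree_eq_zero hQ, eq_X_add_C_of_natDegree_le_one hP]; simp; ring

/-- If a field is the function field of two elliptic curves over `F`, then the curves are
isomorphic: after a translation on the second one, their points at infinity belong to the same
place. -/
theorem exists_variableChange [CharZero F] (h : IsGenericPoint a b c x y)
    (h' : IsGenericPoint a' b' c' x' y') (hd : cubicDisc a b c ≠ 0)
    (hd' : cubicDisc a' b' c' ≠ 0) :
    ∃ v : WeierstrassCurve.VariableChange F, v • cubicModel a' b' c' = cubicModel a b c := by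
  obtain ⟨V, hV, hx⟩ := h.exists_not_mem_valuationSubring
  obtain ⟨X', Y', h', hX'⟩ := h'.exists_not_mem hd' hV
    (fun z hz => h.exists_valuation_sub_lt_one hV hx hz)
  obtain ⟨r, s, t, l, m, hX, hY⟩ := h.exists_linear h' hd hd' hV hx hX'
  have e := h'.equation
  rw [hX, hY] at e
  have hzero := h.eq_zero_of_add_eq_zero (p := C (t ^ 2) * cubicPoly a b c + (C l * X + C m) ^ 2 -
      ((C r * X + C s) ^ 3 + C a' * (C r * X + C s) ^ 2 + C b' * (C r * X + C s) + C c'))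
    (q := C (2 * t) * (C l * X + C m)) (by
      simp only [map_sub, map_add, map_mul, map_pow, aeval_C, aeval_X, map_ofNat, ← h.sq_eq]
      linear_combination e)
  obtain ⟨hp, hq⟩ := hzero
  have hr : r ≠ 0 := by
    rintro rfl
    apply hX'
    rw [hX, map_zero, zero_mul, zero_add]
    exact hV s
  have hexp : C (t ^ 2) * cubicPoly a b c + (C l * X + C m) ^ 2 -
      ((C r * X + C s) ^ 3 + C a' * (C r * X + C s) ^ 2 + C b' * (C r * X + C s) + C c') =
      C (t ^ 2 - r ^ 3) * X ^ 3 + C (t ^ 2 * a + l ^ 2 - 3 * r ^ 2 * s - a' * r ^ 2) * X ^ 2 +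
      C (t ^ 2 * b + 2 * l * m - 3 * r * s ^ 2 - 2 * a' * r * s - b' * r) * X +
      C (t ^ 2 * c + m ^ 2 - s ^ 3 - a' * s ^ 2 - b' * s - c') := by
    simp only [cubicPoly, map_sub, map_add, map_mul, map_pow, map_ofNat]
    ring
  rw [hexp] at hp
  have c3 : t ^ 2 - r ^ 3 = 0 := by
    have := congrArg (coeff · 3) hp
    simpa [coeff_X, coeff_C, coeff_X_pow, -map_sub, -map_mul, -map_pow, -map_add] using this
  have c2 : t ^ 2 * a + l ^ 2 - 3 * r ^ 2 * s - a' * r ^ 2 = 0 := by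
    have := congrArg (coeff · 2) hp
    simpa [coeff_X, coeff_C, coeff_X_pow, -map_sub, -map_mul, -map_pow, -map_add] using this
  have c1 : t ^ 2 * b + 2 * l * m - 3 * r * s ^ 2 - 2 * a' * r * s - b' * r = 0 := by
    have := congrArg (coeff · 1) hp
    simpa [coeff_X, coeff_C, coeff_X_pow, -map_sub, -map_mul, -map_pow, -map_add] using this
  have c0 : t ^ 2 * c + m ^ 2 - s ^ 3 - a' * s ^ 2 - b' * s - c' = 0 := by
    have := congrArg (coeff · 0) hp
    simpa [coeff_X, coeff_C, coeff_X_pow, -map_sub, -map_mul, -map_pow, -map_add] using this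
  have ht : t ≠ 0 := by
    rintro rfl
    simp [hr] at c3
  have hlm : C l * X + C m = 0 := by
    rcases mul_eq_zero.mp hq with h0 | h0
    · rw [C_eq_zero] at h0
      simp [ht] at h0
    · exact h0
  have hl : l = 0 := by simpa [coeff_X, coeff_C] using congrArg (coeff · 1) hlm
  have hm : m = 0 := by simpa [coeff_X, coeff_C] using congrArg (coeff · 0) hlm
  subst hl hm
  have ht2 : t ^ 2 = r ^ 3 := sub_eq_zero.mp c3
  -- the scaling factor is `t / r`, with square `r` and cube `t`
  have hu2 : (r / t) ^ 2 = r⁻¹ := by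
    rw [div_pow, ht2]; field_simp
  have hu4 : (r / t) ^ 4 = r⁻¹ ^ 2 := by rw [← hu2]; ring
  have hu6 : (r / t) ^ 6 = r⁻¹ ^ 3 := by rw [← hu2]; ring
  refine ⟨⟨Units.mk0 (t / r) (div_ne_zero ht hr), s, 0, 0⟩, ?_⟩
  rw [ht2] at c2 c1 c0
  ext
  · simp [WeierstrassCurve.variableChange_a₁, cubicModel]
  · simp only [WeierstrassCurve.variableChange_a₂, cubicModel, Units.val_inv_eq_inv_val,
      Units.val_mk0, inv_div, hu2]
    field_simp
    apply mul_left_cancel₀ (pow_ne_zero 2 hr)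
    linear_combination -c2
  · simp [WeierstrassCurve.variableChange_a₃, cubicModel]
  · simp only [WeierstrassCurve.variableChange_a₄, cubicModel, Units.val_inv_eq_inv_val,
      Units.val_mk0, inv_div, hu4]
    field_simp
    apply mul_left_cancel₀ hr
    linear_combination -c1
  · simp only [WeierstrassCurve.variableChange_a₆, cubicModel, Units.val_inv_eq_inv_val,
      Units.val_mk0, inv_div, hu6]
    field_simp
    linear_combination -c0

end IsGenericPoint

/-! ### Orders of vanishing on the projective line -/

section Order

variable {k : Type*} [Field k]

open scoped Classical in
/-- The order of a nonzero rational function at a point of the projective line, as an integer. -/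
def ordZ (p : OnePoint k) (f : RatFunc k) : ℤ :=
  p.elim (-f.intDegree)
    (fun a => (f.num.rootMultiplicity a : ℤ) - (f.denom.rootMultiplicity a : ℤ))

lemma ordAt_of_ne_zero (p : OnePoint k) {f : RatFunc k} (hf : f ≠ 0) :
    ordAt p f = (ordZ p f : WithTop ℤ) := by
  rw [ordAt, if_neg hf]; rfl

@[simp] lemma ordAt_zero (p : OnePoint k) : ordAt p (0 : RatFunc k) = ⊤ := if_pos rfl

lemma ordZ_infty (f : RatFunc k) : ordZ OnePoint.infty f = -f.intDegree := rfl

lemma ordZ_coe_div (a : k) {P Q : k[X]} (hP : P ≠ 0) (hQ : Q ≠ 0) :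
    ordZ (a : OnePoint k) (algebraMap k[X] (RatFunc k) P / algebraMap k[X] (RatFunc k) Q) =
      (P.rootMultiplicity a : ℤ) - Q.rootMultiplicity a := by
  set f := algebraMap k[X] (RatFunc k) P / algebraMap k[X] (RatFunc k) Q with hf
  have hQ' : algebraMap k[X] (RatFunc k) Q ≠ 0 := RatFunc.algebraMap_ne_zero hQ
  have hf0 : f ≠ 0 := div_ne_zero (RatFunc.algebraMap_ne_zero hP) hQ'
  have hn : f.num ≠ 0 := RatFunc.num_ne_zero hf0
  have e : f.num * Q = P * f.denom := (RatFunc.num_mul_eq_mul_denom_iff hQ).mpr rfl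
  have := congrArg (rootMultiplicity a) e
  rw [rootMultiplicity_mul (mul_ne_zero hn hQ),
    rootMultiplicity_mul (mul_ne_zero hP f.denom_ne_zero)] at this
  change (f.num.rootMultiplicity a : ℤ) - (f.denom.rootMultiplicity a : ℤ) = _
  omega

lemma ordZ_coe_algebraMap (a : k) {P : k[X]} (hP : P ≠ 0) :
    ordZ (a : OnePoint k) (algebraMap k[X] (RatFunc k) P) = P.rootMultiplicity a := by
  have := ordZ_coe_div a hP one_ne_zero
  rw [map_one, div_one] at this
  rw [this, ← C_1, rootMultiplicity_C]; simp

lemma ordZ_infty_algebraMap (P : k[X]) :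
    ordZ OnePoint.infty (algebraMap k[X] (RatFunc k) P) = -(P.natDegree : ℤ) := by
  rw [ordZ_infty, RatFunc.intDegree_polynomial]

lemma ordZ_mul (p : OnePoint k) {f g : RatFunc k} (hf : f ≠ 0) (hg : g ≠ 0) :
    ordZ p (f * g) = ordZ p f + ordZ p g := by
  induction p using OnePoint.rec with
  | infty => simp only [ordZ_infty, RatFunc.intDegree_mul hf hg]; ring
  | coe a =>
    have h : f * g = algebraMap k[X] (RatFunc k) (f.num * g.num) /
        algebraMap k[X] (RatFunc k) (f.denom * g.denom) := by
      conv_lhs => rw [← f.num_div_denom, ← g.num_div_denom]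
      rw [map_mul, map_mul, div_mul_div_comm]
    have hn := mul_ne_zero (RatFunc.num_ne_zero hf) (RatFunc.num_ne_zero hg)
    have hd := mul_ne_zero f.denom_ne_zero g.denom_ne_zero
    rw [h, ordZ_coe_div a hn hd, rootMultiplicity_mul hn, rootMultiplicity_mul hd]
    change _ = (f.num.rootMultiplicity a : ℤ) - (f.denom.rootMultiplicity a : ℤ) +
      ((g.num.rootMultiplicity a : ℤ) - (g.denom.rootMultiplicity a : ℤ))
    push_cast; ring

lemma ordZ_one (p : OnePoint k) : ordZ p (1 : RatFunc k) = 0 := by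
  have := ordZ_mul p (one_ne_zero (α := RatFunc k)) (one_ne_zero (α := RatFunc k))
  rw [mul_one] at this
  omega

lemma ordZ_C (p : OnePoint k) {c : k} (hc : c ≠ 0) : ordZ p (RatFunc.C c) = 0 := by
  rw [← RatFunc.algebraMap_C]
  induction p using OnePoint.rec with
  | infty => rw [ordZ_infty_algebraMap]; simp
  | coe a => rw [ordZ_coe_algebraMap a (C_ne_zero.mpr hc), rootMultiplicity_C]; simp

lemma ordZ_inv (p : OnePoint k) {f : RatFunc k} (hf : f ≠ 0) : ordZ p f⁻¹ = -ordZ p f := by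
  have := ordZ_mul p hf (inv_ne_zero hf)
  rw [mul_inv_cancel₀ hf, ordZ_one] at this
  omega

lemma ordZ_pow (p : OnePoint k) {f : RatFunc k} (hf : f ≠ 0) (n : ℕ) :
    ordZ p (f ^ n) = n * ordZ p f := by
  induction n with
  | zero => simp [ordZ_one]
  | succ n ih => rw [pow_succ, ordZ_mul p (pow_ne_zero n hf) hf, ih]; push_cast; ring

/-- The order of a linear polynomial. -/
lemma ordZ_linear (p : OnePoint k) {e f : k} (h : e ≠ 0 ∨ f ≠ 0) :
    ordZ p (algebraMap k[X] (RatFunc k) (C e * X + C f)) =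
      p.elim (open Classical in if e = 0 then 0 else -1)
        (fun a => open Classical in if e * a + f = 0 then 1 else 0) := by
  have hne : (C e * X + C f : k[X]) ≠ 0 := by
    intro h0
    have h1 : e = 0 := by simpa [coeff_X, coeff_C] using congrArg (coeff · 1) h0
    have h2 : f = 0 := by simpa [coeff_X, coeff_C] using congrArg (coeff · 0) h0
    tauto
  induction p using OnePoint.rec with
  | infty =>
    rw [ordZ_infty_algebraMap, OnePoint.elim_infty]
    by_cases he : e = 0
    · simp [he]
    · rw [if_neg he, natDegree_linear he]; simp
  | coe a =>
    rw [ordZ_coe_algebraMap a hne, OnePoint.elim_some]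
    by_cases h0 : e * a + f = 0
    · rw [if_pos h0]
      have he : e ≠ 0 := by rintro rfl; simp at h0; simp [h0] at h
      have : (C e * X + C f : k[X]) = C e * (X - C a) := by
        have : f = -(e * a) := by linear_combination h0
        rw [this]; simp; ring
      rw [this, rootMultiplicity_mul (by rw [← this]; exact hne), rootMultiplicity_C,
        rootMultiplicity_X_sub_C_self]; simp
    · rw [if_neg h0, rootMultiplicity_eq_zero]
      · simp
      · simpa [IsRoot] using h0

/-! ### Automorphisms of the field of rational functions -/

/-- An automorphism of `k(u)` over `k` is a linear fractional transformation. -/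
lemma exists_map_X_eq (τ : RatFunc k ≃ₐ[k] RatFunc k) :
    ∃ α β γ δ : k, α * δ - β * γ ≠ 0 ∧
      τ RatFunc.X = algebraMap k[X] (RatFunc k) (C α * X + C β) /
        algebraMap k[X] (RatFunc k) (C γ * X + C δ) := by
  set f := τ RatFunc.X with hf
  have htop : IntermediateField.adjoin k {f} = ⊤ := by
    have h1 := congrArg (IntermediateField.map (τ : RatFunc k →ₐ[k] RatFunc k))
      (RatFunc.adjoin_X (K := k))
    rw [IntermediateField.adjoin_map, Set.image_singleton] at h1
    rw [hf]
    refine h1.trans ?_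
    rw [← AlgHom.fieldRange_eq_map]
    exact (AlgHom.fieldRange_eq_top).mpr τ.surjective
  have hdeg : max f.num.natDegree f.denom.natDegree = 1 := by
    rw [← RatFunc.finrank_eq_max_natDegree, htop]
    exact IntermediateField.finrank_top
  have hn : f.num.natDegree ≤ 1 := (le_max_left _ _).trans hdeg.le
  have hd : f.denom.natDegree ≤ 1 := (le_max_right _ _).trans hdeg.le
  refine ⟨f.num.coeff 1, f.num.coeff 0, f.denom.coeff 1, f.denom.coeff 0, ?_, ?_⟩
  · intro h0
    obtain ⟨A, B, hAB⟩ := f.isCoprime_num_denom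
    rw [eq_X_add_C_of_natDegree_le_one hn, eq_X_add_C_of_natDegree_le_one hd] at hAB hdeg
    set α := f.num.coeff 1
    set β := f.num.coeff 0
    set γ := f.denom.coeff 1
    set δ := f.denom.coeff 0
    -- the two proportional linear forms have a common root, or are both constant
    have hr : ∀ a : k, α * a + β = 0 → γ * a + δ = 0 → False := by
      intro a h1 h2
      have := congrArg (eval a) hAB
      simp [h1, h2] at this
    by_cases hα : α = 0
    · by_cases hγ : γ = 0
      · rw [hα, hγ] at hdeg; simp at hdeg
      · refine hr (-δ / γ) ?_ ?_
        · have : β = 0 := by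
            rw [hα] at h0
            simpa [hγ] using h0
          rw [hα, this]; simp
        · field_simp; ring
    · refine hr (-β / α) ?_ ?_
      · field_simp; ring
      · field_simp; linear_combination h0
  · rw [← eq_X_add_C_of_natDegree_le_one hn, ← eq_X_add_C_of_natDegree_le_one hd, f.num_div_denom]

/-- Pullback of orders along a linear fractional transformation. -/
lemma exists_smul_ordAt [IsAlgClosed k] [DecidableEq k] (τ : RatFunc k ≃ₐ[k] RatFunc k) :
    ∃ g : GL (Fin 2) k, ∀ (p : OnePoint k) (f : RatFunc k),
      ordAt p (τ f) = ordAt (g • p) f := by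
  obtain ⟨α, β, γ, δ, hdet, hX⟩ := exists_map_X_eq τ
  let g : GL (Fin 2) k := Matrix.GeneralLinearGroup.mkOfDetNeZero !![α, β; γ, δ]
    (by rw [Matrix.det_fin_two_of]; exact hdet)
  have g00 : g 0 0 = α := rfl
  have g01 : g 0 1 = β := rfl
  have g10 : g 1 0 = γ := rfl
  have g11 : g 1 1 = δ := rfl
  refine ⟨g, fun p f => ?_⟩
  have hden : γ ≠ 0 ∨ δ ≠ 0 := by
    by_contra! h0
    rw [h0.1, h0.2] at hdet; simp at hdet
  have hlin : ∀ c : k, ordZ p (τ (algebraMap k[X] (RatFunc k) (X - C c))) =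
      ordZ (g • p) (algebraMap k[X] (RatFunc k) (X - C c)) := by
    intro c
    have hnum : α - c * γ ≠ 0 ∨ β - c * δ ≠ 0 := by
      by_contra! h0
      apply hdet
      linear_combination δ * h0.1 - γ * h0.2
    have hD : algebraMap k[X] (RatFunc k) (C γ * X + C δ) ≠ 0 := by
      apply RatFunc.algebraMap_ne_zero
      intro h0
      have h1 : γ = 0 := by simpa [coeff_X, coeff_C] using congrArg (coeff · 1) h0
      have h2 : δ = 0 := by simpa [coeff_X, coeff_C] using congrArg (coeff · 0) h0
      tauto
    have hN : algebraMap k[X] (RatFunc k) (C (α - c * γ) * X + C (β - c * δ)) ≠ 0 := by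
      apply RatFunc.algebraMap_ne_zero
      intro h0
      have h1 : α - c * γ = 0 := by
        simpa [coeff_X, coeff_C, -map_sub, -map_mul] using congrArg (coeff · 1) h0
      have h2 : β - c * δ = 0 := by
        simpa [coeff_X, coeff_C, -map_sub, -map_mul] using congrArg (coeff · 0) h0
      tauto
    have e : τ (algebraMap k[X] (RatFunc k) (X - C c)) =
        algebraMap k[X] (RatFunc k) (C (α - c * γ) * X + C (β - c * δ)) *
          (algebraMap k[X] (RatFunc k) (C γ * X + C δ))⁻¹ := by
      have hc : τ (algebraMap k[X] (RatFunc k) (C c)) = algebraMap k[X] (RatFunc k) (C c) := by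
        rw [RatFunc.algebraMap_C, ← RatFunc.algebraMap_eq_C]; exact τ.commutes c
      rw [map_sub, map_sub, hc, RatFunc.algebraMap_X, hX, div_sub' hD, div_eq_mul_inv]
      congr 1
      simp only [map_sub, map_mul, map_add]
      ring
    have hR : (X - C c : k[X]) = C 1 * X + C (-c) := by simp; ring
    rw [e, ordZ_mul p hN (inv_ne_zero hD), ordZ_inv p hD, ordZ_linear p hnum, ordZ_linear p hden,
      hR, ordZ_linear _ (Or.inl one_ne_zero)]
    induction p using OnePoint.rec with
    | infty =>
      rw [OnePoint.smul_infty_eq_ite, g10, g00, OnePoint.elim_infty, OnePoint.elim_infty]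
      by_cases hγ : γ = 0
      · have hα : α ≠ 0 := by rintro rfl; simp [hγ] at hdet
        simp [hγ, hα]
      · rw [if_neg hγ, if_neg hγ, OnePoint.elim_some]
        by_cases h1 : α - c * γ = 0
        · have h2 : 1 * (α / γ) + -c = 0 := by field_simp; linear_combination h1
          rw [if_pos h1, if_pos h2]; rfl
        · have h2 : ¬ (1 * (α / γ) + -c = 0) := by
            intro h2
            apply h1
            field_simp at h2
            linear_combination h2
          rw [if_neg h1, if_neg h2]; rfl
    | coe a =>
      rw [OnePoint.smul_some_eq_ite, g10, g11, g00, g01, OnePoint.elim_some, OnePoint.elim_some]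
      by_cases h3 : γ * a + δ = 0
      · have h4 : ¬ ((α - c * γ) * a + (β - c * δ) = 0) := by
          intro h4
          have h5 : α * a + β = 0 := by linear_combination h4 + c * h3
          have h6 : (α * δ - β * γ) * a = 0 := by linear_combination δ * h5 - β * h3
          have h7 : α * δ - β * γ = 0 := by
            rcases mul_eq_zero.mp h6 with h8 | h8
            · exact h8
            · subst h8; linear_combination α * h3 - γ * h5
          exact hdet h7
        rw [if_pos h3, if_pos h3, if_neg h4]; simp
      · rw [if_neg h3, if_neg h3, OnePoint.elim_some]
        by_cases h1 : (α - c * γ) * a + (β - c * δ) = 0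
        · have h2 : 1 * ((α * a + β) / (γ * a + δ)) + -c = 0 := by
            rw [one_mul, ← sub_eq_add_neg, sub_eq_zero, div_eq_iff h3]; linear_combination h1
          rw [if_pos h1, if_pos h2]; rfl
        · have h2 : ¬ (1 * ((α * a + β) / (γ * a + δ)) + -c = 0) := by
            intro h2
            rw [one_mul, ← sub_eq_add_neg, sub_eq_zero, div_eq_iff h3] at h2
            exact h1 (by linear_combination h2)
          rw [if_neg h1, if_neg h2]; rfl
  have hpoly : ∀ P : k[X], P ≠ 0 → ordZ p (τ (algebraMap k[X] (RatFunc k) P)) =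
      ordZ (g • p) (algebraMap k[X] (RatFunc k) P) := by
    intro P hP
    have hs := (IsAlgClosed.splits P).eq_prod_roots
    have hc : ∀ c : k, τ (algebraMap k[X] (RatFunc k) (C c)) = RatFunc.C c := fun c => by
      rw [RatFunc.algebraMap_C, ← RatFunc.algebraMap_eq_C]; exact τ.commutes c
    have hprod : ∀ s : Multiset k, ordZ p (τ (algebraMap k[X] (RatFunc k)
        (s.map fun a => X - C a).prod)) =
        ordZ (g • p) (algebraMap k[X] (RatFunc k) (s.map fun a => X - C a).prod) := by
      intro s
      induction s using Multiset.induction with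
      | empty => simp [ordZ_one]
      | cons a s ih =>
        have h1 : algebraMap k[X] (RatFunc k) (X - C a) ≠ 0 :=
          RatFunc.algebraMap_ne_zero (X_sub_C_ne_zero a)
        have h2 : algebraMap k[X] (RatFunc k) (s.map fun a => X - C a).prod ≠ 0 :=
          RatFunc.algebraMap_ne_zero (monic_multiset_prod_of_monic _ _
            fun a _ => monic_X_sub_C a).ne_zero
        rw [Multiset.map_cons, Multiset.prod_cons, map_mul, map_mul,
          ordZ_mul _ ((map_ne_zero τ).mpr h1) ((map_ne_zero τ).mpr h2), ordZ_mul _ h1 h2, ih,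
          hlin]
    have h1 : algebraMap k[X] (RatFunc k) (C P.leadingCoeff) ≠ 0 :=
      RatFunc.algebraMap_ne_zero (C_ne_zero.mpr (leadingCoeff_ne_zero.mpr hP))
    have h2 : algebraMap k[X] (RatFunc k) (P.roots.map fun a => X - C a).prod ≠ 0 :=
      RatFunc.algebraMap_ne_zero (monic_multiset_prod_of_monic _ _
        fun a _ => monic_X_sub_C a).ne_zero
    rw [hs, map_mul, map_mul, ordZ_mul _ ((map_ne_zero τ).mpr h1) ((map_ne_zero τ).mpr h2),
      ordZ_mul _ h1 h2, hprod, hc, RatFunc.algebraMap_C,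
      ordZ_C _ (leadingCoeff_ne_zero.mpr hP), ordZ_C _ (leadingCoeff_ne_zero.mpr hP)]
  by_cases hf : f = 0
  · subst hf; simp
  have hτf : τ f ≠ 0 := (map_ne_zero τ).mpr hf
  rw [ordAt_of_ne_zero _ hf, ordAt_of_ne_zero _ hτf]
  congr 1
  have hn := RatFunc.num_ne_zero hf
  have hn' := RatFunc.algebraMap_ne_zero hn
  have hd' := RatFunc.algebraMap_ne_zero f.denom_ne_zero
  rw [← f.num_div_denom, div_eq_mul_inv, map_mul, map_inv₀,
    ordZ_mul _ ((map_ne_zero τ).mpr hn') (inv_ne_zero ((map_ne_zero τ).mpr hd')),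
    ordZ_mul _ hn' (inv_ne_zero hd'), ordZ_inv _ ((map_ne_zero τ).mpr hd'), ordZ_inv _ hd',
    hpoly _ hn, hpoly _ f.denom_ne_zero]

end Order

/-! ### Invariance of the singular fibres under isomorphisms of fibrations -/

/-- Generic points are carried to generic points by semilinear isomorphisms. -/
lemma IsGenericPoint.map_ringEquiv {F F' K K' : Type*} [Field F] [Field F'] [Field K] [Field K']
    [Algebra F K] [Algebra F' K'] {a b c : F} {x y : K} (h : IsGenericPoint a b c x y)
    (σ : K ≃+* K') (τ : F ≃+* F') (hστ : ∀ f, σ (algebraMap F K f) = algebraMap F' K' (τ f)) :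
    IsGenericPoint (τ a) (τ b) (τ c) (σ x) (σ y) where
  equation := by
    rw [← map_pow, h.equation]
    simp only [map_add, map_mul, map_pow, hστ]
  transcendental := by
    rw [transcendental_iff]
    intro p hp
    have h1 : aeval x (p.map (τ.symm : F' →+* F)) = 0 := by
      apply σ.injective
      rw [map_zero, ← hp, aeval_def, aeval_def, eval₂_map]
      change (σ : K →+* K') _ = _
      rw [hom_eval₂]
      congr 1
      ext f
      simp [hστ]
    have h2 := h.aeval_eq_zero h1
    exact (Polynomial.map_eq_zero_iff τ.symm.injective).mp h2
  adjoin_eq_top := by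
    set M := IntermediateField.adjoin F' {σ x, σ y} with hM
    let N : IntermediateField F K :=
      (M.toSubfield.comap (σ : K →+* K')).toIntermediateField
        fun f => show σ (algebraMap F K f) ∈ M by rw [hστ]; exact M.algebraMap_mem _
    have hN : N = ⊤ := by
      rw [← top_le_iff, ← h.adjoin_eq_top, IntermediateField.adjoin_le_iff]
      rintro z (rfl | rfl)
      · exact IntermediateField.subset_adjoin F' _ (Set.mem_insert _ _)
      · exact IntermediateField.subset_adjoin F' _ (Set.mem_insert_of_mem _ rfl)
    rw [← top_le_iff]
    intro z _
    have : σ.symm z ∈ N := hN ▸ IntermediateField.mem_top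
    have : σ (σ.symm z) ∈ M := this
    simpa using this

section InvarianceOfFibres

variable {k : Type*} [Field k]

lemma cubicModel_map {F F' : Type*} [Field F] [Field F'] (f : F →+* F') (a b c : F) :
    (cubicModel a b c).map f = cubicModel (f a) (f b) (f c) := by
  ext <;> simp [cubicModel, WeierstrassCurve.map]

/-- Isomorphic fibrations have generic fibres that differ by an automorphism `τ` of `k(u)` and a
change of Weierstrass coordinates. -/
lemma IsomorphicFibrations.exists_variableChange [CharZero k] {a b c a' b' c' : RatFunc k}
    (h : IsomorphicFibrations (cubicModel a b c) (cubicModel a' b' c'))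
    (hd : (cubicModel a b c).Δ ≠ 0) (hd' : (cubicModel a' b' c').Δ ≠ 0) :
    ∃ (τ : RatFunc k ≃ₐ[k] RatFunc k) (v : WeierstrassCurve.VariableChange (RatFunc k)),
      v • cubicModel a' b' c' = (cubicModel a b c).map (τ : RatFunc k →+* RatFunc k) := by
  obtain ⟨σ, τ, hστ⟩ := h
  have : CharZero (RatFunc k) := charZero_of_injective_algebraMap (algebraMap k _).injective
  have h1 := (isGenericPoint_functionField a b c).map_ringEquiv σ.toRingEquiv τ.toRingEquiv hστ
  rw [Δ_cubicModel] at hd hd'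
  have h2 : cubicDisc (τ a) (τ b) (τ c) ≠ 0 := by
    have : cubicDisc (τ a) (τ b) (τ c) = τ (cubicDisc a b c) := by
      have h4 : τ 4 = 4 := map_ofNat τ 4
      have h18 : τ 18 = 18 := map_ofNat τ 18
      have h27 : τ 27 = 27 := map_ofNat τ 27
      simp [cubicDisc, h4, h18, h27]
    rw [this]
    exact (map_ne_zero τ).mpr (right_ne_zero_of_mul hd)
  obtain ⟨v, hv⟩ := h1.exists_variableChange (isGenericPoint_functionField a' b' c') h2
    (right_ne_zero_of_mul hd')
  exact ⟨τ, v, by rw [hv, cubicModel_map]; rfl⟩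

lemma hasFibre_smul (W : WeierstrassCurve (RatFunc k))
    (v : WeierstrassCurve.VariableChange (RatFunc k)) (p : OnePoint k) (T : KodairaSymbol) :
    HasFibre (v • W) p T ↔ HasFibre W p T := by
  constructor
  · rintro ⟨v', h⟩
    exact ⟨v' * v, by rwa [mul_smul]⟩
  · rintro ⟨v', h⟩
    exact ⟨v' * v⁻¹, by rwa [mul_smul, inv_smul_smul]⟩

lemma HasFibre.map {W : WeierstrassCurve (RatFunc k)} {p q : OnePoint k}
    {T : KodairaSymbol} (τ : RatFunc k ≃ₐ[k] RatFunc k) (h : HasFibre W q T)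
    (hpq : ∀ f, ordAt p (τ f) = ordAt q f) :
    HasFibre (W.map (τ : RatFunc k →+* RatFunc k)) p T := by
  obtain ⟨v, hv⟩ := h
  refine ⟨v.map (τ : RatFunc k →+* RatFunc k), ?_⟩
  rw [WeierstrassCurve.map_variableChange, WeierstrassCurve.map_c₄, WeierstrassCurve.map_c₆,
    WeierstrassCurve.map_Δ]
  simpa [hpq] using hv

lemma hasFibre_map_iff {W : WeierstrassCurve (RatFunc k)} {p q : OnePoint k}
    {T : KodairaSymbol} (τ : RatFunc k ≃ₐ[k] RatFunc k) (hpq : ∀ f, ordAt p (τ f) = ordAt q f) :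
    HasFibre (W.map (τ : RatFunc k →+* RatFunc k)) p T ↔ HasFibre W q T := by
  refine ⟨fun h => ?_, fun h => h.map τ hpq⟩
  have := h.map τ.symm (p := q) (fun f => by rw [← hpq, AlgEquiv.apply_symm_apply])
  rw [WeierstrassCurve.map_map] at this
  convert this
  rw [show ((τ.symm : RatFunc k →+* RatFunc k).comp (τ : RatFunc k →+* RatFunc k)) =
    RingHom.id _ from RingHom.ext fun f => by simp, WeierstrassCurve.map_id]

/-- The singular fibres of isomorphic fibrations correspond to each other under a linear
fractional transformation. -/
lemma IsomorphicFibrations.exists_hasFibre_iff [CharZero k] [IsAlgClosed k] [DecidableEq k]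
    {a b c a' b' c' : RatFunc k}
    (h : IsomorphicFibrations (cubicModel a b c) (cubicModel a' b' c'))
    (hd : (cubicModel a b c).Δ ≠ 0) (hd' : (cubicModel a' b' c').Δ ≠ 0) :
    ∃ g : GL (Fin 2) k, ∀ p T,
      HasFibre (cubicModel a' b' c') p T ↔ HasFibre (cubicModel a b c) (g • p) T := by
  obtain ⟨τ, v, hv⟩ := h.exists_variableChange hd hd'
  obtain ⟨g, hg⟩ := exists_smul_ordAt τ
  refine ⟨g, fun p T => ?_⟩
  rw [← hasFibre_smul _ v, hv, hasFibre_map_iff τ (hg p)]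

/-- Vanishing of `c₆`, that is `j = 1728`, is invariant under isomorphisms of fibrations. -/
lemma IsomorphicFibrations.c₆_eq_zero [CharZero k] {a b c a' b' c' : RatFunc k}
    (h : IsomorphicFibrations (cubicModel a b c) (cubicModel a' b' c'))
    (hd : (cubicModel a b c).Δ ≠ 0) (hd' : (cubicModel a' b' c').Δ ≠ 0)
    (h0 : (cubicModel a' b' c').c₆ = 0) : (cubicModel a b c).c₆ = 0 := by
  obtain ⟨τ, v, hv⟩ := h.exists_variableChange hd hd'
  have := congrArg WeierstrassCurve.c₆ hv
  rw [WeierstrassCurve.variableChange_c₆, h0, mul_zero, WeierstrassCurve.map_c₆] at this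
  exact (map_eq_zero _).mp this.symm

end InvarianceOfFibres

/-! ### Computation of fibres -/

section Fibres

variable {k : Type*} [Field k]

lemma ofNat_le_coe_withTop (n : ℕ) [n.AtLeastTwo] (a : ℤ) :
    (ofNat(n) : WithTop ℤ) ≤ (a : WithTop ℤ) ↔ (ofNat(n) : ℤ) ≤ a := by
  rw [← WithTop.coe_ofNat, WithTop.coe_le_coe]

/-- The entries of Tate's table are pairwise different, and none arises from another one by
a change of coordinates. -/
lemma TateTable.unique {a b a' b' : WithTop ℤ} {d d' n : ℤ} {T T' : KodairaSymbol}
    (h : TateTable a b d T) (h' : TateTable a' b' d' T')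
    (ha : a' + (4 * n : ℤ) = a) (hb : b' + (6 * n : ℤ) = b) (hd : d' + 12 * n = d) : T = T' := by
  subst ha hb hd
  induction a' using WithTop.recTopCoe <;> induction b' using WithTop.recTopCoe <;>
  simp only [WithTop.top_add, ← WithTop.coe_add] at h <;>
  rcases T with (_ | m) | (_ | m) | _ | _ | _ | _ | _ | _ <;>
  simp only [TateTable, le_top, WithTop.top_ne_zero, WithTop.top_ne_one, WithTop.top_ne_ofNat,
    WithTop.coe_eq_ofNat, WithTop.coe_eq_one, WithTop.coe_eq_zero, WithTop.one_le_coe,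
    WithTop.coe_nonneg, ofNat_le_coe_withTop, WithTop.coe_inj, true_and, false_and,
        and_false] at h <;>
  rcases T' with (_ | m') | (_ | m') | _ | _ | _ | _ | _ | _ <;>
  simp only [TateTable, le_top, WithTop.top_ne_zero, WithTop.top_ne_one, WithTop.top_ne_ofNat,
    WithTop.coe_eq_ofNat, WithTop.coe_eq_one, WithTop.coe_eq_zero, WithTop.one_le_coe,
    WithTop.coe_nonneg, ofNat_le_coe_withTop, WithTop.coe_inj, true_and, false_and,
        and_false] at h' <;>
  first
  | rfl
  | (exfalso; omega)
  | (congr 1; omega)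

lemma ordAt_mul_right (p : OnePoint k) (f : RatFunc k) {g : RatFunc k} (hg : g ≠ 0) :
    ordAt p (g * f) = ordAt p f + (ordZ p g : WithTop ℤ) := by
  by_cases hf : f = 0
  · simp [hf]
  · rw [ordAt_of_ne_zero _ hf, ordAt_of_ne_zero _ (mul_ne_zero hg hf), ordZ_mul p hg hf, add_comm]
    rfl

/-- The type of a fibre is well-defined: a change of coordinates with factor `u` shifts the orders
of `c₄`, `c₆` and `Δ` by multiples `4 n`, `6 n` and `12 n` of the order `n` of `u⁻¹`. -/
lemma HasFibre.unique {W : WeierstrassCurve (RatFunc k)} {p : OnePoint k} {T T' : KodairaSymbol}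
    (hΔ : W.Δ ≠ 0) (h : HasFibre W p T) (h' : HasFibre W p T') : T = T' := by
  obtain ⟨v, hv⟩ := h
  obtain ⟨v', hv'⟩ := h'
  set W₀ := v • W with hW₀
  set w := v' * v⁻¹ with hw
  have e : v' • W = w • W₀ := by rw [hw, hW₀, mul_smul, inv_smul_smul]
  have h0 : W₀.Δ ≠ 0 := by
    rw [hW₀, WeierstrassCurve.variableChange_Δ]
    exact mul_ne_zero (pow_ne_zero _ (Units.ne_zero _)) hΔ
  have hu : ((w.u⁻¹ : (RatFunc k)ˣ) : RatFunc k) ≠ 0 := Units.ne_zero _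
  rw [e, WeierstrassCurve.variableChange_c₄, WeierstrassCurve.variableChange_c₆,
    WeierstrassCurve.variableChange_Δ, ordAt_mul_right _ _ (pow_ne_zero _ hu),
    ordAt_mul_right _ _ (pow_ne_zero _ hu), ordAt_mul_right _ _ (pow_ne_zero _ hu),
    ordZ_pow _ hu, ordZ_pow _ hu, ordZ_pow _ hu, ordAt_of_ne_zero _ h0] at hv'
  rw [ordAt_of_ne_zero _ h0] at hv
  symm
  refine TateTable.unique (n := ordZ p ((w.u⁻¹ : (RatFunc k)ˣ) : RatFunc k)) hv' hv ?_ ?_ ?_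
  · rfl
  · rfl
  · push_cast; rfl

/-- `L` lists the reducible fibres of the fibration with generic fibre `W`, with their
positions. -/
structure HasReducibleFibres (W : WeierstrassCurve (RatFunc k))
    (L : List (OnePoint k × KodairaSymbol)) : Prop where
  Δ_ne_zero : W.Δ ≠ 0
  nodup : (L.map Prod.fst).Nodup
  hasFibre : ∀ e ∈ L, HasFibre W e.1 e.2
  exists_irreducible :
    ∀ p, p ∉ L.map Prod.fst → ∃ T : KodairaSymbol, ¬ T.IsReducible ∧ HasFibre W p T

namespace HasReducibleFibres

variable {W : WeierstrassCurve (RatFunc k)} {L : List (OnePoint k × KodairaSymbol)}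

lemma hasFibre_iff (h : HasReducibleFibres W L) {T : KodairaSymbol} (hT : T.IsReducible)
    (p : OnePoint k) : HasFibre W p T ↔ (p, T) ∈ L := by
  refine ⟨fun hp => ?_, h.hasFibre _⟩
  by_cases hmem : p ∈ L.map Prod.fst
  · obtain ⟨e, he, rfl⟩ := List.mem_map.mp hmem
    rwa [← (h.hasFibre e he).unique h.Δ_ne_zero hp]
  · obtain ⟨T', hT', h'⟩ := h.exists_irreducible p hmem
    exact absurd (hp.unique h.Δ_ne_zero h' ▸ hT) hT'

lemma hasType (h : HasReducibleFibres W L) {n : OguisoType}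
    (hn : (L.map Prod.snd : Multiset KodairaSymbol) = n.reducibleFibres) : HasType W n := by
  classical
  intro T hT
  have hset : {p : OnePoint k | HasFibre W p T} =
      (((L.filter fun e => e.2 = T).map Prod.fst).toFinset : Set (OnePoint k)) := by
    ext p
    simp only [Set.mem_ofPred_eq, List.coe_toFinset, List.mem_map, List.mem_filter,
      decide_eq_true_eq, h.hasFibre_iff hT]
    constructor
    · exact fun hp => ⟨_, ⟨hp, rfl⟩, rfl⟩
    · rintro ⟨e, ⟨he, rfl⟩, rfl⟩
      exact he
  rw [hset, Set.encard_coe_eq_coe_finsetCard, List.toFinset_card_of_nodup, List.length_map, ← hn]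
  · rw [Multiset.coe_count, ← List.countP_eq_length_filter, List.count, List.countP_map]
    congr 1
  · exact h.nodup.sublist (List.filter_sublist.map _)

end HasReducibleFibres

/-! ### Polynomial Weierstrass equations -/

/-- The curve `y² = x³ + A x² + B x + C` over `k(u)` with polynomial coefficients. -/
def polyModel (A B C : k[X]) : WeierstrassCurve (RatFunc k) :=
  cubicModel (algebraMap k[X] (RatFunc k) A) (algebraMap k[X] (RatFunc k) B)
    (algebraMap k[X] (RatFunc k) C)

lemma c₄_cubicModel {F : Type*} [Field F] (a b c : F) :
    (cubicModel a b c).c₄ = 16 * (a ^ 2 - 3 * b) := by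
  simp only [WeierstrassCurve.c₄, WeierstrassCurve.b₂, WeierstrassCurve.b₄, cubicModel]
  ring

lemma c₆_cubicModel {F : Type*} [Field F] (a b c : F) :
    (cubicModel a b c).c₆ = 32 * (-2 * a ^ 3 + 9 * a * b - 27 * c) := by
  simp only [WeierstrassCurve.c₆, WeierstrassCurve.b₂, WeierstrassCurve.b₄, WeierstrassCurve.b₆,
    cubicModel]
  ring

lemma ordAt_coe_eq {a : k} {P Q : k[X]} {n : ℕ} (h : P = (X - C a) ^ n * Q) (hQ : Q.eval a ≠ 0) :
    ordAt (a : OnePoint k) (algebraMap k[X] (RatFunc k) P) = ((n : ℤ) : WithTop ℤ) := by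
  have hQ0 : Q ≠ 0 := by rintro rfl; simp at hQ
  have hP0 : P ≠ 0 := h ▸ mul_ne_zero (pow_ne_zero _ (X_sub_C_ne_zero a)) hQ0
  rw [ordAt_of_ne_zero _ (RatFunc.algebraMap_ne_zero hP0), ordZ_coe_algebraMap a hP0, h,
    rootMultiplicity_mul (h ▸ hP0), rootMultiplicity_X_sub_C_pow,
    rootMultiplicity_eq_zero (p := Q) hQ]
  simp

lemma le_ordAt_coe {a : k} {P Q : k[X]} {n : ℕ} (h : P = (X - C a) ^ n * Q) :
    ((n : ℤ) : WithTop ℤ) ≤ ordAt (a : OnePoint k) (algebraMap k[X] (RatFunc k) P) := by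
  by_cases hP0 : P = 0
  · simp [hP0]
  rw [ordAt_of_ne_zero _ (RatFunc.algebraMap_ne_zero hP0), ordZ_coe_algebraMap a hP0]
  have := (le_rootMultiplicity_iff hP0).mpr ⟨Q, h⟩
  exact_mod_cast this

lemma ordAt_ofNat_mul [CharZero k] (p : OnePoint k) (m : ℕ) [m.AtLeastTwo] (f : RatFunc k) :
    ordAt p (ofNat(m) * f) = ordAt p f := by
  have hm : (ofNat(m) : k) ≠ 0 := OfNat.ofNat_ne_zero m
  have e : (ofNat(m) : RatFunc k) = RatFunc.C (ofNat(m) : k) := (map_ofNat _ m).symm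
  rw [e, ordAt_mul_right _ _ ((_root_.map_ne_zero _).mpr hm), ordZ_C _ hm]
  simp

/-- Fibres of a model whose orders are listed in the table. -/
lemma hasFibre_polyModel [CharZero k] {A B D : k[X]} {p : OnePoint k} {T : KodairaSymbol}
    (h : TateTable (ordAt p (algebraMap k[X] (RatFunc k) (A ^ 2 - 3 * B)))
      (ordAt p (algebraMap k[X] (RatFunc k) (-2 * A ^ 3 + 9 * A * B - 27 * D)))
      (ordAt p (algebraMap k[X] (RatFunc k) (cubicDisc A B D))) T) :
    HasFibre (polyModel A B D) p T := by
  refine ⟨1, ?_⟩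
  rw [one_smul, polyModel, c₄_cubicModel, c₆_cubicModel, Δ_cubicModel,
    ordAt_ofNat_mul, ordAt_ofNat_mul, ordAt_ofNat_mul]
  simpa only [cubicDisc, map_sub, map_add, map_mul, map_pow, map_neg, map_ofNat] using h

end Fibres

/-! ### Fibres at finite points -/

section Local

variable {k : Type*} [Field k] {A B D : k[X]} {a : k}

lemma le_ordAt_coe' {n : ℕ} {P Q : k[X]} (h : P = (X - C a) ^ n * Q) {m : WithTop ℤ}
    (hm : m = ((n : ℤ) : WithTop ℤ)) :
    m ≤ ordAt (a : OnePoint k) (algebraMap k[X] (RatFunc k) P) := hm ▸ le_ordAt_coe h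

variable [CharZero k]

/-- The identity `c₄³ - c₆² = 1728 Δ`. -/
lemma four_mul_cube_sub_sq {R : Type*} [CommRing R] (a b d : R) :
    4 * (a ^ 2 - 3 * b) ^ 3 - (-2 * a ^ 3 + 9 * a * b - 27 * d) ^ 2 = 27 * cubicDisc a b d := by
  simp only [cubicDisc]; ring

lemma eval_eq_zero_of_cubicDisc (hd : (cubicDisc A B D).eval a = 0)
    (h6 : (-2 * A ^ 3 + 9 * A * B - 27 * D).eval a = 0) : (A ^ 2 - 3 * B).eval a = 0 := by
  have e := four_mul_cube_sub_sq A B D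
  generalize A ^ 2 - 3 * B = P at e ⊢
  generalize -2 * A ^ 3 + 9 * A * B - 27 * D = P' at e h6
  have e := congrArg (eval a) e
  have h4 : eval a (4 : k[X]) = 4 := eval_ofNat 4 a
  rw [eval_sub, eval_mul, eval_pow, eval_pow, h6, eval_mul, hd, h4] at e
  simpa using e

lemma hasFibre_I_zero (h : (cubicDisc A B D).eval a ≠ 0) : HasFibre (polyModel A B D) a (.I 0) :=
  hasFibre_polyModel ⟨le_ordAt_coe' (n := 0) (by rw [pow_zero, one_mul]) rfl,
    le_ordAt_coe' (n := 0) (by rw [pow_zero, one_mul]) rfl,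
    ordAt_coe_eq (n := 0) (by rw [pow_zero, one_mul]) h⟩

/-- Multiplicative fibres. -/
lemma hasFibre_I (h : (A ^ 2 - 3 * B).eval a ≠ 0) {n : ℕ} (hn : n ≠ 0) {Q : k[X]}
    (hD : cubicDisc A B D = (X - C a) ^ n * Q) (hQ : Q.eval a ≠ 0) :
    HasFibre (polyModel A B D) a (.I n) := by
  obtain ⟨n, rfl⟩ := Nat.exists_eq_succ_of_ne_zero hn
  refine hasFibre_polyModel ⟨ordAt_coe_eq (n := 0) (by rw [pow_zero, one_mul]) h,
    ordAt_coe_eq (n := 0) (by rw [pow_zero, one_mul]) fun h0 => h (eval_eq_zero_of_cubicDisc ?_ h0),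
    ordAt_coe_eq hD hQ⟩
  rw [hD]; simp

/-- A simple zero of the discriminant is a fibre of type `I₁`. -/
lemma hasFibre_I_one (h : (cubicDisc A B D).eval a = 0)
    (h' : (derivative (cubicDisc A B D)).eval a ≠ 0) : HasFibre (polyModel A B D) a (.I 1) := by
  obtain ⟨Q, hQ⟩ := dvd_iff_isRoot.mpr h
  have hQa : Q.eval a ≠ 0 := by
    rw [hQ] at h'
    simpa using h'
  refine hasFibre_I (fun h0 => hQa ?_) one_ne_zero (by rw [pow_one]; exact hQ) hQa
  obtain ⟨P, hP⟩ := dvd_iff_isRoot.mpr h0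
  have e := four_mul_cube_sub_sq A B D
  have h1 : (-2 * A ^ 3 + 9 * A * B - 27 * D).eval a = 0 := by
    have := congrArg (eval a) e
    rw [eval_sub, eval_mul, eval_pow, eval_pow, h0, eval_mul, h] at this
    simpa using this
  obtain ⟨P', hP'⟩ := dvd_iff_isRoot.mpr h1
  -- the left hand side of the identity is divisible by `(u - a)²`
  rw [hP, hP', hQ] at e
  have e2 : 27 * Q = (X - C a) * (4 * (X - C a) * P ^ 3 - P' ^ 2) :=
    mul_left_cancel₀ (X_sub_C_ne_zero a) (by linear_combination -e)
  have := congrArg (eval a) e2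
  rw [eval_mul, eval_mul, eval_sub, eval_X, eval_C, sub_self, zero_mul] at this
  have h27 : eval a (27 : k[X]) = 27 := eval_ofNat 27 a
  rw [h27] at this
  simpa using this

/-- Away from the multiple zeros of the discriminant, all fibres are irreducible. -/
lemma exists_hasFibre_irreducible
    (h : (cubicDisc A B D).eval a = 0 → (derivative (cubicDisc A B D)).eval a ≠ 0) :
    ∃ T : KodairaSymbol, ¬ T.IsReducible ∧ HasFibre (polyModel A B D) a T := by
  by_cases h0 : (cubicDisc A B D).eval a = 0
  · exact ⟨.I 1, by simp [KodairaSymbol.IsReducible], hasFibre_I_one h0 (h h0)⟩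
  · exact ⟨.I 0, by simp [KodairaSymbol.IsReducible], hasFibre_I_zero h0⟩

/-- Quadratic twists of smooth fibres. -/
lemma hasFibre_IStar_zero {A₁ B₁ D₁ : k[X]} (hA : A = (X - C a) * A₁)
    (hB : B = (X - C a) ^ 2 * B₁) (hD : D = (X - C a) ^ 3 * D₁)
    (h : (cubicDisc A₁ B₁ D₁).eval a ≠ 0) : HasFibre (polyModel A B D) a (.IStar 0) :=
  hasFibre_polyModel ⟨le_ordAt_coe' (n := 2) (Q := A₁ ^ 2 - 3 * B₁) (by rw [hA, hB]; ring) rfl,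
    le_ordAt_coe' (n := 3) (Q := -2 * A₁ ^ 3 + 9 * A₁ * B₁ - 27 * D₁)
      (by rw [hA, hB, hD]; ring) rfl,
    ordAt_coe_eq (n := 6) (by rw [hA, hB, hD, cubicDisc, cubicDisc]; ring) h⟩

/-- Quadratic twists of multiplicative fibres. -/
lemma hasFibre_IStar {A₁ B₁ D₁ : k[X]} (hA : A = (X - C a) * A₁)
    (hB : B = (X - C a) ^ 2 * B₁) (hD : D = (X - C a) ^ 3 * D₁)
    (h : (A₁ ^ 2 - 3 * B₁).eval a ≠ 0) {n : ℕ} (hn : n ≠ 0) {Q : k[X]}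
    (hQ : cubicDisc A₁ B₁ D₁ = (X - C a) ^ n * Q) (hQa : Q.eval a ≠ 0) :
    HasFibre (polyModel A B D) a (.IStar n) := by
  obtain ⟨n, rfl⟩ := Nat.exists_eq_succ_of_ne_zero hn
  refine hasFibre_polyModel ⟨ordAt_coe_eq (n := 2) (Q := A₁ ^ 2 - 3 * B₁) (by rw [hA, hB]; ring) h,
    ordAt_coe_eq (n := 3) (Q := -2 * A₁ ^ 3 + 9 * A₁ * B₁ - 27 * D₁)
      (by rw [hA, hB, hD]; ring) fun h0 => h (eval_eq_zero_of_cubicDisc ?_ h0),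
    ordAt_coe_eq (n := n + 7) (Q := Q) ?_ hQa⟩
  · rw [hQ]; simp
  · have : cubicDisc A B D = (X - C a) ^ 6 * cubicDisc A₁ B₁ D₁ := by
      rw [hA, hB, hD, cubicDisc, cubicDisc]; ring
    rw [this, hQ, Nat.succ_eq_add_one]; ring

/-- A double zero of the discriminant that is not a zero of `c₄` is a fibre of type `I₂`. -/
lemma hasFibre_I_two {G F : k[X]} (hD : cubicDisc A B D = G ^ 2 * F)
    (h : (A ^ 2 - 3 * B).eval a ≠ 0) (hG : G.eval a = 0) (hG' : (derivative G).eval a ≠ 0)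
    (hF : F.eval a ≠ 0) : HasFibre (polyModel A B D) a (.I 2) := by
  obtain ⟨Q, rfl⟩ := dvd_iff_isRoot.mpr hG
  have hQ : Q.eval a ≠ 0 := by simpa using hG'
  exact hasFibre_I h two_ne_zero (Q := Q ^ 2 * F) (by rw [hD]; ring)
    (by rw [eval_mul, eval_pow]; exact mul_ne_zero (pow_ne_zero _ hQ) hF)

/-- Quadratic twists of smooth fibres by a function with a simple zero. -/
lemma hasFibre_IStar_zero_of_simple {G A₁ B₁ D₁ : k[X]} (hG : G.eval a = 0)
    (hG' : (derivative G).eval a ≠ 0) (hA : A = G * A₁) (hB : B = G ^ 2 * B₁)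
    (hD : D = G ^ 3 * D₁) (h : (cubicDisc A₁ B₁ D₁).eval a ≠ 0) :
    HasFibre (polyModel A B D) a (.IStar 0) := by
  obtain ⟨Q, rfl⟩ := dvd_iff_isRoot.mpr hG
  have hQ : Q.eval a ≠ 0 := by simpa using hG'
  refine hasFibre_IStar_zero (A₁ := Q * A₁) (B₁ := Q ^ 2 * B₁) (D₁ := Q ^ 3 * D₁)
    (by rw [hA]; ring) (by rw [hB]; ring) (by rw [hD]; ring) ?_
  have : cubicDisc (Q * A₁) (Q ^ 2 * B₁) (Q ^ 3 * D₁) = Q ^ 6 * cubicDisc A₁ B₁ D₁ := by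
    simp only [cubicDisc]; ring
  rw [this, eval_mul, eval_pow]
  exact mul_ne_zero (pow_ne_zero _ hQ) h

/-- In this form, the term `B` dominates: the fibre is of type `III*`. -/
lemma hasFibre_IIIStar {A₁ B₁ D₁ : k[X]} (hA : A = (X - C a) ^ 2 * A₁)
    (hB : B = (X - C a) ^ 3 * B₁) (hD : D = (X - C a) ^ 5 * D₁) (h : B₁.eval a ≠ 0) :
    HasFibre (polyModel A B D) a .IIIStar := by
  have h3 : eval a (3 : k[X]) = 3 := eval_ofNat 3 a
  have h4 : eval a (4 : k[X]) = 4 := eval_ofNat 4 a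
  refine hasFibre_polyModel ⟨ordAt_coe_eq (n := 3) (Q := (X - C a) * A₁ ^ 2 - 3 * B₁)
      (by rw [hA, hB]; ring) ?_,
    le_ordAt_coe' (n := 5) (Q := -2 * (X - C a) * A₁ ^ 3 + 9 * A₁ * B₁ - 27 * D₁)
      (by rw [hA, hB, hD]; ring) rfl,
    ordAt_coe_eq (n := 9) (Q := (X - C a) * A₁ ^ 2 * B₁ ^ 2 - 4 * B₁ ^ 3
      - 4 * (X - C a) ^ 2 * A₁ ^ 3 * D₁ - 27 * (X - C a) * D₁ ^ 2
      + 18 * (X - C a) * A₁ * B₁ * D₁) (by rw [hA, hB, hD, cubicDisc]; ring) ?_⟩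
  · simpa [h3] using h
  · simpa [h4] using h

/-- The additive fibres of `y² = x³ + D` that are not of type `I₀*` or `IV`. -/
lemma hasFibre_of_j_zero {Q : k[X]} {n : ℕ} (hD : D = (X - C a) ^ n * Q) (hQ : Q.eval a ≠ 0)
    {T : KodairaSymbol} (hT : (n = 1 ∧ T = .II) ∨ (n = 4 ∧ T = .IVStar) ∨ (n = 5 ∧ T = .IIStar)) :
    HasFibre (polyModel 0 0 D) a T := by
  have h27 : eval a (27 : k[X]) = 27 := eval_ofNat 27 a
  have h6 : ordAt (a : OnePoint k) (algebraMap k[X] (RatFunc k)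
      (-2 * 0 ^ 3 + 9 * 0 * 0 - 27 * D)) = ((n : ℤ) : WithTop ℤ) :=
    ordAt_coe_eq (Q := -27 * Q) (by rw [hD]; ring) (by simpa [h27] using hQ)
  have hd : ordAt (a : OnePoint k) (algebraMap k[X] (RatFunc k) (cubicDisc 0 0 D)) =
      (((2 * n : ℕ) : ℤ) : WithTop ℤ) :=
    ordAt_coe_eq (Q := -27 * Q ^ 2) (by rw [hD, cubicDisc]; ring) (by simpa [h27] using hQ)
  have h4 : ordAt (a : OnePoint k) (algebraMap k[X] (RatFunc k) (0 ^ 2 - 3 * 0)) = ⊤ := by simp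
  apply hasFibre_polyModel
  rw [h4, h6, hd]
  rcases hT with ⟨rfl, rfl⟩ | ⟨rfl, rfl⟩ | ⟨rfl, rfl⟩ <;> exact ⟨le_top, rfl, rfl⟩

/-- The irreducible fibres of `y² = x³ + D` with separable `D`. -/
lemma exists_hasFibre_irreducible_of_j_zero
    (h : D.eval a = 0 → (derivative D).eval a ≠ 0) :
    ∃ T : KodairaSymbol, ¬ T.IsReducible ∧ HasFibre (polyModel 0 0 D) a T := by
  have h27 : eval a (27 : k[X]) = 27 := eval_ofNat 27 a
  by_cases h0 : D.eval a = 0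
  · obtain ⟨Q, hQ⟩ := dvd_iff_isRoot.mpr h0
    have h' := h h0
    refine ⟨.II, by simp [KodairaSymbol.IsReducible], hasFibre_of_j_zero (n := 1) (Q := Q)
      (by rw [pow_one]; exact hQ) ?_ (Or.inl ⟨rfl, rfl⟩)⟩
    rw [hQ] at h'
    simpa using h'
  · exact ⟨.I 0, by simp [KodairaSymbol.IsReducible], hasFibre_I_zero
      (by simpa [cubicDisc, h27] using h0)⟩

end Local

/-! ### The fibre at infinity -/

section Infinity

variable {k : Type*} [Field k]

/-- The automorphism `u ↦ 1 / u` of `k(u)`. -/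
lemma exists_map_X_eq_inv : ∃ τ : RatFunc k ≃ₐ[k] RatFunc k, τ RatFunc.X = RatFunc.X⁻¹ := by
  have ht : Transcendental k (RatFunc.X⁻¹ : RatFunc k) := fun h =>
    RatFunc.transcendental_X (by simpa using h.inv)
  have htop : IntermediateField.adjoin k {(RatFunc.X⁻¹ : RatFunc k)} = ⊤ := by
    rw [← top_le_iff, ← RatFunc.adjoin_X, IntermediateField.adjoin_simple_le_iff]
    simpa using inv_mem (IntermediateField.mem_adjoin_simple_self k (RatFunc.X⁻¹ : RatFunc k))
  refine ⟨((RatFunc.algEquivOfTranscendental _ ht).trans (IntermediateField.equivOfEq htop)).trans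
    IntermediateField.topEquiv, ?_⟩
  exact RatFunc.algEquivOfTranscendental_X _ ht

variable [IsAlgClosed k]

/-- The fibre at infinity is read off from the equation in the coordinate `1 / u`, after the scaling
`(x, y) ↦ (x / u⁴, y / u⁶)`; so `A`, `B`, `D` are treated as forms of degrees `4`, `8`, `12`. -/
lemma hasFibre_infty {A B D A' B' D' : k[X]} {T : KodairaSymbol}
    (h : HasFibre (polyModel A' B' D') ((0 : k) : OnePoint k) T)
    (H : ∀ x : RatFunc k, x ≠ 0 → x ^ 4 * aeval x⁻¹ A = aeval x A' ∧
      x ^ 8 * aeval x⁻¹ B = aeval x B' ∧ x ^ 12 * aeval x⁻¹ D = aeval x D') :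
    HasFibre (polyModel A B D) OnePoint.infty T := by
  classical
  obtain ⟨τ, hτ⟩ := exists_map_X_eq_inv (k := k)
  have hτP : ∀ P : k[X], τ (algebraMap k[X] (RatFunc k) P) = aeval RatFunc.X⁻¹ P := fun P => by
    rw [← hτ, ← RatFunc.algebraMap_X, aeval_algHom_apply τ, aeval_algebraMap_apply,
        aeval_X_left_apply]
  have hP : ∀ P : k[X], aeval (RatFunc.X : RatFunc k) P = algebraMap k[X] (RatFunc k) P :=
    fun P => by rw [← RatFunc.algebraMap_X, aeval_algebraMap_apply, aeval_X_left_apply]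
  obtain ⟨hA, hB, hD⟩ := H RatFunc.X RatFunc.X_ne_zero
  rw [← hτP, hP] at hA hB hD
  obtain ⟨g, hg⟩ := exists_smul_ordAt τ
  have hX : (RatFunc.X : RatFunc k) ≠ 0 := RatFunc.X_ne_zero
  have h0 : g • ((0 : k) : OnePoint k) = OnePoint.infty := by
    have h1 := hg ((0 : k) : OnePoint k) RatFunc.X
    rw [hτ, ordAt_of_ne_zero _ (inv_ne_zero hX), ordAt_of_ne_zero _ hX, ordZ_inv _ hX] at h1
    have h2 : -ordZ ((0 : k) : OnePoint k) RatFunc.X =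
      ordZ (g • ((0 : k) : OnePoint k)) RatFunc.X := by exact_mod_cast h1
    rw [← RatFunc.algebraMap_X, ordZ_coe_algebraMap _ X_ne_zero] at h2
    generalize g • ((0 : k) : OnePoint k) = q at h2
    induction q using OnePoint.rec with
    | infty => rfl
    | coe b =>
      rw [ordZ_coe_algebraMap _ X_ne_zero] at h2
      have h3 : (X : k[X]).rootMultiplicity 0 = 1 := by
        simpa using rootMultiplicity_X_sub_C_self (x := (0 : k))
      omega
  rw [← h0, ← hasFibre_map_iff τ (hg _)]
  let v : WeierstrassCurve.VariableChange (RatFunc k) := ⟨(Units.mk0 _ hX) ^ 2, 0, 0, 0⟩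
  have e : (polyModel A B D).map (τ : RatFunc k →+* RatFunc k) = v • polyModel A' B' D' := by
    rw [polyModel, cubicModel_map, polyModel, ← hA, ← hB, ← hD]
    ext <;> simp [WeierstrassCurve.variableChange_def, cubicModel, v] <;> field_simp
  rw [e, hasFibre_smul]
  exact h

end Infinity

/-! ### The singular fibres of the sixteen equations -/

section Types

variable {k : Type*} [Field k]

lemma Δ_polyModel (A B D : k[X]) :
    (polyModel A B D).Δ = 16 * algebraMap k[X] (RatFunc k) (cubicDisc A B D) := by
  rw [polyModel, Δ_cubicModel]
  simp only [cubicDisc, map_sub, map_add, map_mul, map_pow, map_ofNat]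

lemma Δ_polyModel_ne_zero [CharZero k] {A B D : k[X]} (a : k)
    (h : (cubicDisc A B D).eval a ≠ 0) : (polyModel A B D).Δ ≠ 0 := by
  rw [Δ_polyModel]
  have : CharZero (RatFunc k) := charZero_of_injective_algebraMap (algebraMap k _).injective
  refine mul_ne_zero (by norm_num) (RatFunc.algebraMap_ne_zero ?_)
  rintro h0
  simp [h0] at h

/-- A product has a simple zero where exactly one factor has one. -/
lemma eval_derivative_ne_zero {D F Q : k[X]} {a : k} (hD : D = F * Q) (hF : F.eval a ≠ 0)
    (hQ : Q.eval a = 0 → (derivative Q).eval a ≠ 0) (h : D.eval a = 0) :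
    (derivative D).eval a ≠ 0 := by
  rw [hD, eval_mul] at h
  have h0 := (mul_eq_zero.mp h).resolve_left hF
  rw [hD, derivative_mul, eval_add, eval_mul, eval_mul, h0, mul_zero, zero_add]
  exact mul_ne_zero hF (hQ h0)

variable {ω : k}

lemma equation_j1a : equation ω .j1a =
    polyModel (X ^ 4 + 1) (4 * X ^ 4) (0) := by
  simp [equation, polyModel, map_ofNat]

lemma equation_j1b : equation ω .j1b =
    polyModel (X ^ 4 + 6 * (2 * C ω + 1) * X ^ 2 + 1) (-32 * X ^ 4) (0) := by
  simp [equation, polyModel, map_ofNat]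

lemma equation_j2 : equation ω .j2 =
    polyModel (-(3 * X ^ 4 + 6 * X ^ 2 - 1)) (32 * X ^ 6) (0) := by
  simp [equation, polyModel, map_ofNat]

lemma equation_j3 : equation ω .j3 =
    polyModel 0 0 (X ^ 4 * (X ^ 4 + 1)) := by
  simp [equation, polyModel]

lemma equation_j4a : equation ω .j4a =
    polyModel 0 (-(X ^ 3 - 1) ^ 2) (0) := by
  simp [equation, polyModel]

lemma equation_j4b : equation ω .j4b =
    polyModel 0 0 (-(X ^ 3 - X) ^ 3) := by
  simp [equation, polyModel]

lemma equation_j5 : equation ω .j5 =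
    polyModel (-(4 + -(2 * X * (X ^ 2 + 3 * X + 3)))) (4 * -(2 * X * (X ^ 2 + 3 * X + 3))) (0) := by
  simp [equation, polyModel, splitModel, map_ofNat]

lemma equation_j6a : equation ω .j6a =
    polyModel (-(-(2 * X ^ 2) + X * (X ^ 2 - X + 1))) (-(2 * X ^ 2) * (X * (X ^ 2 - X + 1))) (0) :=
        by
  simp [equation, polyModel, splitModel, map_ofNat]

lemma equation_j6b : equation ω .j6b =
    polyModel (-(C ω * X ^ 2 + -(X * (2 * X - 1) * (X + C ω ^ 2))))
        (C ω * X ^ 2 * -(X * (2 * X - 1) * (X + C ω ^ 2))) (0) := by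
  simp [equation, polyModel, splitModel, map_ofNat]

lemma equation_j7a : equation ω .j7a =
    polyModel (-(X * (X + 1) * (X + 2))) (X ^ 2 * (X + 2) ^ 2) (0) := by
  simp [equation, polyModel, map_ofNat]

lemma equation_j7b : equation ω .j7b =
    polyModel (C ω * X * (X - 1) * (X - 3 * C ω - 2)) (-(2 * C ω ^ 2 * X ^ 2 * (X - 1) ^ 2)) (0) :=
        by
  simp [equation, polyModel, map_ofNat]

lemma equation_j8 : equation ω .j8 =
    polyModel (X * (3 * X + 2)) (X ^ 2 * (1 + 3 * X + 3 * X ^ 2 + 2 * X ^ 3)) (0) := by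
  simp [equation, polyModel, map_ofNat]

lemma equation_j9 : equation ω .j9 =
    polyModel 0 0 (X * (X ^ 2 - 4) ^ 3) := by
  simp [equation, polyModel, map_ofNat]

lemma equation_j10 : equation ω .j10 =
    polyModel (X ^ 2 * (X + 3)) (X ^ 2 * (-2 * X ^ 2 - 2 * X + 3)) (X ^ 4 * (X - 1)) := by
  simp [equation, polyModel, map_ofNat]

lemma equation_j11a : equation ω .j11a =
    polyModel 0 (-27 * X ^ 2 * (X ^ 4 + 6 * X ^ 3 + 5 * X ^ 2 - 6 * X + 1))
        (-54 * X ^ 3 * (X ^ 2 + 1) * (X ^ 4 + 9 * X ^ 3 + 20 * X ^ 2 - 9 * X + 1)) := by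
  simp [equation, polyModel, map_ofNat]

lemma equation_j11b : equation ω .j11b =
    polyModel 0 (-27 * X ^ 2 *
      (4 * X ^ 4 - 12 * X ^ 3 + 10 * (C ω + 1) * X ^ 2 - 6 * C ω * X + C ω))
          (27 * X ^ 3 * (16 * X ^ 6 - 72 * X ^ 5 + 6 * (19 + 10 * C ω) * X ^ 4 -
      63 * (1 + 2 * C ω) * X ^ 3 + 3 * (-9 + 10 * C ω) * X ^ 2 + 18 * X - 2)) := by
  simp [equation, polyModel, map_ofNat]

lemma cubicDisc_j1a :
    cubicDisc (X ^ 4 + 1) (4 * X ^ 4) (0 : k[X]) =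
      16 * X ^ 8 * (X ^ 8 - 14 * X ^ 4 + 1) := by
  simp only [cubicDisc]
  ring

lemma cubicDisc_j1b (hω : ω ^ 2 + ω + 1 = 0) :
    cubicDisc (X ^ 4 + 6 * (2 * C ω + 1) * X ^ 2 + 1) (-32 * X ^ 4) (0 : k[X]) =
      1024 * X ^ 8 * (X ^ 8 + 12 * (2 * C ω + 1) * X ^ 6 + 22 * X ^ 4 + 12 * (2 * C ω + 1) * X ^ 2 +
          1) := by
  have hw : (C ω : k[X]) ^ 2 + C ω + 1 = 0 := by simpa using congrArg C hω
  simp only [cubicDisc]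
  grind

lemma cubicDisc_j2 :
    cubicDisc (-(3 * X ^ 4 + 6 * X ^ 2 - 1)) (32 * X ^ 6) (0 : k[X]) =
      1024 * X ^ 12 * ((X ^ 4 - 10 * X ^ 2 + 1) * (9 * X ^ 4 - 2 * X ^ 2 + 1)) := by
  simp only [cubicDisc]
  ring

lemma cubicDisc_j4a :
    cubicDisc 0 (-(X ^ 3 - 1) ^ 2) (0 : k[X]) =
      4 * (X ^ 3 - 1) ^ 6 := by
  simp only [cubicDisc]
  ring

lemma cubicDisc_j4b :
    cubicDisc 0 0 (-(X ^ 3 - X) ^ 3 : k[X]) =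
      -27 * (X ^ 3 - X) ^ 6 := by
  simp only [cubicDisc]
  ring

lemma cubicDisc_j5 :
    cubicDisc (-(4 + -(2 * X * (X ^ 2 + 3 * X + 3)))) (4 * -(2 * X * (X ^ 2 + 3 * X + 3)))
        (0 : k[X]) =
      256 * (X * (X + 2) * (X ^ 2 + X + 1) * (X ^ 2 + 3 * X + 3)) ^ 2 := by
  simp only [cubicDisc]
  ring

lemma cubicDisc_j6a :
    cubicDisc (-(-(2 * X ^ 2) + X * (X ^ 2 - X + 1))) (-(2 * X ^ 2) * (X * (X ^ 2 - X + 1)))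
        (0 : k[X]) =
      4 * X ^ 8 * ((X ^ 2 - X + 1) * (X ^ 2 + X + 1)) ^ 2 := by
  simp only [cubicDisc]
  ring

lemma cubicDisc_j6b (hω : ω ^ 2 + ω + 1 = 0) :
    cubicDisc (-(C ω * X ^ 2 + -(X * (2 * X - 1) * (X + C ω ^ 2))))
        (C ω * X ^ 2 * -(X * (2 * X - 1) * (X + C ω ^ 2))) (0 : k[X]) =
      C ω ^ 2 * X ^ 8 *
      ((2 * X - 1) * (X + C ω ^ 2) * (X - 1) * (2 * X + C ω ^ 2)) ^ 2 := by
  have hw : (C ω : k[X]) ^ 2 + C ω + 1 = 0 := by simpa using congrArg C hω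
  simp only [cubicDisc]
  grind

lemma cubicDisc_j7a :
    cubicDisc (-(X * (X + 1) * (X + 2))) (X ^ 2 * (X + 2) ^ 2) (0 : k[X]) =
      X ^ 6 * (X + 2) ^ 6 * ((X - 1) * (X + 3)) := by
  simp only [cubicDisc]
  ring

lemma cubicDisc_j7b (hω : ω ^ 2 + ω + 1 = 0) :
    cubicDisc (C ω * X * (X - 1) * (X - 3 * C ω - 2)) (-(2 * C ω ^ 2 * X ^ 2 * (X - 1) ^ 2))
        (0 : k[X]) =
      4 * X ^ 6 * (X - 1) ^ 6 * (X ^ 2 - 2 * (3 * C ω + 2) * X + 3 * C ω + 3) := by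
  have hw : (C ω : k[X]) ^ 2 + C ω + 1 = 0 := by simpa using congrArg C hω
  simp only [cubicDisc]
  grind

lemma cubicDisc_j8 :
    cubicDisc (X * (3 * X + 2)) (X ^ 2 * (1 + 3 * X + 3 * X ^ 2 + 2 * X ^ 3)) (0 : k[X]) =
      -X ^ 8 * ((2 * X + 1) * (X ^ 2 + X + 1)) ^ 2 * (8 * X + 3) := by
  simp only [cubicDisc]
  ring

lemma cubicDisc_j10 :
    cubicDisc (X ^ 2 * (X + 3)) (X ^ 2 * (-2 * X ^ 2 - 2 * X + 3)) (X ^ 4 * (X - 1) : k[X]) =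
      -4 * X ^ 6 * (3 * X ^ 4 + 10 * X ^ 3 + 9 * X ^ 2 - 54 * X + 27) := by
  simp only [cubicDisc]
  ring

lemma cubicDisc_j11a :
    cubicDisc 0 (-27 * X ^ 2 * (X ^ 4 + 6 * X ^ 3 + 5 * X ^ 2 - 6 * X + 1))
        (-54 * X ^ 3 * (X ^ 2 + 1) * (X ^ 4 + 9 * X ^ 3 + 20 * X ^ 2 - 9 * X + 1) : k[X]) =
      -2125764 * X ^ 10 * (3 * X ^ 4 + 26 * X ^ 3 + 53 * X ^ 2 - 26 * X + 3) := by
  simp only [cubicDisc]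
  ring

lemma cubicDisc_j11b (hω : ω ^ 2 + ω + 1 = 0) :
    cubicDisc 0 (-27 * X ^ 2 *
      (4 * X ^ 4 - 12 * X ^ 3 + 10 * (C ω + 1) * X ^ 2 - 6 * C ω * X + C ω))
          (27 * X ^ 3 * (16 * X ^ 6 - 72 * X ^ 5 + 6 * (19 + 10 * C ω) * X ^ 4 -
      63 * (1 + 2 * C ω) * X ^ 3 + 3 * (-9 + 10 * C ω) * X ^ 2 + 18 * X - 2) : k[X]) =
      -531441 * X ^ 10 * (12 * X ^ 4 + (16 * C ω - 20) * X ^ 3 - 13 * X ^ 2 -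
      (18 + 8 * C ω) * X + 3) := by
  have hw : (C ω : k[X]) ^ 2 + C ω + 1 = 0 := by simpa using congrArg C hω
  simp only [cubicDisc]
  grind

end Types

section Types

variable {k : Type*} [Field k] [IsAlgClosed k] [CharZero k] {ω : k}

set_option linter.unusedSimpArgs false

lemma hasReducibleFibres_j1a : HasReducibleFibres (equation ω .j1a)
    [(OnePoint.infty, .I 8),
      (((0 : k) : OnePoint k), .I 8)] := by
  rw [equation_j1a]
  have h0 : HasFibre (polyModel (X ^ 4 + 1) (4 * X ^ 4) 0)
      ((0 : k) : OnePoint k) (.I 8) :=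
    hasFibre_I (by simp) (by norm_num) (Q := 16 * (X ^ 8 - 14 * X ^ 4 + 1))
      (by rw [cubicDisc_j1a, C_0]; ring) (by simp)
  refine ⟨Δ_polyModel_ne_zero 1 (by rw [cubicDisc_j1a]; simp; grind), by simp, ?_, ?_⟩
  · simp only [List.forall_mem_cons]
    -- up to scaling, the equation is invariant under `u ↦ 1 / u`
    refine ⟨hasFibre_infty h0 fun x hx => ⟨?_, ?_, ?_⟩,
      h0, by simp⟩ <;>
      simp only [map_zero, map_one, map_add, map_sub, map_neg, map_mul, map_pow, map_ofNat, aeval_X,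
        aeval_C] <;> field_simp <;> ring
  · intro p hp
    induction p using OnePoint.rec with
    | infty => simp at hp
    | coe a =>
      simp at hp
      refine exists_hasFibre_irreducible (eval_derivative_ne_zero cubicDisc_j1a ?_ ?_) <;>
        simp <;> grind

lemma hasReducibleFibres_j1b (hω : ω ^ 2 + ω + 1 = 0) : HasReducibleFibres (equation ω .j1b)
    [(OnePoint.infty, .I 8),
      (((0 : k) : OnePoint k), .I 8)] := by
  rw [equation_j1b]
  have h0 : HasFibre (polyModel (X ^ 4 + 6 * (2 * C ω + 1) * X ^ 2 + 1) (-32 * X ^ 4) 0)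
      ((0 : k) : OnePoint k) (.I 8) :=
    hasFibre_I (by simp) (by norm_num)
      (by rw [cubicDisc_j1b hω, C_0, sub_zero, mul_comm _ (X ^ 8), mul_assoc]) (by simp)
  refine ⟨Δ_polyModel_ne_zero 1 (by rw [cubicDisc_j1b hω]; simp; grind), by simp, ?_, ?_⟩
  · simp only [List.forall_mem_cons]
    -- up to scaling, the equation is invariant under `u ↦ 1 / u`
    refine ⟨hasFibre_infty h0 fun x hx => ⟨?_, ?_, ?_⟩,
      h0, by simp⟩ <;>
      simp only [map_zero, map_one, map_add, map_sub, map_neg, map_mul, map_pow, map_ofNat, aeval_X,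
        aeval_C] <;> field_simp <;> ring
  · intro p hp
    induction p using OnePoint.rec with
    | infty => simp at hp
    | coe a =>
      simp at hp
      refine exists_hasFibre_irreducible (eval_derivative_ne_zero (cubicDisc_j1b hω) ?_ ?_) <;>
        simp <;> grind

lemma hasReducibleFibres_j2 : HasReducibleFibres (equation ω .j2)
    [(OnePoint.infty, .I 4),
      (((0 : k) : OnePoint k), .I 12)] := by
  rw [equation_j2]
  have h0 : HasFibre (polyModel (-(3 * X ^ 4 + 6 * X ^ 2 - 1)) (32 * X ^ 6) 0)
      ((0 : k) : OnePoint k) (.I 12) :=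
    hasFibre_I (by simp) (by norm_num)
      (by rw [cubicDisc_j2, C_0, sub_zero, mul_comm _ (X ^ 12), mul_assoc]) (by simp)
  have hi : HasFibre (polyModel (-(3 + 6 * X ^ 2 - X ^ 4)) (32 * X ^ 2) 0)
      ((0 : k) : OnePoint k) (.I 4) :=
    hasFibre_I (by simp) (by norm_num)
      (Q := 1024 * ((X ^ 4 - 10 * X ^ 2 + 1) * (X ^ 4 - 2 * X ^ 2 + 9)))
      (by simp only [cubicDisc, C_0]; ring) (by simp)
  refine ⟨Δ_polyModel_ne_zero 1 (by rw [cubicDisc_j2]; simp; grind), by simp, ?_, ?_⟩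
  · simp only [List.forall_mem_cons]
    refine ⟨hasFibre_infty hi fun x hx => ⟨?_, ?_, ?_⟩,
      h0, by simp⟩ <;>
      simp only [map_zero, map_one, map_add, map_sub, map_neg, map_mul, map_pow, map_ofNat, aeval_X,
        aeval_C] <;> field_simp <;> ring
  · intro p hp
    induction p using OnePoint.rec with
    | infty => simp at hp
    | coe a =>
      simp at hp
      refine exists_hasFibre_irreducible (eval_derivative_ne_zero cubicDisc_j2 ?_ ?_) <;>
        simp <;> grind

lemma hasReducibleFibres_j3 : HasReducibleFibres (equation ω .j3)
    [(OnePoint.infty, .IVStar),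
      (((0 : k) : OnePoint k), .IVStar)] := by
  rw [equation_j3]
  have h0 : HasFibre (polyModel 0 0 (X ^ 4 * (X ^ 4 + 1)))
      ((0 : k) : OnePoint k) .IVStar :=
    hasFibre_of_j_zero (n := 4) (by rw [C_0, sub_zero]) (by simp) (by simp)
  refine ⟨Δ_polyModel_ne_zero 1 (by simp only [cubicDisc]; norm_num), by simp, ?_, ?_⟩
  · simp only [List.forall_mem_cons]
    -- up to scaling, the equation is invariant under `u ↦ 1 / u`
    refine ⟨hasFibre_infty h0 fun x hx => ⟨?_, ?_, ?_⟩,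
      h0, by simp⟩ <;>
      simp only [map_zero, map_one, map_add, map_sub, map_neg, map_mul, map_pow, map_ofNat, aeval_X,
        aeval_C] <;> field_simp <;> ring
  · intro p hp
    induction p using OnePoint.rec with
    | infty => simp at hp
    | coe a =>
      simp at hp
      refine exists_hasFibre_irreducible_of_j_zero (eval_derivative_ne_zero rfl ?_ ?_) <;> simp <;>
        grind

lemma hasReducibleFibres_j4a (hω : ω ^ 2 + ω + 1 = 0) : HasReducibleFibres (equation ω .j4a)
    [(OnePoint.infty, .IStar 0),
      (((1 : k) : OnePoint k), .IStar 0),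
      (((ω : k) : OnePoint k), .IStar 0),
      (((ω ^ 2 : k) : OnePoint k), .IStar 0)] := by
  rw [equation_j4a]
  have hi : HasFibre (polyModel 0 (-(X * (1 - X ^ 3)) ^ 2) 0)
      ((0 : k) : OnePoint k) (.IStar 0) :=
    hasFibre_IStar_zero_of_simple (G := X * (1 - X ^ 3)) (A₁ := 0) (B₁ := -1) (D₁ := 0)
      (by simp) (by simp) (by ring) (by ring) (by ring)
      (by simp [cubicDisc])
  have hr : ∀ a : k, a ^ 3 = 1 → HasFibre (polyModel 0 (-(X ^ 3 - 1) ^ 2) 0) (a : OnePoint k)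
      (.IStar 0) := fun a ha =>
    hasFibre_IStar_zero_of_simple (G := X ^ 3 - 1) (A₁ := 0) (B₁ := -1) (D₁ := 0)
      (by simp [ha]) (by simp; grind) (by ring) (by ring) (by ring)
      (by simp [cubicDisc])
  refine ⟨Δ_polyModel_ne_zero 0 (by rw [cubicDisc_j4a]; simp),
    by simp; constructorm* _ ∧ _ <;> grind, ?_, ?_⟩
  · simp only [List.forall_mem_cons]
    refine ⟨hasFibre_infty hi fun x hx => ⟨?_, ?_, ?_⟩,
      hr 1 (by simp),
      hr ω (by grind),
      hr (ω ^ 2) (by grind), by simp⟩ <;>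
      simp only [map_zero, map_one, map_add, map_sub, map_neg, map_mul, map_pow, map_ofNat, aeval_X,
        aeval_C] <;> field_simp <;> ring
  · intro p hp
    induction p using OnePoint.rec with
    | infty => simp at hp
    | coe a =>
      simp at hp
      refine ⟨.I 0, by simp [KodairaSymbol.IsReducible], hasFibre_I_zero ?_⟩
      rw [cubicDisc_j4a]
      simp
      grind

lemma hasReducibleFibres_j4b : HasReducibleFibres (equation ω .j4b)
    [(OnePoint.infty, .IStar 0),
      (((0 : k) : OnePoint k), .IStar 0),
      (((1 : k) : OnePoint k), .IStar 0),
      (((-1 : k) : OnePoint k), .IStar 0)] := by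
  rw [equation_j4b]
  have hi : HasFibre (polyModel 0 0 (-(X * (1 - X ^ 2)) ^ 3))
      ((0 : k) : OnePoint k) (.IStar 0) :=
    hasFibre_IStar_zero_of_simple (G := X * (1 - X ^ 2)) (A₁ := 0) (B₁ := 0) (D₁ := -1)
      (by simp) (by simp) (by ring) (by ring) (by ring)
      (by simp [cubicDisc])
  have hr : ∀ a : k, a ^ 3 = a → HasFibre (polyModel 0 0 (-(X ^ 3 - X) ^ 3)) (a : OnePoint k)
      (.IStar 0) := fun a ha =>
    hasFibre_IStar_zero_of_simple (G := X ^ 3 - X) (A₁ := 0) (B₁ := 0) (D₁ := -1)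
      (by simp [ha]) (by simp; grind) (by ring) (by ring) (by ring)
      (by simp [cubicDisc])
  refine ⟨Δ_polyModel_ne_zero 2 (by rw [cubicDisc_j4b]; simp; grind), by simp; grind, ?_, ?_⟩
  · simp only [List.forall_mem_cons]
    refine ⟨hasFibre_infty hi fun x hx => ⟨?_, ?_, ?_⟩,
      hr 0 (by simp),
      hr 1 (by simp),
      hr (-1) (by norm_num), by simp⟩ <;>
      simp only [map_zero, map_one, map_add, map_sub, map_neg, map_mul, map_pow, map_ofNat, aeval_X,
        aeval_C] <;> field_simp <;> ring
  · intro p hp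
    induction p using OnePoint.rec with
    | infty => simp at hp
    | coe a =>
      simp at hp
      refine ⟨.I 0, by simp [KodairaSymbol.IsReducible], hasFibre_I_zero ?_⟩
      rw [cubicDisc_j4b]
      simp
      grind

lemma hasReducibleFibres_j5 (hω : ω ^ 2 + ω + 1 = 0) : HasReducibleFibres (equation ω .j5)
    [(OnePoint.infty, .IStar 6),
      (((0 : k) : OnePoint k), .I 2),
      (((-2 : k) : OnePoint k), .I 2),
      (((ω : k) : OnePoint k), .I 2),
      (((ω ^ 2 : k) : OnePoint k), .I 2),
      (((ω - 1 : k) : OnePoint k), .I 2),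
      (((ω ^ 2 - 1 : k) : OnePoint k), .I 2)] := by
  rw [equation_j5]
  have hi : HasFibre (polyModel (2 * X + 6 * X ^ 2 + 6 * X ^ 3 - 4 * X ^ 4)
      (-8 * X ^ 5 * (1 + 3 * X + 3 * X ^ 2)) 0)
      ((0 : k) : OnePoint k) (.IStar 6) :=
    hasFibre_IStar (n := 6) (A₁ := 2 + 6 * X + 6 * X ^ 2 - 4 * X ^ 3)
      (B₁ := -8 * X ^ 3 * (1 + 3 * X + 3 * X ^ 2)) (D₁ := 0)
      (Q := 64 * (1 + 3 * X + 3 * X ^ 2) ^ 2 * ((2 + 6 * X + 6 * X ^ 2 - 4 * X ^ 3) ^ 2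
        + 32 * X ^ 3 * (1 + 3 * X + 3 * X ^ 2)))
      (by rw [C_0]; ring) (by rw [C_0]; ring) (by ring) (by simp) (by norm_num)
      (by simp only [cubicDisc, C_0]; ring) (by simp)
  have hr : ∀ a : k, (X * (X + 2) * (X ^ 2 + X + 1) * (X ^ 2 + 3 * X + 3)).eval a = 0 →
      HasFibre (polyModel (-(4 + -(2 * X * (X ^ 2 + 3 * X + 3))))
          (4 * -(2 * X * (X ^ 2 + 3 * X + 3))) 0) (a : OnePoint k) (.I 2) := by
    intro a ha
    refine hasFibre_I_two (G := X * (X + 2) * (X ^ 2 + X + 1) * (X ^ 2 + 3 * X + 3)) (F := 256)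
        (by rw [cubicDisc_j5]; ring) ?_ ha ?_ ?_ <;>
      simp [derivative_pow] at ha ⊢ <;> grind
  refine ⟨Δ_polyModel_ne_zero 1 (by rw [cubicDisc_j5]; simp; grind),
    by simp; constructorm* _ ∧ _ <;> grind, ?_, ?_⟩
  · simp only [List.forall_mem_cons]
    refine ⟨hasFibre_infty hi fun x hx => ⟨?_, ?_, ?_⟩,
      hr _ (by simp),
      hr _ (by simp),
      hr _ (by simp; grind),
      hr _ (by simp; grind),
      hr _ (by simp; grind),
      hr _ (by simp; grind), by simp⟩ <;>
      simp only [map_zero, map_one, map_add, map_sub, map_neg, map_mul, map_pow, map_ofNat, aeval_X,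
        aeval_C] <;> field_simp <;> ring
  · intro p hp
    induction p using OnePoint.rec with
    | infty => simp at hp
    | coe a =>
      simp at hp
      have e1 : a ^ 2 + a + 1 = (a - ω) * (a - ω ^ 2) := by grind
      have e2 : a ^ 2 + 3 * a + 3 = (a - (ω - 1)) * (a - (ω ^ 2 - 1)) := by grind
      refine ⟨.I 0, by simp [KodairaSymbol.IsReducible], hasFibre_I_zero ?_⟩
      rw [cubicDisc_j5]
      simp only [eval_add, eval_sub, eval_mul, eval_pow, eval_X, eval_one, eval_ofNat, e1, e2]
      simp [sub_eq_zero, hp, add_eq_zero_iff_eq_neg]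

lemma hasReducibleFibres_j6a (hω : ω ^ 2 + ω + 1 = 0) : HasReducibleFibres (equation ω .j6a)
    [(OnePoint.infty, .IStar 2),
      (((0 : k) : OnePoint k), .IStar 2),
      (((ω : k) : OnePoint k), .I 2),
      (((ω ^ 2 : k) : OnePoint k), .I 2),
      (((-ω : k) : OnePoint k), .I 2),
      (((-ω ^ 2 : k) : OnePoint k), .I 2)] := by
  rw [equation_j6a]
  have h0 : HasFibre (polyModel (-(-(2 * X ^ 2) + X * (X ^ 2 - X + 1)))
      (-(2 * X ^ 2) * (X * (X ^ 2 - X + 1))) 0)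
      ((0 : k) : OnePoint k) (.IStar 2) :=
    hasFibre_IStar (n := 2) (A₁ := 2 * X - (X ^ 2 - X + 1))
      (B₁ := -2 * X * (X ^ 2 - X + 1)) (D₁ := 0)
      (Q := 4 * ((X ^ 2 - X + 1) * (X ^ 2 + X + 1)) ^ 2)
      (by rw [C_0]; ring) (by rw [C_0]; ring) (by ring) (by simp) (by norm_num)
      (by simp only [cubicDisc, C_0]; ring) (by simp)
  have hr : ∀ a : k, ((X ^ 2 - X + 1) * (X ^ 2 + X + 1)).eval a = 0 →
      HasFibre (polyModel (-(-(2 * X ^ 2) + X * (X ^ 2 - X + 1)))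
          (-(2 * X ^ 2) * (X * (X ^ 2 - X + 1))) 0) (a : OnePoint k) (.I 2) := by
    intro a ha
    refine hasFibre_I_two (G := (X ^ 2 - X + 1) * (X ^ 2 + X + 1)) (F := 4 * X ^ 8)
        (by rw [cubicDisc_j6a]; ring) ?_ ha ?_ ?_ <;>
      simp [derivative_pow] at ha ⊢ <;> grind
  refine ⟨Δ_polyModel_ne_zero 1 (by rw [cubicDisc_j6a]; simp; grind),
    by simp; constructorm* _ ∧ _ <;> grind, ?_, ?_⟩
  · simp only [List.forall_mem_cons]
    -- up to scaling, the equation is invariant under `u ↦ 1 / u`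
    refine ⟨hasFibre_infty h0 fun x hx => ⟨?_, ?_, ?_⟩,
      h0,
      hr _ (by simp; grind),
      hr _ (by simp; grind),
      hr _ (by simp; grind),
      hr _ (by simp; grind), by simp⟩ <;>
      simp only [map_zero, map_one, map_add, map_sub, map_neg, map_mul, map_pow, map_ofNat, aeval_X,
        aeval_C] <;> field_simp <;> ring
  · intro p hp
    induction p using OnePoint.rec with
    | infty => simp at hp
    | coe a =>
      simp at hp
      have e1 : a ^ 2 + a + 1 = (a - ω) * (a - ω ^ 2) := by grind
      have e3 : a ^ 2 - a + 1 = (a - -ω) * (a - -ω ^ 2) := by grind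
      refine ⟨.I 0, by simp [KodairaSymbol.IsReducible], hasFibre_I_zero ?_⟩
      rw [cubicDisc_j6a]
      simp only [eval_add, eval_sub, eval_mul, eval_pow, eval_X, eval_one, eval_ofNat, e1, e3]
      simp [sub_eq_zero, hp, add_eq_zero_iff_eq_neg]

lemma hasReducibleFibres_j6b (hω : ω ^ 2 + ω + 1 = 0) : HasReducibleFibres (equation ω .j6b)
    [(OnePoint.infty, .IStar 2),
      (((0 : k) : OnePoint k), .IStar 2),
      (((1 : k) : OnePoint k), .I 2),
      (((1 / 2 : k) : OnePoint k), .I 2),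
      (((-ω ^ 2 : k) : OnePoint k), .I 2),
      (((-ω ^ 2 / 2 : k) : OnePoint k), .I 2)] := by
  rw [equation_j6b]
  have hω0 : ω ≠ 0 := by grind
  have h0 : HasFibre (polyModel (-(C ω * X ^ 2 + -(X * (2 * X - 1) * (X + C ω ^ 2))))
      (C ω * X ^ 2 * -(X * (2 * X - 1) * (X + C ω ^ 2))) 0)
      ((0 : k) : OnePoint k) (.IStar 2) :=
    hasFibre_IStar (n := 2) (A₁ := -C ω * X + (2 * X - 1) * (X + C ω ^ 2))
      (B₁ := -C ω * X * (2 * X - 1) * (X + C ω ^ 2)) (D₁ := 0)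
      (Q := (C ω * (2 * X - 1) * (X + C ω ^ 2) *
        (C ω * X + (2 * X - 1) * (X + C ω ^ 2))) ^ 2)
      (by rw [C_0]; ring) (by rw [C_0]; ring) (by ring) (by simp [hω0]) (by norm_num)
      (by simp only [cubicDisc, C_0]; ring) (by simp [hω0])
  have hi : HasFibre (polyModel (-(C ω * X ^ 2 - X * (2 - X) * (1 + C ω ^ 2 * X)))
      (-C ω * X ^ 3 * (2 - X) * (1 + C ω ^ 2 * X)) 0)
      ((0 : k) : OnePoint k) (.IStar 2) :=
    hasFibre_IStar (n := 2) (A₁ := -C ω * X + (2 - X) * (1 + C ω ^ 2 * X))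
      (B₁ := -C ω * X * (2 - X) * (1 + C ω ^ 2 * X)) (D₁ := 0)
      (Q := (C ω * (2 - X) * (1 + C ω ^ 2 * X) *
        (C ω * X + (2 - X) * (1 + C ω ^ 2 * X))) ^ 2)
      (by rw [C_0]; ring) (by rw [C_0]; ring) (by ring) (by simp) (by norm_num)
      (by simp only [cubicDisc, C_0]; ring) (by simp [hω0])
  have hr : ∀ a : k, ((2 * X - 1) * (X + C ω ^ 2) * (X - 1) * (2 * X + C ω ^ 2)).eval a = 0 →
      HasFibre (polyModel (-(C ω * X ^ 2 + -(X * (2 * X - 1) * (X + C ω ^ 2))))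
          (C ω * X ^ 2 * -(X * (2 * X - 1) * (X + C ω ^ 2))) 0) (a : OnePoint k) (.I 2) := by
    intro a ha
    refine hasFibre_I_two (G := (2 * X - 1) * (X + C ω ^ 2) * (X - 1) * (2 * X + C ω ^ 2))
        (F := C ω ^ 2 * X ^ 8) (by rw [cubicDisc_j6b hω]; ring) ?_ ha ?_ ?_ <;>
      simp [derivative_pow] at ha ⊢ <;> grind
  refine ⟨Δ_polyModel_ne_zero 2 (by rw [cubicDisc_j6b hω]; simp; grind),
    by simp; constructorm* _ ∧ _ <;> grind, ?_, ?_⟩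
  · simp only [List.forall_mem_cons]
    refine ⟨hasFibre_infty hi fun x hx => ⟨?_, ?_, ?_⟩,
      h0,
      hr _ (by simp),
      hr _ (by simp),
      hr _ (by simp),
      hr _ (by simp; grind), by simp⟩ <;>
      simp only [map_zero, map_one, map_add, map_sub, map_neg, map_mul, map_pow, map_ofNat, aeval_X,
        aeval_C] <;> field_simp <;> ring
  · intro p hp
    induction p using OnePoint.rec with
    | infty => simp at hp
    | coe a =>
      simp at hp
      refine ⟨.I 0, by simp [KodairaSymbol.IsReducible], hasFibre_I_zero ?_⟩
      rw [cubicDisc_j6b hω]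
      simp
      grind

lemma hasReducibleFibres_j7a : HasReducibleFibres (equation ω .j7a)
    [(OnePoint.infty, .IStar 4),
      (((0 : k) : OnePoint k), .IStar 0),
      (((-2 : k) : OnePoint k), .IStar 0)] := by
  rw [equation_j7a]
  have hi : HasFibre (polyModel (-(X * (1 + X) * (1 + 2 * X))) (X ^ 4 * (1 + 2 * X) ^ 2) 0)
      ((0 : k) : OnePoint k) (.IStar 4) :=
    hasFibre_IStar (n := 4) (A₁ := -((1 + X) * (1 + 2 * X)))
      (B₁ := X ^ 2 * (1 + 2 * X) ^ 2) (D₁ := 0)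
      (Q := (1 + 2 * X) ^ 6 * ((1 + X) ^ 2 - 4 * X ^ 2))
      (by rw [C_0]; ring) (by rw [C_0]; ring) (by ring) (by simp) (by norm_num)
      (by simp only [cubicDisc, C_0]; ring) (by simp)
  have hr : ∀ a : k, a * (a + 2) = 0 →
      HasFibre (polyModel (-(X * (X + 1) * (X + 2))) (X ^ 2 * (X + 2) ^ 2) 0) (a : OnePoint k)
          (.IStar 0) := fun a ha =>
    hasFibre_IStar_zero_of_simple (G := X * (X + 2)) (A₁ := -(X + 1)) (B₁ := 1) (D₁ := 0)
      (by simpa using ha) (by simp; grind) (by ring) (by ring) (by ring)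
      (by simp [cubicDisc]; grind)
  refine ⟨Δ_polyModel_ne_zero 2 (by rw [cubicDisc_j7a]; simp; grind), by simp, ?_, ?_⟩
  · simp only [List.forall_mem_cons]
    refine ⟨hasFibre_infty hi fun x hx => ⟨?_, ?_, ?_⟩,
      hr 0 (by simp),
      hr (-2) (by simp), by simp⟩ <;>
      simp only [map_zero, map_one, map_add, map_sub, map_neg, map_mul, map_pow, map_ofNat, aeval_X,
        aeval_C] <;> field_simp <;> ring
  · intro p hp
    induction p using OnePoint.rec with
    | infty => simp at hp
    | coe a =>
      simp at hp
      refine exists_hasFibre_irreducible (eval_derivative_ne_zero cubicDisc_j7a ?_ ?_) <;>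
        simp <;> grind

lemma hasReducibleFibres_j7b (hω : ω ^ 2 + ω + 1 = 0) : HasReducibleFibres (equation ω .j7b)
    [(OnePoint.infty, .IStar 4),
      (((0 : k) : OnePoint k), .IStar 0),
      (((1 : k) : OnePoint k), .IStar 0)] := by
  rw [equation_j7b]
  have hω0 : ω ≠ 0 := by grind
  have hi : HasFibre (polyModel (C ω * X * (1 - X) * (1 - (3 * C ω + 2) * X))
      (-(2 * C ω ^ 2 * X ^ 4 * (1 - X) ^ 2)) 0)
      ((0 : k) : OnePoint k) (.IStar 4) :=
    hasFibre_IStar (n := 4) (A₁ := C ω * (1 - X) * (1 - (3 * C ω + 2) * X))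
      (B₁ := -(2 * C ω ^ 2 * X ^ 2 * (1 - X) ^ 2)) (D₁ := 0)
      (Q := 4 * C ω ^ 6 * (1 - X) ^ 6 * ((1 - (3 * C ω + 2) * X) ^ 2 + 8 * X ^ 2))
      (by rw [C_0]; ring) (by rw [C_0]; ring) (by ring) (by simp [hω0]) (by norm_num)
      (by simp only [cubicDisc, C_0]; ring) (by simp [hω0])
  have hr : ∀ a : k, a * (a - 1) = 0 →
      HasFibre (polyModel (C ω * X * (X - 1) * (X - 3 * C ω - 2))
          (-(2 * C ω ^ 2 * X ^ 2 * (X - 1) ^ 2)) 0) (a : OnePoint k) (.IStar 0) := fun a ha =>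
    hasFibre_IStar_zero_of_simple (G := X * (X - 1)) (A₁ := C ω * (X - 3 * C ω - 2))
        (B₁ := -2 * C ω ^ 2) (D₁ := 0)
      (by simpa using ha) (by simp; grind) (by ring) (by ring) (by ring)
      (by simp [cubicDisc]; grind)
  refine ⟨Δ_polyModel_ne_zero 2 (by rw [cubicDisc_j7b hω]; simp; grind), by simp, ?_, ?_⟩
  · simp only [List.forall_mem_cons]
    refine ⟨hasFibre_infty hi fun x hx => ⟨?_, ?_, ?_⟩,
      hr 0 (by simp),
      hr 1 (by simp), by simp⟩ <;>
      simp only [map_zero, map_one, map_add, map_sub, map_neg, map_mul, map_pow, map_ofNat, aeval_X,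
        aeval_C] <;> field_simp <;> ring
  · intro p hp
    induction p using OnePoint.rec with
    | infty => simp at hp
    | coe a =>
      simp at hp
      refine exists_hasFibre_irreducible (eval_derivative_ne_zero (cubicDisc_j7b hω) ?_ ?_) <;>
        simp <;> grind

lemma hasReducibleFibres_j8 (hω : ω ^ 2 + ω + 1 = 0) : HasReducibleFibres (equation ω .j8)
    [(OnePoint.infty, .IIIStar),
      (((0 : k) : OnePoint k), .IStar 2),
      (((-1 / 2 : k) : OnePoint k), .I 2),
      (((ω : k) : OnePoint k), .I 2),
      (((ω ^ 2 : k) : OnePoint k), .I 2)] := by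
  rw [equation_j8]
  have hi : HasFibre (polyModel (X ^ 2 * (3 + 2 * X)) (X ^ 3 * (X ^ 3 + 3 * X ^ 2 + 3 * X + 2)) 0)
      ((0 : k) : OnePoint k) .IIIStar :=
    hasFibre_IIIStar (A₁ := 3 + 2 * X) (B₁ := X ^ 3 + 3 * X ^ 2 + 3 * X + 2) (D₁ := 0)
      (by rw [C_0]; ring) (by rw [C_0]; ring) (by ring) (by simp)
  have h0 : HasFibre (polyModel (X * (3 * X + 2)) (X ^ 2 * (1 + 3 * X + 3 * X ^ 2 + 2 * X ^ 3)) 0)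
      ((0 : k) : OnePoint k) (.IStar 2) :=
    hasFibre_IStar (n := 2) (A₁ := 3 * X + 2)
      (B₁ := 1 + 3 * X + 3 * X ^ 2 + 2 * X ^ 3) (D₁ := 0)
      (Q := -(1 + 3 * X + 3 * X ^ 2 + 2 * X ^ 3) ^ 2 * (8 * X + 3))
      (by rw [C_0]; ring) (by rw [C_0]; ring) (by ring) (by simp; norm_num) (by norm_num)
      (by simp only [cubicDisc, C_0]; ring) (by simp)
  have hr : ∀ a : k, ((2 * X + 1) * (X ^ 2 + X + 1)).eval a = 0 →
      HasFibre (polyModel (X * (3 * X + 2)) (X ^ 2 * (1 + 3 * X + 3 * X ^ 2 + 2 * X ^ 3)) 0)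
          (a : OnePoint k) (.I 2) := by
    intro a ha
    refine hasFibre_I_two (G := (2 * X + 1) * (X ^ 2 + X + 1)) (F := -X ^ 8 * (8 * X + 3))
        (by rw [cubicDisc_j8]; ring) ?_ ha ?_ ?_ <;>
      simp [derivative_pow] at ha ⊢ <;> grind
  refine ⟨Δ_polyModel_ne_zero 1 (by rw [cubicDisc_j8]; simp; grind),
    by simp; constructorm* _ ∧ _ <;> grind, ?_, ?_⟩
  · simp only [List.forall_mem_cons]
    refine ⟨hasFibre_infty hi fun x hx => ⟨?_, ?_, ?_⟩,
      h0,
      hr _ (by simp; grind),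
      hr _ (by simp; grind),
      hr _ (by simp; grind), by simp⟩ <;>
      simp only [map_zero, map_one, map_add, map_sub, map_neg, map_mul, map_pow, map_ofNat, aeval_X,
        aeval_C] <;> field_simp <;> ring
  · intro p hp
    induction p using OnePoint.rec with
    | infty => simp at hp
    | coe a =>
      simp at hp
      have e1 : a ^ 2 + a + 1 = (a - ω) * (a - ω ^ 2) := by grind
      refine exists_hasFibre_irreducible (eval_derivative_ne_zero cubicDisc_j8 ?_ ?_)
      · simp only [eval_add, eval_sub, eval_mul, eval_pow, eval_X, eval_one, eval_ofNat, eval_neg,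
          e1]
        simp [sub_eq_zero, hp, add_eq_zero_iff_eq_neg]; grind
      · simp

lemma hasReducibleFibres_j9 : HasReducibleFibres (equation ω .j9)
    [(OnePoint.infty, .IIStar),
      (((2 : k) : OnePoint k), .IStar 0),
      (((-2 : k) : OnePoint k), .IStar 0)] := by
  rw [equation_j9]
  have hi : HasFibre (polyModel 0 0 (X ^ 5 * (1 - 4 * X ^ 2) ^ 3))
      ((0 : k) : OnePoint k) .IIStar :=
    hasFibre_of_j_zero (n := 5) (by rw [C_0, sub_zero]) (by simp) (by simp)
  have hr : ∀ a : k, a ^ 2 = 4 → HasFibre (polyModel 0 0 (X * (X ^ 2 - 4) ^ 3)) (a : OnePoint k)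
      (.IStar 0) := fun a ha =>
    hasFibre_IStar_zero_of_simple (G := X ^ 2 - 4) (A₁ := 0) (B₁ := 0) (D₁ := X)
      (by simp [ha]) (by simp; grind) (by ring) (by ring) (by ring)
      (by simp [cubicDisc]; grind)
  refine ⟨Δ_polyModel_ne_zero 1 (by simp only [cubicDisc]; norm_num), by simp; grind, ?_, ?_⟩
  · simp only [List.forall_mem_cons]
    refine ⟨hasFibre_infty hi fun x hx => ⟨?_, ?_, ?_⟩,
      hr 2 (by norm_num),
      hr (-2) (by norm_num), by simp⟩ <;>
      simp only [map_zero, map_one, map_add, map_sub, map_neg, map_mul, map_pow, map_ofNat, aeval_X,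
        aeval_C] <;> field_simp <;> ring
  · intro p hp
    induction p using OnePoint.rec with
    | infty => simp at hp
    | coe a =>
      simp at hp
      refine exists_hasFibre_irreducible_of_j_zero
        (eval_derivative_ne_zero (mul_comm _ _) ?_ ?_) <;>
        simp <;> grind

lemma hasReducibleFibres_j10 : HasReducibleFibres (equation ω .j10)
    [(OnePoint.infty, .IStar 8),
      (((0 : k) : OnePoint k), .IStar 0)] := by
  rw [equation_j10]
  have hi : HasFibre (polyModel (X * (1 + 3 * X)) (X ^ 4 * (3 * X ^ 2 - 2 * X - 2))
      (X ^ 7 * (1 - X)))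
      ((0 : k) : OnePoint k) (.IStar 8) :=
    hasFibre_IStar (n := 8) (A₁ := 1 + 3 * X) (B₁ := X ^ 2 * (3 * X ^ 2 - 2 * X - 2))
      (D₁ := X ^ 4 * (1 - X))
      (Q := -4 * (3 + 10 * X + 9 * X ^ 2 - 54 * X ^ 3 + 27 * X ^ 4))
      (by rw [C_0]; ring) (by rw [C_0]; ring) (by rw [C_0]; ring) (by simp) (by norm_num)
      (by simp only [cubicDisc, C_0]; ring) (by simp)
  have h0 : HasFibre (polyModel (X ^ 2 * (X + 3)) (X ^ 2 * (-2 * X ^ 2 - 2 * X + 3))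
      (X ^ 4 * (X - 1)))
      ((0 : k) : OnePoint k) (.IStar 0) :=
    hasFibre_IStar_zero (A₁ := X * (X + 3)) (B₁ := -2 * X ^ 2 - 2 * X + 3)
      (D₁ := X * (X - 1)) (by rw [C_0]; ring) (by rw [C_0]; ring) (by rw [C_0]; ring)
      (by simp [cubicDisc])
  refine ⟨Δ_polyModel_ne_zero 1 (by rw [cubicDisc_j10]; simp; grind), by simp, ?_, ?_⟩
  · simp only [List.forall_mem_cons]
    refine ⟨hasFibre_infty hi fun x hx => ⟨?_, ?_, ?_⟩,
      h0, by simp⟩ <;>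
      simp only [map_zero, map_one, map_add, map_sub, map_neg, map_mul, map_pow, map_ofNat, aeval_X,
        aeval_C] <;> field_simp <;> ring
  · intro p hp
    induction p using OnePoint.rec with
    | infty => simp at hp
    | coe a =>
      simp at hp
      refine exists_hasFibre_irreducible (eval_derivative_ne_zero cubicDisc_j10 ?_ ?_) <;>
        simp <;> grind

lemma hasReducibleFibres_j11a : HasReducibleFibres (equation ω .j11a)
    [(OnePoint.infty, .IStar 4),
      (((0 : k) : OnePoint k), .IStar 4)] := by
  rw [equation_j11a]
  have hi : HasFibre (polyModel 0 (X ^ 2 * (-27 * (1 + 6 * X + 5 * X ^ 2 - 6 * X ^ 3 + X ^ 4)))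
      (X ^ 3 * (-54 * (1 + X ^ 2) * (1 + 9 * X + 20 * X ^ 2 - 9 * X ^ 3 + X ^ 4))))
      ((0 : k) : OnePoint k) (.IStar 4) :=
    hasFibre_IStar (n := 4) (A₁ := 0)
      (B₁ := -27 * (1 + 6 * X + 5 * X ^ 2 - 6 * X ^ 3 + X ^ 4))
      (D₁ := -54 * (1 + X ^ 2) * (1 + 9 * X + 20 * X ^ 2 - 9 * X ^ 3 + X ^ 4))
      (Q := -2125764 * (3 + 26 * X + 53 * X ^ 2 - 26 * X ^ 3 + 3 * X ^ 4))
      (by ring) (by rw [C_0]; ring) (by rw [C_0]; ring) (by simp) (by norm_num)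
      (by simp only [cubicDisc, C_0]; ring) (by simp)
  have h0 : HasFibre (polyModel 0 (-27 * X ^ 2 * (X ^ 4 + 6 * X ^ 3 + 5 * X ^ 2 - 6 * X + 1))
      (-54 * X ^ 3 * (X ^ 2 + 1) * (X ^ 4 + 9 * X ^ 3 + 20 * X ^ 2 - 9 * X + 1)))
      ((0 : k) : OnePoint k) (.IStar 4) :=
    hasFibre_IStar (n := 4) (A₁ := 0)
      (B₁ := -27 * (X ^ 4 + 6 * X ^ 3 + 5 * X ^ 2 - 6 * X + 1))
      (D₁ := -54 * (X ^ 2 + 1) * (X ^ 4 + 9 * X ^ 3 + 20 * X ^ 2 - 9 * X + 1))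
      (Q := -2125764 * (3 * X ^ 4 + 26 * X ^ 3 + 53 * X ^ 2 - 26 * X + 3))
      (by ring) (by rw [C_0]; ring) (by rw [C_0]; ring) (by simp) (by norm_num)
      (by simp only [cubicDisc, C_0]; ring) (by simp)
  refine ⟨Δ_polyModel_ne_zero 1 (by rw [cubicDisc_j11a]; simp; grind), by simp, ?_, ?_⟩
  · simp only [List.forall_mem_cons]
    refine ⟨hasFibre_infty hi fun x hx => ⟨?_, ?_, ?_⟩,
      h0, by simp⟩ <;>
      simp only [map_zero, map_one, map_add, map_sub, map_neg, map_mul, map_pow, map_ofNat, aeval_X,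
        aeval_C] <;> field_simp <;> ring
  · intro p hp
    induction p using OnePoint.rec with
    | infty => simp at hp
    | coe a =>
      simp at hp
      refine exists_hasFibre_irreducible (eval_derivative_ne_zero cubicDisc_j11a ?_ ?_) <;>
        simp <;> grind

lemma hasReducibleFibres_j11b (hω : ω ^ 2 + ω + 1 = 0) : HasReducibleFibres (equation ω .j11b)
    [(OnePoint.infty, .IStar 4),
      (((0 : k) : OnePoint k), .IStar 4)] := by
  rw [equation_j11b]
  have hω0 : ω ≠ 0 := by grind
  have hw : (C ω : k[X]) ^ 2 + C ω + 1 = 0 := by simpa using congrArg C hω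
  have hi : HasFibre (polyModel 0 (X ^ 2 * (-27 * (4 - 12 * X + 10 * (C ω + 1) * X ^ 2 -
      6 * C ω * X ^ 3 + C ω * X ^ 4))) (X ^ 3 * (27 * (16 - 72 * X + 6 * (19 + 10 * C ω) * X ^ 2 -
        63 * (1 + 2 * C ω) * X ^ 3 + 3 * (-9 + 10 * C ω) * X ^ 4 + 18 * X ^ 5 - 2 * X ^ 6))))
      ((0 : k) : OnePoint k) (.IStar 4) :=
    hasFibre_IStar (n := 4) (A₁ := 0)
      (B₁ := -27 * (4 - 12 * X + 10 * (C ω + 1) * X ^ 2 - 6 * C ω * X ^ 3 + C ω * X ^ 4))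
      (D₁ := 27 * (16 - 72 * X + 6 * (19 + 10 * C ω) * X ^ 2 -
        63 * (1 + 2 * C ω) * X ^ 3 + 3 * (-9 + 10 * C ω) * X ^ 4 + 18 * X ^ 5 - 2 * X ^ 6))
      (Q := -531441 * (12 + (16 * C ω - 20) * X - 13 * X ^ 2 -
        (18 + 8 * C ω) * X ^ 3 + 3 * X ^ 4))
      (by ring) (by rw [C_0]; ring) (by rw [C_0]; ring) (by simp) (by norm_num)
      (by simp only [cubicDisc, C_0]; grind) (by simp)
  have h0 : HasFibre (polyModel 0 (-27 * X ^ 2 *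
      (4 * X ^ 4 - 12 * X ^ 3 + 10 * (C ω + 1) * X ^ 2 - 6 * C ω * X + C ω))
          (27 * X ^ 3 * (16 * X ^ 6 - 72 * X ^ 5 + 6 * (19 + 10 * C ω) * X ^ 4 -
      63 * (1 + 2 * C ω) * X ^ 3 + 3 * (-9 + 10 * C ω) * X ^ 2 + 18 * X - 2)))
      ((0 : k) : OnePoint k) (.IStar 4) :=
    hasFibre_IStar (n := 4) (A₁ := 0)
      (B₁ := -27 * (4 * X ^ 4 - 12 * X ^ 3 + 10 * (C ω + 1) * X ^ 2 - 6 * C ω * X + C ω))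
      (D₁ := 27 * (16 * X ^ 6 - 72 * X ^ 5 + 6 * (19 + 10 * C ω) * X ^ 4 -
        63 * (1 + 2 * C ω) * X ^ 3 + 3 * (-9 + 10 * C ω) * X ^ 2 + 18 * X - 2))
      (Q := -531441 * (12 * X ^ 4 + (16 * C ω - 20) * X ^ 3 - 13 * X ^ 2 -
        (18 + 8 * C ω) * X + 3))
      (by ring) (by rw [C_0]; ring) (by rw [C_0]; ring) (by simp [hω0]) (by norm_num)
      (by simp only [cubicDisc, C_0]; grind) (by simp)
  refine ⟨Δ_polyModel_ne_zero 1 (by rw [cubicDisc_j11b hω]; simp; grind), by simp, ?_, ?_⟩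
  · simp only [List.forall_mem_cons]
    refine ⟨hasFibre_infty hi fun x hx => ⟨?_, ?_, ?_⟩,
      h0, by simp⟩ <;>
      simp only [map_zero, map_one, map_add, map_sub, map_neg, map_mul, map_pow, map_ofNat, aeval_X,
        aeval_C] <;> field_simp <;> ring
  · intro p hp
    induction p using OnePoint.rec with
    | infty => simp at hp
    | coe a =>
      simp at hp
      refine exists_hasFibre_irreducible (eval_derivative_ne_zero (cubicDisc_j11b hω) ?_ ?_) <;>
        simp <;> grind

end Types

/-! ### Function fields of surfaces as double covers of the plane -/

section DoublePlane

variable {k K : Type*} [Field k] [Field K] [Algebra k K]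

variable (k) in
/-- The field `K`, of transcendence degree at least two over `k`, is the quadratic extension
`k(u, x)(v)`, where `v² ∈ k(u, x)`. -/
structure IsDoublePlane (u x v : K) : Prop where
  two_le_trdeg : 2 ≤ Algebra.trdeg k K
  sq_mem : v ^ 2 ∈ IntermediateField.adjoin k {u, x}
  adjoin_eq_top : IntermediateField.adjoin k {u, x, v} = ⊤

namespace IsDoublePlane

variable {u x v : K}

/-- Another triple that generates the same field. -/
lemma of_mem (h : IsDoublePlane k u x v) {u' x' v' : K}
    (hsq : ∀ S : IntermediateField k K, u' ∈ S → x' ∈ S → v' ^ 2 ∈ S)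
    (hmem : ∀ S : IntermediateField k K, u' ∈ S → x' ∈ S → v' ∈ S → u ∈ S ∧ x ∈ S ∧ v ∈ S) :
    IsDoublePlane k u' x' v' := by
  refine ⟨h.two_le_trdeg, hsq _ (IntermediateField.subset_adjoin k _ (by simp))
    (IntermediateField.subset_adjoin k _ (by simp)), ?_⟩
  rw [← top_le_iff, ← h.adjoin_eq_top, IntermediateField.adjoin_le_iff]
  obtain ⟨h1, h2, h3⟩ := hmem (IntermediateField.adjoin k {u', x', v'})
    (IntermediateField.subset_adjoin k _ (by simp))
    (IntermediateField.subset_adjoin k _ (by simp))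
    (IntermediateField.subset_adjoin k _ (by simp))
  rintro z (rfl | rfl | rfl) <;> assumption

open scoped IntermediateField.algebraAdjoinAdjoin in
/-- Since `K` is algebraic over `k(u, x)`, its transcendence degree shows that `u` and `x` are
independent. -/
lemma algebraicIndependent (h : IsDoublePlane k u x v) : AlgebraicIndependent k ![u, x] := by
  have hr : Set.range ![u, x] = {u, x} := by simp [Set.pair_comm]
  set F := IntermediateField.adjoin k ({u, x} : Set K) with hF
  have hv : IsIntegral F v := by
    refine ⟨X ^ 2 - C ⟨v ^ 2, h.sq_mem⟩, monic_X_pow_sub_C _ two_ne_zero, ?_⟩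
    simp [F]
  have htop : IntermediateField.adjoin F {v} = ⊤ := by
    have hle : (⊤ : IntermediateField k K) ≤
        (IntermediateField.adjoin F {v}).restrictScalars k := by
      rw [← h.adjoin_eq_top, IntermediateField.adjoin_le_iff]
      have hF' : ∀ z ∈ F, z ∈ IntermediateField.adjoin F {v} := fun z hz =>
        (IntermediateField.adjoin F {v}).algebraMap_mem ⟨z, hz⟩
      rintro z (rfl | rfl | rfl)
      · exact hF' _ (IntermediateField.subset_adjoin k _ (by simp))
      · exact hF' _ (IntermediateField.subset_adjoin k _ (by simp))
      · exact IntermediateField.mem_adjoin_simple_self F _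
    rw [← top_le_iff]
    exact fun z _ => hle (IntermediateField.mem_top (x := z))
  have halg : Algebra.IsAlgebraic F K := by
    have : Algebra.IsAlgebraic F (IntermediateField.adjoin F {v}) :=
      IntermediateField.isAlgebraic_adjoin fun z hz => by
        rw [Set.mem_singleton_iff.mp hz]; exact hv
    rw [htop] at this
    exact ⟨fun z => by
      have := this.isAlgebraic ⟨z, IntermediateField.mem_top⟩
      exact (isAlgebraic_algebraMap_iff (algebraMap (⊤ : IntermediateField F K) K).injective).mpr
        this⟩
  have halg' : Algebra.IsAlgebraic (Algebra.adjoin k (Set.range ![u, x])) K := by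
    rw [hr]
    exact ⟨fun z => (IsFractionRing.isAlgebraic_iff (Algebra.adjoin k ({u, x} : Set K))
      (IntermediateField.adjoin k ({u, x} : Set K)) K).mpr
      (halg.isAlgebraic z)⟩
  exact (Algebra.IsAlgebraic.isTranscendenceBasis_of_lift_le_trdeg_of_finite k ![u, x]
    (by simpa using h.two_le_trdeg)).1

/-- A polynomial in `u` and `x` does not vanish if it has a non-zero value. -/
lemma aeval_ne_zero (h : IsDoublePlane k u x v) (P : MvPolynomial (Fin 2) k) (a b : k)
    (hP : MvPolynomial.eval ![a, b] P ≠ 0) : MvPolynomial.aeval ![u, x] P ≠ 0 := by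
  intro h0
  have := h.algebraicIndependent (h0.trans (map_zero _).symm)
  simp [this] at hP

lemma ne_zero_of_eq (h : IsDoublePlane k u x v) {y : K}
    (P : MvPolynomial (Fin 2) k) (a b : k)
    (hP : MvPolynomial.eval ![a, b] P ≠ 0) (hy : MvPolynomial.aeval ![u, x] P = y) : y ≠ 0 :=
  hy ▸ h.aeval_ne_zero P a b hP

lemma transcendental_ratFunc [Algebra (RatFunc k) K] [IsScalarTower k (RatFunc k) K]
    (h : IsDoublePlane k (algebraMap (RatFunc k) K RatFunc.X) x v) :
    Transcendental (RatFunc k) x := by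
  set u := algebraMap (RatFunc k) K RatFunc.X with hu
  let : Algebra k[X] K := ((algebraMap (RatFunc k) K).comp (algebraMap k[X] (RatFunc k))).toAlgebra
  have : IsScalarTower k[X] (RatFunc k) K := IsScalarTower.of_algebraMap_eq fun P => rfl
  have : IsScalarTower k k[X] K := IsScalarTower.of_algebraMap_eq fun c => by
    rw [IsScalarTower.algebraMap_apply k (RatFunc k) K,
      IsScalarTower.algebraMap_apply k k[X] (RatFunc k)]; rfl
  have hmap : ∀ P, algebraMap k[X] K P = aeval u P := fun P => by
    have : (IsScalarTower.toAlgHom k k[X] K) = aeval u := by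
      ext
      simp only [IsScalarTower.coe_toAlgHom', aeval_X, hu]
      rw [← RatFunc.algebraMap_X]; rfl
    exact congrArg (· P) this
  intro hx
  have hx' := (IsFractionRing.isAlgebraic_iff k[X] (RatFunc k) K).mpr hx
  have hind := h.algebraicIndependent
  have ht := hind.transcendental_adjoin (s := {0}) (i := 1) (by simp)
  have h0 : ![u, x] '' {0} = {u} := by simp
  rw [h0] at ht
  apply ht
  let g : k[X] →+* Algebra.adjoin k {u} :=
    (((aeval u : k[X] →ₐ[k] K).codRestrict (Algebra.adjoin k {u}) fun P =>
      aeval_mem_adjoin_singleton k u) : k[X] →ₐ[k] _).toRingHom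
  refine hx'.ringHom_of_comp_eq g (RingHom.id K) ?_ ?_
  · intro P Q hPQ
    exact (transcendental_iff_injective.mp (hind.transcendental 0)) (congrArg Subtype.val hPQ)
  · exact RingHom.ext fun P => (hmap P).symm

lemma adjoin_ratFunc [Algebra (RatFunc k) K] [IsScalarTower k (RatFunc k) K]
    (h : IsDoublePlane k (algebraMap (RatFunc k) K RatFunc.X) x v) :
    IntermediateField.adjoin (RatFunc k) {x, v} = ⊤ := by
  have hle : (⊤ : IntermediateField k K) ≤
      (IntermediateField.adjoin (RatFunc k) {x, v}).restrictScalars k := by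
    rw [← h.adjoin_eq_top, IntermediateField.adjoin_le_iff]
    rintro z (rfl | rfl | rfl) <;> rw [SetLike.mem_coe, IntermediateField.mem_restrictScalars]
    · exact (IntermediateField.adjoin (RatFunc k) {x, v}).algebraMap_mem _
    · exact IntermediateField.subset_adjoin _ _ (by simp)
    · exact IntermediateField.subset_adjoin _ _ (by simp)
  rw [← top_le_iff]
  exact fun z _ => hle (IntermediateField.mem_top (x := z))

/-- If `v²` is a monic cubic in `x` over `k[u]`, then `K` is the function field of the elliptic
curve over `k(u)` with this equation. -/
lemma exists_algEquiv (h : IsDoublePlane k u x v) {A B D : k[X]}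
    (e : v ^ 2 = x ^ 3 + aeval u A * x ^ 2 + aeval u B * x + aeval u D) :
    ∃ φ : (polyModel A B D).toAffine.FunctionField ≃ₐ[k] K,
      φ (parameter (polyModel A B D)) = u := by
  have hu : Transcendental k u := h.algebraicIndependent.transcendental 0
  have hinj := nonZeroDivisors_le_comap_nonZeroDivisors_of_injective _
      (transcendental_iff_injective.mp hu)
  let f : RatFunc k →ₐ[k] K := RatFunc.liftAlgHom (aeval u) hinj
  have hf : ∀ P : k[X], f (algebraMap k[X] (RatFunc k) P) = aeval u P := fun P => by
    simpa using RatFunc.liftAlgHom_apply_div (aeval u : k[X] →ₐ[k] K) hinj P 1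
  let : Algebra (RatFunc k) K := f.toRingHom.toAlgebra
  have hmap : ∀ P, algebraMap (RatFunc k) K (algebraMap k[X] (RatFunc k) P) = aeval u P := hf
  have : IsScalarTower k (RatFunc k) K := IsScalarTower.of_algebraMap_eq fun c =>
    (f.commutes c).symm
  have hX : algebraMap (RatFunc k) K RatFunc.X = u := by
    rw [← RatFunc.algebraMap_X, hmap, aeval_X]
  have h' : IsDoublePlane k (algebraMap (RatFunc k) K RatFunc.X) x v := by rwa [hX]
  have hgen : IsGenericPoint (algebraMap k[X] (RatFunc k) A) (algebraMap k[X] (RatFunc k) B)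
      (algebraMap k[X] (RatFunc k) D) x v :=
    ⟨by rw [hmap, hmap, hmap, e], h'.transcendental_ratFunc, h'.adjoin_ratFunc⟩
  exact ⟨hgen.functionFieldEquiv.restrictScalars k,
    (hgen.functionFieldEquiv.commutes RatFunc.X).trans hX⟩

end IsDoublePlane

end DoublePlane

/-! ### The Kummer surface as a double plane -/

section KummerField

variable (k : Type*) [Field k]

lemma isGenericPoint_of_eq {F : Type*} [Field F] {a b c : F} (W : WeierstrassCurve F)
    (hW : W = cubicModel a b c) :
    IsGenericPoint (K := W.toAffine.FunctionField) a b c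
      (algebraMap W.toAffine.CoordinateRing _
        (WeierstrassCurve.Affine.CoordinateRing.mk _ (C X)))
      (algebraMap W.toAffine.CoordinateRing _
        (WeierstrassCurve.Affine.CoordinateRing.mk _ X)) := by
  subst hW
  exact isGenericPoint_functionField a b c

/-- The coordinate function `x₁` on the Kummer surface. -/
def kummerX : kummerField k := ⟨xOne k, IntermediateField.subset_adjoin k _ (by simp)⟩

/-- The coordinate function `x₂` on the Kummer surface. -/
def kummerZ : kummerField k := ⟨xTwo k, IntermediateField.subset_adjoin k _ (by simp)⟩

/-- The function `t = y₁ / y₂` on the Kummer surface. -/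
def kummerT : kummerField k := ⟨yOne k / yTwo k, IntermediateField.subset_adjoin k _ (by simp)⟩

lemma yOne_sq : yOne k ^ 2 = xOne k ^ 3 - xOne k := by
  have h := (isGenericPoint_of_eq (a := 0) (b := -1) (c := 0) (curveOne k) rfl).equation
  have h' := congrArg (algebraMap (CurveOneField k) (ProductField k)) h
  simp only [map_add, map_mul, map_pow, map_neg, map_one, map_zero] at h'
  rw [zero_mul, add_zero, add_zero, neg_one_mul, ← sub_eq_add_neg] at h'
  exact h'

lemma curveTwoGeneric_eq : curveTwoGeneric k = cubicModel 0 0 (-1) := by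
  have : curveTwo k = cubicModel 0 0 (-1) := rfl
  rw [curveTwoGeneric, this, cubicModel_map, map_zero, map_neg, map_one]

lemma isGenericPoint_xTwo : IsGenericPoint (F := CurveOneField k) 0 0 (-1) (xTwo k) (yTwo k) :=
  isGenericPoint_of_eq (curveTwoGeneric k) (curveTwoGeneric_eq k)

lemma yTwo_sq : yTwo k ^ 2 = xTwo k ^ 3 - 1 := by
  rw [(isGenericPoint_xTwo k).equation]
  simp only [map_neg, map_one, map_zero]
  ring

lemma algebraicIndependent_xOne_xTwo : AlgebraicIndependent k ![xOne k, xTwo k] := by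
  have h1 := (isGenericPoint_of_eq (a := 0) (b := -1) (c := 0) (curveOne k) rfl).transcendental
  have h2 := (isGenericPoint_xTwo k).transcendental
  have h := ((algebraicIndependent_unique_type_iff (ι := Unit)
      (x := fun _ => _)).mpr h1).sumElim_comp
    ((algebraicIndependent_unique_type_iff (ι := Unit) (x := fun _ => xTwo k)).mpr h2)
  have h' := h.comp (![Sum.inr (), Sum.inl ()] : Fin 2 → Unit ⊕ Unit) (by decide)
  convert h' using 1
  ext i
  fin_cases i <;> rfl

lemma xTwo_cube_ne_one : xTwo k ^ 3 - 1 ≠ 0 := by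
  intro h
  have := (isGenericPoint_xTwo k).aeval_eq_zero (p := X ^ 3 - 1) (by simpa using h)
  have := congrArg (eval 0) this
  simp at this

/-- The equation of the Kummer surface as a double cover of the plane with coordinates `x₁`, `x₂`.
-/
lemma kummer_relation :
    kummerX k ^ 3 - kummerX k = kummerT k ^ 2 * (kummerZ k ^ 3 - 1) := by
  apply Subtype.ext
  have h := xTwo_cube_ne_one k
  have h' : yTwo k ≠ 0 := by
    intro h0; apply h; rw [← yTwo_sq, h0]; ring
  change xOne k ^ 3 - xOne k = (yOne k / yTwo k) ^ 2 * (xTwo k ^ 3 - 1)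
  rw [div_pow, yOne_sq, yTwo_sq]
  field_simp

lemma isDoublePlane_kummer : IsDoublePlane k (kummerX k) (kummerZ k) (kummerT k) := by
  refine ⟨?_, ?_, ?_⟩
  · have h : AlgebraicIndependent k ![kummerX k, kummerZ k] := by
      have h' := algebraicIndependent_xOne_xTwo k
      rw [← AlgHom.algebraicIndependent_iff (kummerField k).val Subtype.val_injective]
      convert h' using 1
      ext i
      fin_cases i <;> rfl
    simpa using h.lift_cardinalMk_le_trdeg
  · have hx : kummerX k ∈ IntermediateField.adjoin k {kummerX k, kummerZ k} :=
      IntermediateField.subset_adjoin k _ (by simp)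
    have hz : kummerZ k ∈ IntermediateField.adjoin k {kummerX k, kummerZ k} :=
      IntermediateField.subset_adjoin k _ (by simp)
    have h0 : kummerZ k ^ 3 - 1 ≠ 0 := fun h0 =>
      xTwo_cube_ne_one k (congrArg Subtype.val h0)
    rw [show kummerT k ^ 2 = (kummerX k ^ 3 - kummerX k) / (kummerZ k ^ 3 - 1) by
      rw [kummer_relation]; field_simp]
    exact div_mem (sub_mem (pow_mem hx 3) hx) (sub_mem (pow_mem hz 3) (one_mem _))
  · rw [← top_le_iff]
    intro z _
    have h1 : IntermediateField.map (kummerField k).val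
        (IntermediateField.adjoin k {kummerX k, kummerZ k, kummerT k}) = kummerField k := by
      rw [IntermediateField.adjoin_map, Set.image_insert_eq, Set.image_insert_eq,
        Set.image_singleton]
      rfl
    have h2 : (z : ProductField k) ∈ IntermediateField.map (kummerField k).val
        (IntermediateField.adjoin k {kummerX k, kummerZ k, kummerT k}) := by
      rw [h1]; exact z.2
    obtain ⟨w, hw, hwz⟩ := h2
    rwa [← Subtype.ext hwz]

end KummerField

section Maps

variable {k K : Type*} [Field k] [Field K] [Algebra k K] {x z t : K}

/-! ### The two projections -/

open MvPolynomial in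
/-- The second projection: over `k(z)`, the equation is a quadratic twist by `z³ - 1` of `C₁`. -/
lemma map_j4a [CharZero k] (h : IsDoublePlane k x z t) (hr : x ^ 3 - x = t ^ 2 * (z ^ 3 - 1)) :
    ∃ X Y : K, IsDoublePlane k z X Y ∧ Y ^ 2 = X ^ 3 - (z ^ 3 - 1) ^ 2 * X := by
  have hg : z ^ 3 - 1 ≠ 0 := h.ne_zero_of_eq (X 1 ^ 3 - 1) 0 0 (by simp) (by simp)
  have e : (t * (z ^ 3 - 1) ^ 2) ^ 2 =
      ((z ^ 3 - 1) * x) ^ 3 - (z ^ 3 - 1) ^ 2 * ((z ^ 3 - 1) * x) := by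
    linear_combination -(z ^ 3 - 1) ^ 3 * hr
  refine ⟨_, _, h.of_mem (fun S hz hX => ?_) fun S hz hX hY => ?_, e⟩
  · rw [e]
    apply_rules [sub_mem, mul_mem, pow_mem, one_mem]
  · have hg' : z ^ 3 - 1 ∈ S := sub_mem (pow_mem hz 3) (one_mem _)
    refine ⟨?_, hz, ?_⟩
    · have := div_mem hX hg'
      rwa [mul_div_cancel_left₀ _ hg] at this
    · have := div_mem hY (pow_mem hg' 2)
      rwa [mul_div_cancel_right₀ _ (pow_ne_zero 2 hg)] at this

open MvPolynomial in
/-- The first projection: over `k(x)`, the equation is a quadratic twist by `x³ - x` of `C₂`. -/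
lemma map_j4b [CharZero k] (h : IsDoublePlane k x z t) (hr : x ^ 3 - x = t ^ 2 * (z ^ 3 - 1)) :
    ∃ X Y : K, IsDoublePlane k x X Y ∧ Y ^ 2 = X ^ 3 - (x ^ 3 - x) ^ 3 := by
  have hf : x ^ 3 - x ≠ 0 := h.ne_zero_of_eq (X 0 ^ 3 - X 0) 2 0 (by simp; norm_num) (by simp)
  have ht : t ≠ 0 := by rintro rfl; simp [hr] at hf
  have e : ((x ^ 3 - x) ^ 2 / t) ^ 2 = ((x ^ 3 - x) * z) ^ 3 - (x ^ 3 - x) ^ 3 := by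
    rw [div_pow, div_eq_iff (pow_ne_zero 2 ht)]
    linear_combination (x ^ 3 - x) ^ 3 * hr
  refine ⟨_, _, h.of_mem (fun S hx hX => ?_) fun S hx hX hY => ?_, e⟩
  · rw [e]
    apply_rules [sub_mem, mul_mem, pow_mem, one_mem]
  · have hf' : x ^ 3 - x ∈ S := sub_mem (pow_mem hx 3) hx
    refine ⟨hx, ?_, ?_⟩
    · have := div_mem hX hf'
      rwa [mul_div_cancel_left₀ _ hf] at this
    · have := div_mem (pow_mem hf' 2) hY
      rwa [div_div_cancel₀ (pow_ne_zero 2 hf)] at this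

/-! ### Double covers branched along a quartic -/

/-- A double cover `v² = a² x⁴ + b x³ + c x² + d x + e` of the line over `k(u)` is an elliptic
curve, one of the two points at infinity being the origin. The left hand side of `hM` is the norm of
the denominator in the formula for `x` in terms of the Weierstrass coordinates `P`, `Q`. -/
lemma IsDoublePlane.of_quartic {u x v : K} (h : IsDoublePlane k u x v) {a b c d e : K}
    (hmem : ∀ S : IntermediateField k K, u ∈ S → a ∈ S ∧ b ∈ S ∧ c ∈ S ∧ d ∈ S ∧ e ∈ S)
    (h2 : (2 : K) ≠ 0) (ha : a ≠ 0) (hv : v ^ 2 = a ^ 2 * x ^ 4 + b * x ^ 3 + c * x ^ 2 + d * x + e)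
    (hM : (4 * a ^ 2 * (b * x + 2 * a ^ 2 * x ^ 2 + c) - b ^ 2) ^ 2 -
      64 * a ^ 6 * (a ^ 2 * x ^ 4 + b * x ^ 3 + c * x ^ 2 + d * x + e) ≠ 0) :
    ∃ P Q : K, IsDoublePlane k u P Q ∧ Q ^ 2 = P ^ 3 + c * P ^ 2 + (b * d - 4 * a ^ 2 * e) * P +
      (a ^ 2 * d ^ 2 - 4 * a ^ 2 * e * c + e * b ^ 2) := by
  have h2a : 2 * a ≠ 0 := mul_ne_zero h2 ha
  obtain ⟨P, hP⟩ : ∃ P, P = b * x + 2 * a * (v + a * x ^ 2) := ⟨_, rfl⟩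
  obtain ⟨Q, hQ⟩ : ∃ Q, 2 * a * Q = (4 * a ^ 2 * (P + c) - b ^ 2) * x + 2 * a ^ 2 * d + b * P :=
    ⟨_, mul_div_cancel₀ _ h2a⟩
  have hM' : 4 * a ^ 2 * (P + c) - b ^ 2 ≠ 0 := by
    intro h0
    apply hM
    rw [← hv]
    have h1 : 4 * a ^ 2 * (b * x + 2 * a ^ 2 * x ^ 2 + c) - b ^ 2 = - (8 * a ^ 3 * v) := by
      rw [hP] at h0
      linear_combination h0
    rw [h1]; ring
  have eQ : Q ^ 2 = P ^ 3 + c * P ^ 2 + (b * d - 4 * a ^ 2 * e) * P +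
      (a ^ 2 * d ^ 2 - 4 * a ^ 2 * e * c + e * b ^ 2) := by
    have h3 : (2 * a * Q) ^ 2 = (2 * a) ^ 2 * (P ^ 3 + c * P ^ 2 + (b * d - 4 * a ^ 2 * e) * P +
      (a ^ 2 * d ^ 2 - 4 * a ^ 2 * e * c + e * b ^ 2)) := by
      have he : e = v ^ 2 - a ^ 2 * x ^ 4 - b * x ^ 3 - c * x ^ 2 - d * x := by
        linear_combination -hv
      rw [hQ, hP, he]
      ring
    rw [mul_pow] at h3
    exact mul_left_cancel₀ (pow_ne_zero 2 h2a) h3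
  refine ⟨P, Q, h.of_mem (fun S hu hP' => ?_) fun S hu hP' hQ' => ?_, eQ⟩
  · obtain ⟨ma, mb, mc, md, me⟩ := hmem S hu
    rw [eQ]
    apply_rules [add_mem, sub_mem, mul_mem, pow_mem, ofNat_mem]
  · obtain ⟨ma, mb, mc, md, me⟩ := hmem S hu
    have hx : x ∈ S := by
      rw [show x = (2 * a * Q - 2 * a ^ 2 * d - b * P) / (4 * a ^ 2 * (P + c) - b ^ 2) by
        rw [eq_div_iff hM']; linear_combination -hQ]
      apply_rules [add_mem, sub_mem, mul_mem, div_mem, pow_mem, ofNat_mem]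
    refine ⟨hu, hx, ?_⟩
    rw [show v = (P - b * x) / (2 * a) - a * x ^ 2 by rw [hP]; field_simp; ring]
    apply_rules [add_mem, sub_mem, mul_mem, div_mem, pow_mem, ofNat_mem]

/-- A double cover `v² = a x³ + b x² + c x + d` of the line over `k(u)` becomes a Weierstrass
equation in the coordinates `a x` and `a v`. -/
lemma IsDoublePlane.of_cubic {u x v : K} (h : IsDoublePlane k u x v) {a b c d : K}
    (e : v ^ 2 = a * x ^ 3 + b * x ^ 2 + c * x + d) (ha : a ≠ 0)
    (hmem : ∀ S : IntermediateField k K, u ∈ S → a ∈ S) :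
    IsDoublePlane k u (a * x) (a * v) ∧
      (a * v) ^ 2 = (a * x) ^ 3 + b * (a * x) ^ 2 + a * c * (a * x) + a ^ 2 * d := by
  have hx : ∀ {y : K} (S : IntermediateField k K), u ∈ S → a * y ∈ S → y ∈ S := fun S hS hX => by
    have := div_mem hX (hmem S hS)
    rwa [mul_div_cancel_left₀ _ ha] at this
  refine ⟨h.of_mem (fun S hS hX => ?_) fun S hS hX hv => ⟨hS, hx S hS hX, hx S hS hv⟩, ?_⟩
  · rw [mul_pow]
    refine mul_mem (pow_mem (hmem S hS) 2) ?_
    have hle : IntermediateField.adjoin k {u, x} ≤ S := by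
      rw [IntermediateField.adjoin_le_iff]
      rintro w (rfl | rfl)
      · exact hS
      · exact hx S hS hX
    exact hle h.sq_mem
  · rw [mul_pow, e]
    ring

/-- Changes of variables `x ↦ l² (x - r)`, `v ↦ l³ v` in the Weierstrass equation, together with the
replacement of the parameter `u` by `U`, where `u ∈ k(U)`. -/
lemma IsDoublePlane.rescale {u x v : K} (h : IsDoublePlane k u x v) {a b c : K}
    (e : v ^ 2 = x ^ 3 + a * x ^ 2 + b * x + c) {U : K} (l r : K) {A B D : K} (hl : l ≠ 0)
    (hlS : ∀ S : IntermediateField k K, U ∈ S → l ∈ S)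
    (hU : ∀ S : IntermediateField k K, U ∈ S → u ∈ S ∧ r ∈ S)
    (hA : A = l ^ 2 * (3 * r + a)) (hB : B = l ^ 4 * (3 * r ^ 2 + 2 * a * r + b))
    (hD : D = l ^ 6 * (r ^ 3 + a * r ^ 2 + b * r + c)) :
    ∃ X Y : K, IsDoublePlane k U X Y ∧ Y ^ 2 = X ^ 3 + A * X ^ 2 + B * X + D := by
  have hx : ∀ S : IntermediateField k K, U ∈ S → l ^ 2 * (x - r) ∈ S → x ∈ S := fun S hS hX => by
    rw [show x = l ^ 2 * (x - r) / l ^ 2 + r by field_simp; ring]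
    exact add_mem (div_mem hX (pow_mem (hlS S hS) 2)) (hU S hS).2
  refine ⟨l ^ 2 * (x - r), l ^ 3 * v, h.of_mem (fun S hS hX => ?_)
    fun S hS hX hv => ⟨(hU S hS).1, hx S hS hX, ?_⟩, ?_⟩
  · rw [mul_pow]
    refine mul_mem (pow_mem (pow_mem (hlS S hS) 3) 2) ?_
    have hle : IntermediateField.adjoin k {u, x} ≤ S := by
      rw [IntermediateField.adjoin_le_iff]
      rintro w (rfl | rfl)
      · exact (hU S hS).1
      · exact hx S hS hX
    exact hle h.sq_mem
  · rw [show v = l ^ 3 * v / l ^ 3 by field_simp]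
    exact div_mem hv (pow_mem (hlS S hS) 3)
  · rw [hA, hB, hD, mul_pow, e]
    ring

/-- Solution of a quadratic equation `a y² + b y + c = 0` by completing the square. -/
lemma sq_of_quadratic {a b c y : K} (h : a * y ^ 2 + b * y + c = 0) :
    (2 * a * y + b) ^ 2 = b ^ 2 - 4 * a * c := by
  linear_combination 4 * a * h

/-- Roots of constants, as elements of every intermediate field. -/
lemma exists_const_pow_eq [IsAlgClosed k] (K : Type*) [Field K] [Algebra k K] (c : k) {n : ℕ}
    (hn : 0 < n) : ∃ b : K, b ^ n = algebraMap k K c ∧ ∀ S : IntermediateField k K, b ∈ S := by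
  obtain ⟨b, hb⟩ := IsAlgClosed.exists_pow_nat_eq c hn
  exact ⟨algebraMap k K b, by rw [← map_pow, hb], fun S => S.algebraMap_mem b⟩

end Maps

end KummerFibrations

end

noncomputable section

open MvPolynomial

namespace KummerFibrations

/-! ### Fibrations over pencils of lines and conics and related pencils -/

section Maps

variable {k K : Type*} [Field k] [Field K] [Algebra k K] {x z t : K}

/-- The image in `K` of the primitive cube root of unity. -/
lemma exists_cubeRoot (K : Type*) [Field K] [Algebra k K] {ω : k} (hω : ω ^ 2 + ω + 1 = 0) :
    ∃ w : K, algebraMap k K ω = w ∧ w ^ 2 + w + 1 = 0 ∧ ∀ S : IntermediateField k K, w ∈ S :=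
  ⟨_, rfl, by simpa using congrArg (algebraMap k K) hω, fun S => S.algebraMap_mem ω⟩

/-- The parameter `u = t (z - 1) / (x² - 1)`, up to a constant factor. The relation
`u² (x² - 1) (z² + z + 1) = x (z - 1)` is quadratic in `z`; completing the square gives a double
cover of the `x`-line branched along a quartic with leading coefficient `-3 u⁴ = ((2 ω + 1) u²)²`.
-/
lemma map_j1a [hk : CharZero k] [IsAlgClosed k] (h : IsDoublePlane k x z t)
    (hr : x ^ 3 - x = t ^ 2 * (z ^ 3 - 1)) {ω : k} (hω : ω ^ 2 + ω + 1 = 0) :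
    ∃ U X Y : K, IsDoublePlane k U X Y ∧ Y ^ 2 = X ^ 3 + (U ^ 4 + 1) * X ^ 2 + 4 * U ^ 4 * X +
      0 := by
  have : CharZero K := charZero_of_injective_algebraMap (algebraMap k K).injective
  obtain ⟨w, hw, hw2, wS⟩ := exists_cubeRoot K hω
  obtain ⟨β, hβ, βS⟩ := exists_const_pow_eq K (2 * (2 * ω + 1)) (n := 2) (by norm_num)
  simp only [map_add, map_mul, map_one, map_ofNat, hw] at hβ
  have hs : 2 * w + 1 ≠ 0 := by grind
  have hβ0 : β ≠ 0 := by rintro rfl; grind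
  have hx : x ^ 2 - 1 ≠ 0 := h.ne_zero_of_eq (X 0 ^ 2 - 1) 0 0 (by simp) (by simp)
  have hx' : x ≠ 0 := h.ne_zero_of_eq (X 0) 1 0 (by simp) (by simp)
  have hz : z - 1 ≠ 0 := h.ne_zero_of_eq (X 1 - 1) 0 0 (by simp) (by simp)
  obtain ⟨u, hu⟩ : ∃ u, u * (x ^ 2 - 1) = t * (z - 1) := ⟨_, div_mul_cancel₀ _ hx⟩
  have h1 : u ^ 2 * (x ^ 2 - 1) * (z ^ 2 + z + 1) = x * (z - 1) := mul_left_cancel₀ hx <| by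
    linear_combination (u * (x ^ 2 - 1) + t * (z - 1)) * (z ^ 2 + z + 1) * hu - (z - 1) * hr
  have hu0 : u ≠ 0 := by
    rintro rfl
    exact mul_ne_zero hx' hz (by linear_combination -h1)
  obtain ⟨v, hv0⟩ : ∃ v, v = 2 * u ^ 2 * (x ^ 2 - 1) * (z - 1) + 3 * u ^ 2 * (x ^ 2 - 1) - x :=
    ⟨_, rfl⟩
  have hv : v ^ 2 = -3 * u ^ 4 * (x ^ 2 - 1) ^ 2 - 6 * u ^ 2 * x * (x ^ 2 - 1) + x ^ 2 := by
    rw [hv0]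
    linear_combination 4 * u ^ 2 * (x ^ 2 - 1) * h1
  have hd : 2 * u ^ 2 * (x ^ 2 - 1) ≠ 0 := mul_ne_zero (mul_ne_zero two_ne_zero
      (pow_ne_zero 2 hu0)) hx
  have h' : IsDoublePlane k u x v := by
    refine h.of_mem (fun S mu mx => ?_) fun S mu mx mv => ?_
    · rw [hv]
      apply_rules [add_mem, sub_mem, mul_mem, neg_mem, pow_mem, ofNat_mem, one_mem]
    · have mz : z ∈ S := by
        rw [show z = (v - 3 * u ^ 2 * (x ^ 2 - 1) + x) / (2 * u ^ 2 * (x ^ 2 - 1)) + 1 by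
          rw [hv0]; field_simp; ring]
        apply_rules [add_mem, sub_mem, mul_mem, div_mem, pow_mem, ofNat_mem, one_mem]
      refine ⟨mx, mz, ?_⟩
      rw [eq_div_of_mul_eq hz hu.symm]
      apply_rules [add_mem, sub_mem, mul_mem, div_mem, pow_mem, one_mem]
  obtain ⟨P, Q, h2, e2⟩ := h'.of_quartic (a := (2 * w + 1) * u ^ 2) (b := -6 * u ^ 2)
    (c := 6 * u ^ 4 + 1) (d := 6 * u ^ 2) (e := -3 * u ^ 4)
    (fun S mu => by
      have mw := wS S
      refine ⟨?_, ?_, ?_, ?_, ?_⟩ <;>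
      apply_rules [add_mem, sub_mem, mul_mem, neg_mem, pow_mem, ofNat_mem, one_mem])
    two_ne_zero (mul_ne_zero hs (pow_ne_zero 2 hu0)) (by
        rw [hv]
        linear_combination (-4 * u ^ 4 * x ^ 4) * hw2)
    (h'.ne_zero_of_eq ((4 * ((2 * C ω + 1) * X 0 ^ 2) ^ 2 *
        ((-6 * X 0 ^ 2) * X 1 + 2 * ((2 * C ω + 1) * X 0 ^ 2) ^ 2 * X 1 ^ 2 + (6 * X 0 ^ 4 + 1)) -
            (-6 * X 0 ^ 2) ^ 2) ^ 2 -
      64 * ((2 * C ω + 1) * X 0 ^ 2) ^ 6 * (((2 * C ω + 1) * X 0 ^ 2) ^ 2 * X 1 ^ 4 +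
          (-6 * X 0 ^ 2) * X 1 ^ 3 + (6 * X 0 ^ 4 + 1) * X 1 ^ 2 + (6 * X 0 ^ 2) * X 1 +
              (-3 * X 0 ^ 4))) 1 0 (by simp; clear * - hω hk; grind) (by simp [hw]))
  refine ⟨β * u, h2.rescale e2 1 (-6 * u ^ 4) one_ne_zero (fun S _ => one_mem S) (fun S mU => ?_)
    ?_ ?_ ?_⟩
  · have mu : u ∈ S := by
      have := div_mem mU (βS S)
      rwa [mul_div_cancel_left₀ _ hβ0] at this
    exact ⟨mu, by apply_rules [mul_mem, neg_mem, pow_mem, ofNat_mem]⟩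
  all_goals clear h h' h2 e2 hv hv0 hu h1 hr; grind

/-- The parameter `u = t (z - 1) / (x (x + 1))`, up to a constant factor. The relation
`u² x (x + 1) (z² + z + 1) = (x - 1) (z - 1)` is quadratic in `z`; completing the square gives a
double cover of the `x`-line branched along a quartic. -/
lemma map_j1b [hk : CharZero k] [IsAlgClosed k] (h : IsDoublePlane k x z t)
    (hr : x ^ 3 - x = t ^ 2 * (z ^ 3 - 1)) {ω : k} (hω : ω ^ 2 + ω + 1 = 0) :
    ∃ U X Y : K, IsDoublePlane k U X Y ∧ Y ^ 2 = X ^ 3 +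
      (U ^ 4 + 6 * (2 * algebraMap k K ω + 1) * U ^ 2 + 1) * X ^ 2 + (-32 * U ^ 4) * X + 0 := by
  have : CharZero K := charZero_of_injective_algebraMap (algebraMap k K).injective
  obtain ⟨w, hw, hw2, wS⟩ := exists_cubeRoot K hω
  obtain ⟨β, hβ, βS⟩ := exists_const_pow_eq K (2 * ω + 1) (n := 2) (by norm_num)
  simp only [map_add, map_mul, map_one, map_ofNat, hw] at hβ
  rw [hw]
  have hs : 2 * w + 1 ≠ 0 := by grind
  have hβ0 : β ≠ 0 := by rintro rfl; grind
  have hx : x * (x + 1) ≠ 0 := h.ne_zero_of_eq (X 0 * (X 0 + 1)) 1 0 (by simp) (by simp)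
  have hx' : x - 1 ≠ 0 := h.ne_zero_of_eq (X 0 - 1) 0 0 (by simp) (by simp)
  have hz : z - 1 ≠ 0 := h.ne_zero_of_eq (X 1 - 1) 0 0 (by simp) (by simp)
  obtain ⟨u, hu⟩ : ∃ u, u * (x * (x + 1)) = t * (z - 1) := ⟨_, div_mul_cancel₀ _ hx⟩
  have h1 : u ^ 2 * (x * (x + 1)) * (z ^ 2 + z + 1) = (x - 1) * (z - 1) := mul_left_cancel₀ hx <| by
    linear_combination (u * (x * (x + 1)) + t * (z - 1)) * (z ^ 2 + z + 1) * hu - (z - 1) * hr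
  have hu0 : u ≠ 0 := by
    rintro rfl
    exact mul_ne_zero hx' hz (by linear_combination -h1)
  obtain ⟨v, hv0⟩ : ∃ v, v = 2 * u ^ 2 * (x * (x + 1)) * (z - 1) + 3 * u ^ 2 * (x * (x + 1)) -
      (x - 1) := ⟨_, rfl⟩
  have hv : v ^ 2 = -3 * u ^ 4 * (x * (x + 1)) ^ 2 - 6 * u ^ 2 * (x - 1) * (x * (x + 1)) +
      (x - 1) ^ 2 := by
    rw [hv0]
    linear_combination 4 * u ^ 2 * (x * (x + 1)) * h1
  have hd : 2 * u ^ 2 * (x * (x + 1)) ≠ 0 :=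
    mul_ne_zero (mul_ne_zero two_ne_zero (pow_ne_zero 2 hu0)) hx
  have h' : IsDoublePlane k u x v := by
    refine h.of_mem (fun S mu mx => ?_) fun S mu mx mv => ?_
    · rw [hv]
      apply_rules [add_mem, sub_mem, mul_mem, neg_mem, pow_mem, ofNat_mem, one_mem]
    · have mz : z ∈ S := by
        rw [show z = (v - 3 * u ^ 2 * (x * (x + 1)) + (x - 1)) / (2 * u ^ 2 * (x * (x + 1))) + 1 by
          rw [← sub_eq_iff_eq_add, eq_div_iff hd, hv0]; ring]
        apply_rules [add_mem, sub_mem, mul_mem, div_mem, pow_mem, ofNat_mem, one_mem]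
      refine ⟨mx, mz, ?_⟩
      rw [eq_div_of_mul_eq hz hu.symm]
      apply_rules [add_mem, sub_mem, mul_mem, div_mem, pow_mem, one_mem]
  obtain ⟨P, Q, h2, e2⟩ := h'.of_quartic (a := (2 * w + 1) * u ^ 2) (b := -6 * u ^ 4 - 6 * u ^ 2)
    (c := 1 - 3 * u ^ 4) (d := 6 * u ^ 2 - 2) (e := 1)
    (fun S mu => by
      have mw := wS S
      refine ⟨?_, ?_, ?_, ?_, ?_⟩ <;>
      apply_rules [add_mem, sub_mem, mul_mem, neg_mem, pow_mem, ofNat_mem, one_mem])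
    two_ne_zero (mul_ne_zero hs (pow_ne_zero 2 hu0))
    (by rw [hv]; linear_combination (-4 * u ^ 4 * x ^ 4) * hw2)
    (h'.ne_zero_of_eq ((4 * ((2 * C ω + 1) * X 0 ^ 2) ^ 2 *
        ((-6 * X 0 ^ 4 - 6 * X 0 ^ 2) * X 1 + 2 * ((2 * C ω + 1) * X 0 ^ 2) ^ 2 * X 1 ^ 2 +
            (1 - 3 * X 0 ^ 4)) - (-6 * X 0 ^ 4 - 6 * X 0 ^ 2) ^ 2) ^ 2 -
      64 * ((2 * C ω + 1) * X 0 ^ 2) ^ 6 * (((2 * C ω + 1) * X 0 ^ 2) ^ 2 * X 1 ^ 4 +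
          (-6 * X 0 ^ 4 - 6 * X 0 ^ 2) * X 1 ^ 3 + (1 - 3 * X 0 ^ 4) * X 1 ^ 2 +
              (6 * X 0 ^ 2 - 2) * X 1 + 1)) 1 0 (by simp; clear * - hω hk; grind) (by simp [hw]))
  refine ⟨β * u, h2.rescale e2 1 (-6 * u ^ 2) one_ne_zero (fun S _ => one_mem S) (fun S mU => ?_)
    ?_ ?_ ?_⟩
  · have mu : u ∈ S := by
      have := div_mem mU (βS S)
      rwa [mul_div_cancel_left₀ _ hβ0] at this
    exact ⟨mu, by apply_rules [mul_mem, neg_mem, pow_mem, ofNat_mem]⟩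
  all_goals clear h h' h2 e2 hv hv0 hu h1 hr; grind

set_option maxHeartbeats 1000000 in
/-- The parameter is, up to a constant factor, the inverse of `u = t q / (x³ - x)`, where
`q = (z - 1) - (2 ω + 1) x (z + 1)`. In terms of `m = (z - 1) (x - 1) / (x (z - ω))`, the function
`z` is a fractional linear function of `x`, and the relation between `u`, `m` and `x` becomes
quadratic in `x` after division by `q²`; its discriminant is a square times a quartic in `m`. -/
lemma map_j2 [hk : CharZero k] [IsAlgClosed k] (h : IsDoublePlane k x z t)
    (hr : x ^ 3 - x = t ^ 2 * (z ^ 3 - 1)) {ω : k} (hω : ω ^ 2 + ω + 1 = 0) :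
    ∃ U X Y : K, IsDoublePlane k U X Y ∧ Y ^ 2 = X ^ 3 +
      (-(3 * U ^ 4 + 6 * U ^ 2 - 1)) * X ^ 2 + 32 * U ^ 6 * X + 0 := by
  have : CharZero K := charZero_of_injective_algebraMap (algebraMap k K).injective
  obtain ⟨w, hw, hw2, wS⟩ := exists_cubeRoot K hω
  obtain ⟨β, hβ, βS⟩ := exists_const_pow_eq K (-(2 * ω + 1)) (n := 2) (by norm_num)
  simp only [map_add, map_mul, map_one, map_neg, map_ofNat, hw] at hβ
  have hs : 2 * w + 1 ≠ 0 := by grind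
  have hw0 : w ≠ 0 := by rintro rfl; simp at hw2
  have hw1 : w - 1 ≠ 0 := by grind
  have hβ0 : β ≠ 0 := by rintro rfl; grind
  have hx : x ≠ 0 := h.ne_zero_of_eq (X 0) 1 0 (by simp) (by simp)
  have hx1 : x - 1 ≠ 0 := h.ne_zero_of_eq (X 0 - 1) 0 0 (by simp) (by simp)
  have hf : x ^ 3 - x ≠ 0 := h.ne_zero_of_eq (X 0 ^ 3 - X 0) 2 0 (by simp; norm_num) (by simp)
  have ht : t ≠ 0 := by rintro rfl; simp [hr] at hf
  have hz : z - 1 ≠ 0 := h.ne_zero_of_eq (X 1 - 1) 0 0 (by simp) (by simp)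
  have hzw : z - w ≠ 0 := h.ne_zero_of_eq (X 1 - C ω) 0 0
    (by rintro h0; simp_all) (by simp [hw])
  obtain ⟨q, hq⟩ : ∃ q, q = (z - 1) - (2 * w + 1) * x * (z + 1) := ⟨_, rfl⟩
  have hq0 : q ≠ 0 := by
    rw [hq]
    exact h.ne_zero_of_eq ((X 1 - 1) - (2 * C ω + 1) * X 0 * (X 1 + 1)) 0 0 (by simp) (by simp [hw])
  obtain ⟨m, hm⟩ : ∃ m, m * (x * (z - w)) = (z - 1) * (x - 1) :=
    ⟨_, div_mul_cancel₀ _ (mul_ne_zero hx hzw)⟩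
  have hm0 : m ≠ 0 := by
    rintro rfl
    exact mul_ne_zero hz hx1 (by linear_combination -hm)
  have hm2 : m + 2 * w ≠ 0 := fun h0 => by
    have h2 : (z - 1) * (x - 1) + 2 * w * (x * (z - w)) ≠ 0 :=
      h.ne_zero_of_eq ((X 1 - 1) * (X 0 - 1) + 2 * C ω * (X 0 * (X 1 - C ω))) 0 0 (by simp)
        (by simp [hw])
    exact h2 (by linear_combination x * (z - w) * h0 - hm)
  have hm1 : w + m ≠ 0 := fun h0 => by
    have h2 : (z - 1) * (x - 1) + w * (x * (z - w)) ≠ 0 :=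
      h.ne_zero_of_eq ((X 1 - 1) * (X 0 - 1) + C ω * (X 0 * (X 1 - C ω))) 0 0 (by simp)
        (by simp [hw])
    exact h2 (by linear_combination x * (z - w) * h0 - hm)
  have hD : m * x - x + 1 ≠ 0 := fun h0 =>
    mul_ne_zero hw1 hx1 (by linear_combination (z - w) * h0 - hm)
  have hzD : z * (m * x - x + 1) = w * m * x - x + 1 := by linear_combination hm
  have hqD : q * (m * x - x + 1) =
      (w - 1) * m * x - (2 * w + 1) * x * ((w + 1) * m * x - 2 * x + 2) := by
    rw [hq]
    linear_combination (1 - (2 * w + 1) * x) * hzD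
  obtain ⟨u, hu⟩ : ∃ u, u * (x ^ 3 - x) = t * q := ⟨_, div_mul_cancel₀ _ hf⟩
  have hu0 : u ≠ 0 := by
    rintro rfl
    exact mul_ne_zero ht hq0 (by linear_combination -hu)
  have h0 : u ^ 2 * (x ^ 3 - x) * (z ^ 3 - 1) = q ^ 2 := mul_left_cancel₀ hf <| by
    linear_combination (u * (x ^ 3 - x) + t * q) * (z ^ 3 - 1) * hu - q ^ 2 * hr
  have h0' : u ^ 2 * (x ^ 3 - x) * ((w * m * x - x + 1) ^ 3 - (m * x - x + 1) ^ 3) =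
      ((w - 1) * m * x - (2 * w + 1) * x * ((w + 1) * m * x - 2 * x + 2)) ^ 2 *
        (m * x - x + 1) := by
    rw [← hzD, ← hqD]
    linear_combination (m * x - x + 1) ^ 3 * h0
  have h1 : 3 * (2 * w + 1) * w * m * u ^ 2 * ((x + 1) * ((w + m) * x - w)) =
      ((1 - w) * (m + 2 * w)) ^ 2 * ((1 - m) * x - 1) := by
    refine mul_left_cancel₀ (pow_ne_zero 2 (mul_ne_zero hq0 hD)) ?_
    rw [hqD]
    have key : 3 * (2 * w + 1) * w * m * ((x + 1) * ((w + m) * x - w)) *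
        ((w - 1) * m * x - (2 * w + 1) * x * ((w + 1) * m * x - 2 * x + 2)) ^ 2 =
        - (((1 - w) * (m + 2 * w)) ^ 2 * ((x ^ 3 - x) *
          ((w * m * x - x + 1) ^ 3 - (m * x - x + 1) ^ 3))) := by
      clear * - hw2
      grind
    linear_combination u ^ 2 * key - ((1 - w) * (m + 2 * w)) ^ 2 * h0'
  obtain ⟨v, hv0⟩ : ∃ v, v * (3 * w * (m + 2 * w)) =
      2 * (3 * (2 * w + 1) * w * m * u ^ 2 * (w + m)) * x + (3 * (2 * w + 1) * w * m * u ^ 2 * m -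
        ((1 - w) * (m + 2 * w)) ^ 2 * (1 - m)) :=
    ⟨_, div_mul_cancel₀ _ (mul_ne_zero (mul_ne_zero three_ne_zero hw0) hm2)⟩
  have hv : v ^ 2 = (1) ^ 2 * m ^ 4 +
      (-2 * (1 - 2 * w) - 2 * (2 * w + 1) * u ^ 2) * m ^ 3 +
      ((1 - 2 * w) ^ 2 - 4 * w - 3 * u ^ 4 + 6 * (2 * w + 1) * u ^ 2) * m ^ 2 +
      (4 * w * (1 - 2 * w) + 4 * w * (2 * w + 1) * u ^ 2) * m + 4 * w ^ 2 := by
    refine mul_right_cancel₀ (pow_ne_zero 2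
      (mul_ne_zero (mul_ne_zero three_ne_zero hw0) hm2)) ?_
    rw [← mul_pow, hv0]
    have h2 := sq_of_quadratic (K := K) (a := 3 * (2 * w + 1) * w * m * u ^ 2 * (w + m))
      (b := 3 * (2 * w + 1) * w * m * u ^ 2 * m - ((1 - w) * (m + 2 * w)) ^ 2 * (1 - m))
      (c := ((1 - w) * (m + 2 * w)) ^ 2 - 3 * (2 * w + 1) * w * m * u ^ 2 * w) (y := x)
      (by linear_combination h1)
    rw [h2]
    clear * - hw2
    grind
  have hA : 2 * (3 * (2 * w + 1) * w * m * u ^ 2 * (w + m)) ≠ 0 := by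
    have h3 : (3 : K) ≠ 0 := three_ne_zero
    have h2 : (2 : K) ≠ 0 := two_ne_zero
    simp [*]
  have h' : IsDoublePlane k u m v := by
    refine h.of_mem (fun S mu mm => ?_) fun S mu mm mv => ?_
    · have mw := wS S
      rw [hv]
      clear * - mu mm mw
      apply_rules (maxDepth := 300) [add_mem, sub_mem, mul_mem, neg_mem, pow_mem, ofNat_mem,
          one_mem]
    · have mw := wS S
      have mx : x ∈ S := by
        rw [show x = (v * (3 * w * (m + 2 * w)) - (3 * (2 * w + 1) * w * m * u ^ 2 * m -
            ((1 - w) * (m + 2 * w)) ^ 2 * (1 - m))) /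
            (2 * (3 * (2 * w + 1) * w * m * u ^ 2 * (w + m))) by
          rw [eq_div_iff hA]; linear_combination -hv0]
        clear * - mu mm mv mw
        apply_rules (maxDepth := 300) [add_mem, sub_mem, mul_mem, div_mem, pow_mem, ofNat_mem,
            one_mem]
      have mz : z ∈ S := by
        rw [eq_div_of_mul_eq hD hzD]
        apply_rules [add_mem, sub_mem, mul_mem, div_mem, pow_mem, ofNat_mem, one_mem]
      refine ⟨mx, mz, ?_⟩
      rw [eq_div_of_mul_eq hq0 hu.symm, hq]
      apply_rules [add_mem, sub_mem, mul_mem, div_mem, pow_mem, ofNat_mem, one_mem]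
  obtain ⟨P, Q, h2, e2⟩ := h'.of_quartic (a := 1) (b := -2 * (1 - 2 * w) - 2 * (2 * w + 1) * u ^ 2)
    (c := (1 - 2 * w) ^ 2 - 4 * w - 3 * u ^ 4 + 6 * (2 * w + 1) * u ^ 2)
    (d := 4 * w * (1 - 2 * w) + 4 * w * (2 * w + 1) * u ^ 2)
    (e := 4 * w ^ 2)
    (fun S mu => by
      have mw := wS S
      refine ⟨?_, ?_, ?_, ?_, ?_⟩ <;>
      apply_rules [add_mem, sub_mem, mul_mem, neg_mem, pow_mem, ofNat_mem, one_mem])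
    two_ne_zero one_ne_zero hv
    (h'.ne_zero_of_eq ((4 * 1 ^ 2 * ((-2 * (1 - 2 * C ω) - 2 * (2 * C ω + 1) * X 0 ^ 2) * X 1 +
        2 * 1 ^ 2 * X 1 ^ 2 + ((1 - 2 * C ω) ^ 2 - 4 * C ω - 3 * X 0 ^ 4 +
            6 * (2 * C ω + 1) * X 0 ^ 2)) - (-2 * (1 - 2 * C ω) -
                2 * (2 * C ω + 1) * X 0 ^ 2) ^ 2) ^ 2 -
      64 * 1 ^ 6 * (1 ^ 2 * X 1 ^ 4 + (-2 * (1 - 2 * C ω) - 2 * (2 * C ω + 1) * X 0 ^ 2) * X 1 ^ 3 +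
          ((1 - 2 * C ω) ^ 2 - 4 * C ω - 3 * X 0 ^ 4 + 6 * (2 * C ω + 1) * X 0 ^ 2) * X 1 ^ 2 +
              (4 * C ω * (1 - 2 * C ω) + 4 * C ω * (2 * C ω + 1) * X 0 ^ 2) * X 1 +
                  (4 * C ω ^ 2))) 1 0 (by simp; clear * - hω hk; grind) (by simp [hw]))
  obtain ⟨U, hU⟩ : ∃ U, U * (β * u) = 1 := ⟨_, inv_mul_cancel₀ (mul_ne_zero hβ0 hu0)⟩
  have hU0 : U ≠ 0 := by rintro rfl; simp at hU
  have hU2 : U ^ 2 * u ^ 2 * (2 * w + 1) = -1 := by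
    linear_combination -(U * (β * u) + 1) * hU + U ^ 2 * u ^ 2 * hβ
  refine ⟨U, h2.rescale e2 (U ^ 2) (4 * w) (pow_ne_zero 2 hU0)
    (fun S mU => pow_mem mU 2) (fun S mU => ?_) ?_ ?_ ?_⟩
  · have mw := wS S
    have mb := βS S
    have mu : u ∈ S := by
      rw [show u = 1 / (U * β) by rw [eq_div_iff (mul_ne_zero hU0 hβ0)]; linear_combination hU]
      exact div_mem (one_mem S) (mul_mem mU mb)
    exact ⟨mu, mul_mem (ofNat_mem S 4) mw⟩
  all_goals
    clear * - hU2 hw2 this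
    grind

/-- The parameter is `t`, up to a constant factor. Its fibres are the plane cubics
`x³ - x = t² (z³ - 1)`; the lines `z = m x + 1` through the point `(0, 1)` of these cubics give the
double cover of the `m`-line by the two further points of intersection. -/
lemma map_j3 [hk : CharZero k] [IsAlgClosed k] (h : IsDoublePlane k x z t)
    (hr : x ^ 3 - x = t ^ 2 * (z ^ 3 - 1)) {ω : k} (hω : ω ^ 2 + ω + 1 = 0) :
    ∃ U X Y : K, IsDoublePlane k U X Y ∧ Y ^ 2 = X ^ 3 + 0 * X ^ 2 + 0 * X +
      U ^ 4 * (U ^ 4 + 1) := by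
  have : CharZero K := charZero_of_injective_algebraMap (algebraMap k K).injective
  obtain ⟨w, hw, hw2, wS⟩ := exists_cubeRoot K hω
  obtain ⟨l, hl, lS⟩ := exists_const_pow_eq K (-27 / 256 : k) (n := 6) (by norm_num)
  obtain ⟨β, hβ, βS⟩ := exists_const_pow_eq K (-27 / 4 : k) (n := 4) (by norm_num)
  simp only [map_div₀, map_neg, map_ofNat] at hβ hl
  have hs : 2 * w + 1 ≠ 0 := by grind
  have hβ0 : β ≠ 0 := by rintro rfl; norm_num at hβ
  have hl0 : l ≠ 0 := by rintro rfl; norm_num at hl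
  have hx : x ≠ 0 := h.ne_zero_of_eq (X 0) 1 0 (by simp) (by simp)
  have hx1 : x ^ 3 - x ≠ 0 := h.ne_zero_of_eq (X 0 ^ 3 - X 0) 2 0 (by simp; norm_num) (by simp)
  have ht : t ≠ 0 := by rintro rfl; simp [hr] at hx1
  obtain ⟨m, hm⟩ : ∃ m, m * x = z - 1 := ⟨_, div_mul_cancel₀ _ hx⟩
  obtain rfl : z = m * x + 1 := by linear_combination -hm
  have h1 : (1 - t ^ 2 * m ^ 3) * x ^ 2 - 3 * t ^ 2 * m ^ 2 * x - (1 + 3 * t ^ 2 * m) = 0 :=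
    mul_left_cancel₀ hx <| by linear_combination hr
  have hd : 1 - t ^ 2 * m ^ 3 ≠ 0 := by
    intro h0
    have h2 : 3 * x ^ 2 * (m * x + 1) + (m * x) ^ 2 ≠ 0 :=
      h.ne_zero_of_eq (3 * X 0 ^ 2 * X 1 + (X 1 - 1) ^ 2) 0 0 (by simp) (by simp)
    exact h2 (by linear_combination x ^ 2 * ((m ^ 2 * x ^ 2 + 3 * m * x + 3) * h0 - m ^ 2 * h1))
  obtain ⟨v, hv0⟩ : ∃ v, v = 2 * (1 - t ^ 2 * m ^ 3) * x - 3 * t ^ 2 * m ^ 2 := ⟨_, rfl⟩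
  have hv : v ^ 2 = -3 * t ^ 4 * m ^ 4 - 4 * t ^ 2 * m ^ 3 + 12 * t ^ 2 * m + 4 := by
    rw [hv0]
    linear_combination 4 * (1 - t ^ 2 * m ^ 3) * h1
  have h' : IsDoublePlane k t m v := by
    refine h.of_mem (fun S mu mx => ?_) fun S mu mx mv => ?_
    · rw [hv]
      apply_rules [add_mem, sub_mem, mul_mem, neg_mem, pow_mem, ofNat_mem, one_mem]
    · have mz : x ∈ S := by
        rw [show x = (v + 3 * t ^ 2 * m ^ 2) / (2 * (1 - t ^ 2 * m ^ 3)) by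
          rw [eq_div_iff (mul_ne_zero two_ne_zero hd), hv0]; ring]
        apply_rules [add_mem, sub_mem, mul_mem, div_mem, pow_mem, ofNat_mem, one_mem]
      exact ⟨mz, add_mem (mul_mem mx mz) (one_mem S), mu⟩
  obtain ⟨P, Q, h2, e2⟩ := h'.of_quartic (a := (2 * w + 1) * t ^ 2) (b := -4 * t ^ 2)
    (c := 0) (d := 12 * t ^ 2) (e := 4)
    (fun S mu => by
      have mw := wS S
      refine ⟨?_, ?_, ?_, ?_, ?_⟩ <;>
      apply_rules [add_mem, sub_mem, mul_mem, neg_mem, pow_mem, ofNat_mem, one_mem, zero_mem])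
    two_ne_zero (mul_ne_zero hs (pow_ne_zero 2 ht))
    (by rw [hv]; linear_combination (-4 * t ^ 4 * m ^ 4) * hw2)
    (h'.ne_zero_of_eq ((4 * ((2 * C ω + 1) * X 0 ^ 2) ^ 2 *
        ((-4 * X 0 ^ 2) * X 1 + 2 * ((2 * C ω + 1) * X 0 ^ 2) ^ 2 * X 1 ^ 2 + 0) -
            (-4 * X 0 ^ 2) ^ 2) ^ 2 -
      64 * ((2 * C ω + 1) * X 0 ^ 2) ^ 6 * (((2 * C ω + 1) * X 0 ^ 2) ^ 2 * X 1 ^ 4 +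
          (-4 * X 0 ^ 2) * X 1 ^ 3 + 0 * X 1 ^ 2 + (12 * X 0 ^ 2) * X 1 + 4)) 1 0
              (by simp; clear * - hω hk; grind) (by simp [hw]))
  refine ⟨β * t, h2.rescale e2 l 0 hl0 (fun S _ => lS S) (fun S mU => ?_) ?_ ?_ ?_⟩
  · have mu : t ∈ S := by
      have := div_mem mU (βS S)
      rwa [mul_div_cancel_left₀ _ hβ0] at this
    exact ⟨mu, zero_mem S⟩
  · ring
  · linear_combination 64 * l ^ 4 * t ^ 4 * hw2
  · rw [hl, mul_pow, hβ]
    linear_combination (243 / 4 * t ^ 8) * hw2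

/-- The fibres lie over the conics `3 x² - u x (z - 1) = (z - ω) (z - ω²)`, which are parametrized
by the slope `m = x / (z - ω)` of the lines through their point `(0, ω)`. -/
lemma map_j5 [hk : CharZero k] [IsAlgClosed k] (h : IsDoublePlane k x z t)
    (hr : x ^ 3 - x = t ^ 2 * (z ^ 3 - 1)) {ω : k} (hω : ω ^ 2 + ω + 1 = 0) :
    ∃ U X Y : K, IsDoublePlane k U X Y ∧ Y ^ 2 = X ^ 3 +
      (2 * U * (U ^ 2 + 3 * U + 3) - 4) * X ^ 2 + (-(8 * U * (U ^ 2 + 3 * U + 3))) * X + 0 := by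
  have : CharZero K := charZero_of_injective_algebraMap (algebraMap k K).injective
  obtain ⟨w, hw, hw2, wS⟩ := exists_cubeRoot K hω
  obtain ⟨l, hl, lS⟩ := exists_const_pow_eq K (2 * (2 * ω + 1) / 9) (n := 2) (by norm_num)
  simp only [map_add, map_mul, map_one, map_ofNat, map_div₀, hw] at hl
  have hs : 2 * w + 1 ≠ 0 := by grind
  have hl0 : l ≠ 0 := by rintro rfl; grind
  obtain ⟨c, hc⟩ : ∃ c, c = w - 1 := ⟨_, rfl⟩
  obtain ⟨d, hd⟩ : ∃ d, d = w ^ 2 - 1 := ⟨_, rfl⟩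
  have hc0 : c ≠ 0 := by grind
  have hd0 : d ≠ 0 := by grind
  have hcS : ∀ S : IntermediateField k K, c ∈ S := fun S => hc ▸ sub_mem (wS S) (one_mem S)
  have hdS : ∀ S : IntermediateField k K, d ∈ S := fun S =>
    hd ▸ sub_mem (pow_mem (wS S) 2) (one_mem S)
  have hx : x ≠ 0 := h.ne_zero_of_eq (X 0) 1 0 (by simp) (by simp)
  have hz : z - 1 ≠ 0 := h.ne_zero_of_eq (X 1 - 1) 0 0 (by simp) (by simp)
  have hzc : z - w ≠ 0 := h.ne_zero_of_eq (X 1 - C ω) 0 0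
    (by rintro h0; simp_all) (by simp [hw])
  have hzd : z - w ^ 2 ≠ 0 := h.ne_zero_of_eq (X 1 - C ω ^ 2) 0 0
    (by rintro h0; simp_all) (by simp [hw])
  obtain ⟨m, hm⟩ : ∃ m, m * (z - w) = x := ⟨_, div_mul_cancel₀ _ hzc⟩
  have hm0 : m ≠ 0 := by rintro rfl; exact hx (by linear_combination -hm)
  have hN : 3 * c * m ^ 2 - d ≠ 0 := fun h0 => by
    have h2 : 3 * (w - 1) * x ^ 2 - (w ^ 2 - 1) * (z - w) ^ 2 ≠ 0 :=
      h.ne_zero_of_eq (3 * (C ω - 1) * X 0 ^ 2 - (C ω ^ 2 - 1) * (X 1 - C ω) ^ 2) 0 0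
        (by simp; clear * - hω hk; grind) (by simp [hw])
    apply h2
    rw [← hc, ← hd]
    linear_combination (z - w) ^ 2 * h0 - 3 * c * (m * (z - w) + x) * hm
  obtain ⟨u, hu⟩ : ∃ u, u * (x * (z - 1)) = 3 * x ^ 2 - (z - w) * (z - w ^ 2) :=
    ⟨_, div_mul_cancel₀ _ (mul_ne_zero hx hz)⟩
  have hZ : (z - 1) * (3 * m ^ 2 - u * m - 1) = 3 * c * m ^ 2 - d := mul_left_cancel₀ hzc <| by
    rw [← hm] at hu
    rw [hc, hd]
    linear_combination -hu
  have hden : 3 * m ^ 2 - u * m - 1 ≠ 0 := fun h0 => hN (by rw [← hZ, h0, mul_zero])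
  have hZd : (z - w ^ 2) * (3 * m ^ 2 - u * m - 1) = m * d * (c * (2 * w + 1) * m + u) := by
    rw [hc, hd] at *
    clear * - hZ hw2
    grind
  have hxd : x * (3 * m ^ 2 - u * m - 1) = m * (c * u * m + (2 * w + 1)) := by
    rw [← hm, hc, hd] at *
    clear * - hZ hw2
    grind
  have hT0 : c * (2 * w + 1) * m + u ≠ 0 := fun h0 =>
    mul_ne_zero hzd hden (by rw [hZd, h0, mul_zero])
  have h1 : t ^ 2 * (z - 1) * (z - w ^ 2) = m * (x ^ 2 - 1) := mul_left_cancel₀ hzc <| by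
    have : z ^ 3 - 1 = (z - 1) * (z - w) * (z - w ^ 2) := by
      clear * - hw2
      grind
    rw [this] at hr
    linear_combination -hr - (x ^ 2 - 1) * hm
  have h2 : t ^ 2 * (3 * c * m ^ 2 - d) * (d * (c * (2 * w + 1) * m + u)) =
      (m * (c * u * m + (2 * w + 1))) ^ 2 - (3 * m ^ 2 - u * m - 1) ^ 2 :=
    mul_left_cancel₀ hm0 <| by
    rw [← hxd, ← hZ]
    linear_combination (3 * m ^ 2 - u * m - 1) ^ 2 * h1 -
      t ^ 2 * (z - 1) * (3 * m ^ 2 - u * m - 1) * hZd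
  obtain ⟨v, hv0⟩ : ∃ v, v = t * (d * (c * (2 * w + 1) * m + u)) := ⟨_, rfl⟩
  have hv : v ^ 2 = (u ^ 2 - d ^ 2) * (c * (2 * w + 1)) * m ^ 3 +
      ((u ^ 2 - d ^ 2) * u + 2 * u * (c * (2 * w + 1))) * m ^ 2 +
      (2 * u ^ 2 + c * (2 * w + 1)) * m + u := by
    have h3 : t ^ 2 * d ^ 2 * (c * (2 * w + 1) * m + u) =
        ((u - d) * m + 1) * ((u + d) * m + 1) := mul_left_cancel₀ hN <| by
      have key : d * ((m * (c * u * m + (2 * w + 1))) ^ 2 - (3 * m ^ 2 - u * m - 1) ^ 2) =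
          (3 * c * m ^ 2 - d) * (((u - d) * m + 1) * ((u + d) * m + 1)) := by
        rw [hc, hd]
        clear * - hw2
        grind
      linear_combination d * h2 + key
    rw [hv0]
    linear_combination (c * (2 * w + 1) * m + u) * h3
  have h' : IsDoublePlane k u m v := by
    refine h.of_mem (fun S mu mm => ?_) fun S mu mm mv => ?_
    · have mw := wS S
      have mc := hcS S
      have md := hdS S
      rw [hv]
      clear * - mu mm mw mc md
      apply_rules (maxDepth := 300) [add_mem, sub_mem, mul_mem, pow_mem, ofNat_mem, one_mem]
    · have mw := wS S
      have mc := hcS S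
      have md := hdS S
      have mz : z ∈ S := by
        rw [show z = (3 * c * m ^ 2 - d) / (3 * m ^ 2 - u * m - 1) + 1 by
          rw [← sub_eq_iff_eq_add, eq_div_iff hden, hZ]]
        apply_rules [add_mem, sub_mem, mul_mem, div_mem, pow_mem, ofNat_mem, one_mem]
      refine ⟨hm ▸ mul_mem mm (sub_mem mz mw), mz, ?_⟩
      rw [eq_div_of_mul_eq (mul_ne_zero hd0 hT0) hv0.symm]
      apply_rules [add_mem, sub_mem, mul_mem, div_mem, pow_mem, ofNat_mem, one_mem]
  have hu2 : u ^ 2 - d ^ 2 ≠ 0 :=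
    h'.ne_zero_of_eq (X 0 ^ 2 - (C ω ^ 2 - 1) ^ 2) 0 0 (by simp; clear * - hω hk; grind)
      (by simp [hw, hd])
  obtain ⟨h3, e3⟩ := h'.of_cubic hv (mul_ne_zero hu2 (mul_ne_zero hc0 hs)) fun S mu => by
    have mw := wS S
    have mc := hcS S
    have md := hdS S
    apply_rules [add_mem, sub_mem, mul_mem, pow_mem, ofNat_mem, one_mem]
  obtain ⟨U, hU⟩ : ∃ U, u = d * (U + 1) := ⟨u / d - 1, by field_simp; ring⟩
  refine ⟨U, h3.rescale e3 l (-(c * (2 * w + 1)) * (u - d)) hl0 (fun S _ => lS S)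
      (fun S mU => ?_) ?_ ?_ ?_⟩
  · have mw := wS S
    have mc := hcS S
    have md := hdS S
    have mu : u ∈ S := by
      rw [hU]
      apply_rules [add_mem, mul_mem, one_mem]
    exact ⟨mu, by apply_rules [add_mem, sub_mem, neg_mem, mul_mem, ofNat_mem, one_mem]⟩
  all_goals
    rw [hU, hc, hd]
    clear * - hl hw2 this
    grind

/-- The fibres lie over the lines `x = u (z - 1)`. The coordinate `r = 1 / (z - ω)` on such a line
moves a branch point to infinity. -/
lemma map_j6a [hk : CharZero k] [IsAlgClosed k] (h : IsDoublePlane k x z t)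
    (hr : x ^ 3 - x = t ^ 2 * (z ^ 3 - 1)) {ω : k} (hω : ω ^ 2 + ω + 1 = 0) :
    ∃ U X Y : K, IsDoublePlane k U X Y ∧ Y ^ 2 = X ^ 3 +
      (2 * U ^ 2 - U * (U ^ 2 - U + 1)) * X ^ 2 +
      (-(2 * U ^ 2 * (U * (U ^ 2 - U + 1)))) * X + 0 := by
  have : CharZero K := charZero_of_injective_algebraMap (algebraMap k K).injective
  obtain ⟨w, hw, hw2, wS⟩ := exists_cubeRoot K hω
  obtain ⟨l, hl, lS⟩ := exists_const_pow_eq K (-(2 * ω + 1)) (n := 2) (by norm_num)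
  simp only [map_add, map_mul, map_one, map_neg, map_ofNat, hw] at hl
  have hs : 2 * w + 1 ≠ 0 := by grind
  have hl0 : l ≠ 0 := by rintro rfl; grind
  have hx : x ≠ 0 := h.ne_zero_of_eq (X 0) 1 0 (by simp) (by simp)
  have hz : z - 1 ≠ 0 := h.ne_zero_of_eq (X 1 - 1) 0 0 (by simp) (by simp)
  have hzc : z - w ≠ 0 := h.ne_zero_of_eq (X 1 - C ω) 0 0
    (by rintro h0; simp_all) (by simp [hw])
  have hzd : z - w ^ 2 ≠ 0 := h.ne_zero_of_eq (X 1 - C ω ^ 2) 0 0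
    (by rintro h0; simp_all) (by simp [hw])
  obtain ⟨u, hu⟩ : ∃ u, u * (z - 1) = x := ⟨_, div_mul_cancel₀ _ hz⟩
  have hu0 : u ≠ 0 := by rintro rfl; exact hx (by linear_combination -hu)
  obtain ⟨r, hr0⟩ : ∃ r, r * (z - w) = 1 := ⟨_, div_mul_cancel₀ _ hzc⟩
  have hr1 : r ≠ 0 := by rintro rfl; simp at hr0
  have h1 : t ^ 2 * (z - w) * (z - w ^ 2) = u * (x ^ 2 - 1) := mul_left_cancel₀ hz <| by
    have : z ^ 3 - 1 = (z - 1) * (z - w) * (z - w ^ 2) := by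
      clear * - hw2
      grind
    rw [this] at hr
    linear_combination -hr - (x ^ 2 - 1) * hu
  have hrz : r * (z - 1) = 1 + (w - 1) * r := by linear_combination hr0
  have hrd : r * (z - w ^ 2) = 1 + (2 * w + 1) * r := by linear_combination hr0 - r * hw2
  obtain ⟨v, hv0⟩ : ∃ v, v = t * ((z - w ^ 2) * r) := ⟨_, rfl⟩
  have hv : v ^ 2 = (2 * w + 1) * u * (u ^ 2 * (w - 1) ^ 2 - 1) * r ^ 3 +
      u * (u ^ 2 * (w - 1) ^ 2 - 1 + 2 * u ^ 2 * (w - 1) * (2 * w + 1)) * r ^ 2 +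
      u ^ 3 * ((2 * w + 1) + 2 * (w - 1)) * r + u ^ 3 := by
    have h2 : v ^ 2 = u * (1 + (2 * w + 1) * r) * ((u * (1 + (w - 1) * r)) ^ 2 - r ^ 2) := by
      rw [← hrz, ← hrd, hv0]
      rw [← hu] at h1
      linear_combination r ^ 3 * (z - w ^ 2) * h1 -
        t ^ 2 * (z - w ^ 2) ^ 2 * r ^ 2 * hr0
    rw [h2]
    ring
  have h' : IsDoublePlane k u r v := by
    refine h.of_mem (fun S mu mm => ?_) fun S mu mm mv => ?_
    · have mw := wS S
      rw [hv]
      clear * - mu mm mw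
      apply_rules (maxDepth := 300) [add_mem, sub_mem, mul_mem, pow_mem, ofNat_mem, one_mem]
    · have mw := wS S
      have mz : z ∈ S := by
        rw [show z = 1 / r + w by rw [← sub_eq_iff_eq_add, eq_div_iff hr1, mul_comm, hr0]]
        apply_rules [add_mem, div_mem, one_mem]
      refine ⟨hu ▸ mul_mem mu (sub_mem mz (one_mem S)), mz, ?_⟩
      rw [eq_div_of_mul_eq (mul_ne_zero hzd hr1) hv0.symm]
      apply_rules [sub_mem, mul_mem, div_mem, pow_mem, one_mem]
  have hu2 : u ^ 2 * (w - 1) ^ 2 - 1 ≠ 0 :=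
    h'.ne_zero_of_eq (X 0 ^ 2 * (C ω - 1) ^ 2 - 1) 0 0 (by simp) (by simp [hw])
  obtain ⟨h3, e3⟩ := h'.of_cubic hv (mul_ne_zero (mul_ne_zero hs hu0) hu2) fun S mu => by
    have mw := wS S
    apply_rules [add_mem, sub_mem, mul_mem, pow_mem, ofNat_mem, one_mem]
  obtain ⟨U, hU⟩ : ∃ U, u = (2 * w + 1) / 3 * U :=
    ⟨3 / (2 * w + 1) * u, by field_simp⟩
  refine ⟨U, h3.rescale e3 l (-(u ^ 2 * (2 * w + 1) * (u * (w - 1) + 1))) hl0 (fun S _ => lS S)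
    (fun S mU => ?_) ?_ ?_ ?_⟩
  · have mw := wS S
    have mu : u ∈ S := by
      rw [hU]
      apply_rules [add_mem, mul_mem, div_mem, ofNat_mem, one_mem]
    exact ⟨mu, by apply_rules [add_mem, sub_mem, neg_mem, mul_mem, pow_mem, ofNat_mem, one_mem]⟩
  all_goals
    rw [hU]
    clear * - hl hw2 this
    grind

/-- The fibres lie over the lines `x - 1 = u (z - 1)`. The coordinate `r = 1 / (z - ω)` on such a
line moves a branch point to infinity. -/
lemma map_j6b [hk : CharZero k] [IsAlgClosed k] (h : IsDoublePlane k x z t)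
    (hr : x ^ 3 - x = t ^ 2 * (z ^ 3 - 1)) {ω : k} (hω : ω ^ 2 + ω + 1 = 0) :
    ∃ U X Y : K, IsDoublePlane k U X Y ∧ Y ^ 2 = X ^ 3 +
      (-(algebraMap k K ω * U ^ 2 - U * (2 * U - 1) * (U + algebraMap k K ω ^ 2))) * X ^ 2 +
      (-(algebraMap k K ω * U ^ 2 * (U * (2 * U - 1) * (U + algebraMap k K ω ^ 2)))) * X + 0 := by
  have : CharZero K := charZero_of_injective_algebraMap (algebraMap k K).injective
  obtain ⟨w, hw, hw2, wS⟩ := exists_cubeRoot K hω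
  obtain ⟨l, hl, lS⟩ := exists_const_pow_eq K ((2 * ω + 1) / 4) (n := 2) (by norm_num)
  simp only [map_add, map_mul, map_one, map_div₀, map_ofNat, hw] at hl
  rw [hw]
  have hs : 2 * w + 1 ≠ 0 := by grind
  have hl0 : l ≠ 0 := by rintro rfl; grind
  have hx : x - 1 ≠ 0 := h.ne_zero_of_eq (X 0 - 1) 0 0 (by simp) (by simp)
  have hz : z - 1 ≠ 0 := h.ne_zero_of_eq (X 1 - 1) 0 0 (by simp) (by simp)
  have hzc : z - w ≠ 0 := h.ne_zero_of_eq (X 1 - C ω) 0 0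
    (by rintro h0; simp_all) (by simp [hw])
  have hzd : z - w ^ 2 ≠ 0 := h.ne_zero_of_eq (X 1 - C ω ^ 2) 0 0
    (by rintro h0; simp_all) (by simp [hw])
  obtain ⟨u, hu⟩ : ∃ u, u * (z - 1) = x - 1 := ⟨_, div_mul_cancel₀ _ hz⟩
  have hu0 : u ≠ 0 := by rintro rfl; exact hx (by linear_combination -hu)
  obtain ⟨r, hr0⟩ : ∃ r, r * (z - w) = 1 := ⟨_, div_mul_cancel₀ _ hzc⟩
  have hr1 : r ≠ 0 := by rintro rfl; simp at hr0
  have h1 : t ^ 2 * (z - w) * (z - w ^ 2) = u * (x * (x + 1)) := mul_left_cancel₀ hz <| by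
    have : z ^ 3 - 1 = (z - 1) * (z - w) * (z - w ^ 2) := by
      clear * - hw2
      grind
    rw [this] at hr
    linear_combination -hr - x * (x + 1) * hu
  have hrz : r * (z - 1) = 1 + (w - 1) * r := by linear_combination hr0
  have hrd : r * (z - w ^ 2) = 1 + (2 * w + 1) * r := by linear_combination hr0 - r * hw2
  obtain ⟨v, hv0⟩ : ∃ v, v = t * ((z - w ^ 2) * r) := ⟨_, rfl⟩
  have hv : v ^ 2 = (2 * w + 1) * u * ((u * (w - 1) + 1) * (u * (w - 1) + 2)) * r ^ 3 +
      u * ((u * (w - 1) + 1) * (u * (w - 1) + 2) +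
        u * (2 * (u * (w - 1)) + 3) * (2 * w + 1)) * r ^ 2 +
      u * (u * (2 * (u * (w - 1)) + 3) + u ^ 2 * (2 * w + 1)) * r + u ^ 3 := by
    have h2 : v ^ 2 = u * (1 + (2 * w + 1) * r) * ((u * (1 + (w - 1) * r) + r) *
        (u * (1 + (w - 1) * r) + 2 * r)) := by
      rw [← hrz, ← hrd, hv0]
      rw [show x = u * (z - 1) + 1 by linear_combination -hu] at h1
      linear_combination r ^ 3 * (z - w ^ 2) * h1 -
        t ^ 2 * (z - w ^ 2) ^ 2 * r ^ 2 * hr0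
    rw [h2]
    ring
  have h' : IsDoublePlane k u r v := by
    refine h.of_mem (fun S mu mm => ?_) fun S mu mm mv => ?_
    · have mw := wS S
      rw [hv]
      clear * - mu mm mw
      apply_rules (maxDepth := 300) [add_mem, sub_mem, mul_mem, pow_mem, ofNat_mem, one_mem]
    · have mw := wS S
      have mz : z ∈ S := by
        rw [show z = 1 / r + w by rw [← sub_eq_iff_eq_add, eq_div_iff hr1, mul_comm, hr0]]
        apply_rules [add_mem, div_mem, one_mem]
      refine ⟨?_, mz, ?_⟩
      · rw [show x = u * (z - 1) + 1 by linear_combination -hu]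
        apply_rules [add_mem, sub_mem, mul_mem, one_mem]
      rw [eq_div_of_mul_eq (mul_ne_zero hzd hr1) hv0.symm]
      apply_rules [sub_mem, mul_mem, div_mem, pow_mem, one_mem]
  have hu2 : (u * (w - 1) + 1) * (u * (w - 1) + 2) ≠ 0 :=
    h'.ne_zero_of_eq ((X 0 * (C ω - 1) + 1) * (X 0 * (C ω - 1) + 2)) 0 0 (by simp) (by simp [hw])
  obtain ⟨h3, e3⟩ := h'.of_cubic hv (mul_ne_zero (mul_ne_zero hs hu0) hu2) fun S mu => by
    have mw := wS S
    apply_rules [add_mem, sub_mem, mul_mem, pow_mem, ofNat_mem, one_mem]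
  have hw1 : 1 - w ≠ 0 := by grind
  obtain ⟨U, hU⟩ : ∃ U, u = 2 / 3 * (1 - w) * U := ⟨3 / 2 / (1 - w) * u, by field_simp⟩
  refine ⟨U, h3.rescale e3 l (-(u ^ 2 * (2 * w + 1) * (u * (w - 1) + 2))) hl0 (fun S _ => lS S)
    (fun S mU => ?_) ?_ ?_ ?_⟩
  · have mw := wS S
    have mu : u ∈ S := by
      rw [hU]
      apply_rules [sub_mem, mul_mem, div_mem, ofNat_mem, one_mem]
    exact ⟨mu, by apply_rules [add_mem, sub_mem, neg_mem, mul_mem, pow_mem, ofNat_mem, one_mem]⟩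
  all_goals
    rw [hU]
    clear * - hl hw2 this
    grind

set_option maxHeartbeats 1000000 in
/-- The fibres lie over the conics `u x (x - 1) = (z - 1) (z - ω + (2 ω + 1) x)`, which are
parametrized by the slope `m = (z - 1) / x` of the lines through their point `(0, 1)`. The
coordinate `r = 1 / (u - (2 ω + 1) m)` moves a branch point to infinity. -/
lemma map_j8 [hk : CharZero k] [IsAlgClosed k] (h : IsDoublePlane k x z t)
    (hr : x ^ 3 - x = t ^ 2 * (z ^ 3 - 1)) {ω : k} (hω : ω ^ 2 + ω + 1 = 0) :
    ∃ U X Y : K, IsDoublePlane k U X Y ∧ Y ^ 2 = X ^ 3 +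
      U * (3 * U + 2) * X ^ 2 + U ^ 2 * (1 + 3 * U + 3 * U ^ 2 + 2 * U ^ 3) * X + 0 := by
  have : CharZero K := charZero_of_injective_algebraMap (algebraMap k K).injective
  obtain ⟨w, hw, hw2, wS⟩ := exists_cubeRoot K hω
  obtain ⟨l, hl, lS⟩ := exists_const_pow_eq K (-(ω * (2 * ω + 1)) / 9) (n := 2) (by norm_num)
  simp only [map_add, map_mul, map_one, map_neg, map_div₀, map_ofNat, hw] at hl
  have hw0 : w ≠ 0 := by rintro rfl; simp at hw2
  have hs : 2 * w + 1 ≠ 0 := by grind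
  have hl0 : l ≠ 0 := by rintro rfl; grind
  have hx : x ≠ 0 := h.ne_zero_of_eq (X 0) 1 0 (by simp) (by simp)
  have hx1 : x - 1 ≠ 0 := h.ne_zero_of_eq (X 0 - 1) 0 0 (by simp) (by simp)
  have hz : z - 1 ≠ 0 := h.ne_zero_of_eq (X 1 - 1) 0 0 (by simp) (by simp)
  have hzc : z - w ≠ 0 := h.ne_zero_of_eq (X 1 - C ω) 0 0
    (by rintro h0; simp_all) (by simp [hw])
  have hzd : z - w ^ 2 ≠ 0 := h.ne_zero_of_eq (X 1 - C ω ^ 2) 0 0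
    (by rintro h0; simp_all) (by simp [hw])
  obtain ⟨m, hm⟩ : ∃ m, m * x = z - 1 := ⟨_, div_mul_cancel₀ _ hx⟩
  have hm0 : m ≠ 0 := by rintro rfl; exact hz (by linear_combination -hm)
  obtain ⟨u, hu⟩ : ∃ u, u * (x * (x - 1)) = (z - 1) * (z - w + (2 * w + 1) * x) :=
    ⟨_, div_mul_cancel₀ _ (mul_ne_zero hx hx1)⟩
  have hu0 : u ≠ 0 := by
    rintro rfl
    have h2 : z - w + (2 * w + 1) * x ≠ 0 :=
      h.ne_zero_of_eq (X 1 - C ω + (2 * C ω + 1) * X 0) 0 0 (by rintro h0; simp_all)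
        (by simp [hw])
    exact mul_ne_zero hz h2 (by linear_combination -hu)
  obtain ⟨e, he⟩ : ∃ e, e = m ^ 2 + (2 * w + 1) * m - u := ⟨_, rfl⟩
  have hxe : x * e = m * (w - 1) - u := mul_left_cancel₀ hx <| by
    rw [he]
    linear_combination (m * x + (2 * w + 1) * x + z - w) * hm - hu
  have hxe1 : (x - 1) * e = m * (w ^ 2 - 1 - m) := by linear_combination hxe - he - m * hw2
  have hdm : w ^ 2 - 1 - m ≠ 0 := fun h0 => by
    have h2 : (w ^ 2 - 1) * x - (z - 1) ≠ 0 :=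
      h.ne_zero_of_eq ((C ω ^ 2 - 1) * X 0 - (X 1 - 1)) 0 0 (by simp) (by simp [hw])
    exact h2 (by linear_combination x * h0 + hm)
  have he0 : e ≠ 0 := fun h0 => mul_ne_zero hm0 hdm (by rw [← hxe1, h0, mul_zero])
  obtain ⟨n, hn⟩ : ∃ n, n = u - (2 * w + 1) * m := ⟨_, rfl⟩
  have hzde : (z - w ^ 2) * e = n * (w ^ 2 - 1 - m) := by
    rw [show z = m * x + 1 by linear_combination -hm, hn]
    rw [he] at *
    clear * - hxe hw2
    grind
  have hn0 : n ≠ 0 := fun h0 => mul_ne_zero hzd he0 (by rw [hzde, h0, zero_mul])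
  have hzce : (z - w) * e = u * (w - 1 - m) - (w - 1) * (2 * w + 1) * m := by
    rw [show z = m * x + 1 by linear_combination -hm]
    rw [he] at *
    clear * - hxe hw2
    grind
  obtain ⟨p, hp⟩ : ∃ p, p = u * (w - 1 - m) - (w - 1) * (2 * w + 1) * m := ⟨_, rfl⟩
  rw [← hp] at hzce
  have hp0 : p ≠ 0 := by rw [← hzce]; exact mul_ne_zero hzc he0
  have hx2 : (x + 1) * e = m ^ 2 + 3 * w * m - 2 * u := by linear_combination hxe + he
  have h1 : t ^ 2 * (p * n) = m ^ 2 + 3 * w * m - 2 * u := by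
    have h2 : t ^ 2 * (m * (z - w) * (z - w ^ 2)) = (x - 1) * (x + 1) := mul_left_cancel₀ hx <| by
      have : z ^ 3 - 1 = (z - 1) * (z - w) * (z - w ^ 2) := by
        clear * - hw2
        grind
      rw [this] at hr
      linear_combination -hr + t ^ 2 * (z - w) * (z - w ^ 2) * hm
    refine mul_left_cancel₀ (mul_ne_zero hm0 hdm) ?_
    rw [← hx2, ← hxe1]
    linear_combination e ^ 2 * h2 - t ^ 2 * m * (z - w) * e * hzde -
      t ^ 2 * m * n * (w ^ 2 - 1 - m) * hzce +
      t ^ 2 * p * n * hxe1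
  obtain ⟨r, hr0⟩ : ∃ r, r * n = 1 := ⟨_, div_mul_cancel₀ _ hn0⟩
  have hr1 : r ≠ 0 := by rintro rfl; simp at hr0
  obtain ⟨v, hv0⟩ : ∃ v, v = t * (p * n * r ^ 2) := ⟨_, rfl⟩
  have hv : v ^ 2 = (-u ^ 2 * (-u ^ 2 - 3 * w * (2 * w + 1) * u - 6 * u) * (2 * w + 1) * (-1 / 9)) *
        r ^ 3 +
      (-u ^ 2 * (2 * u + 3 * w * (2 * w + 1)) + (3 * w ^ 2 + u) *
        (-u ^ 2 - 3 * w * (2 * w + 1) * u - 6 * u)) * (2 * w + 1) * (-1 / 9) * r ^ 2 +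
      (u ^ 2 + (3 * w ^ 2 + u) * (2 * u + 3 * w * (2 * w + 1))) * (2 * w + 1) * (-1 / 9) * r +
      (-(3 * w ^ 2 + u)) * (2 * w + 1) * (-1 / 9) := by
    have h2 : v ^ 2 = (m ^ 2 + 3 * w * m - 2 * u) * r ^ 2 * (p * r) := by
      rw [hv0]
      linear_combination p * r ^ 3 * (r * n) * h1 + (m ^ 2 + 3 * w * m - 2 * u) * p * r ^ 3 * hr0
    have h3 : p * r = (-u ^ 2 * r + (3 * w ^ 2 + u)) * (-(2 * w + 1) / 3) := by
      rw [hp]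
      have : m = (u - n) * (-(2 * w + 1) / 3) := by rw [hn]; linear_combination (4 / 3 * m) * hw2
      rw [this]
      clear * - hr0 hw2
      grind
    have h4 : (m ^ 2 + 3 * w * m - 2 * u) * r ^ 2 =
        (-(u * r - 1) ^ 2 - 3 * w * (2 * w + 1) * (u * r ^ 2 - r) - 6 * u * r ^ 2) / 3 := by
      have : m = (u - n) * (-(2 * w + 1) / 3) := by rw [hn]; linear_combination (4 / 3 * m) * hw2
      rw [this]
      clear * - hr0 hw2
      grind
    rw [h2, h3, h4]
    ring
  have h' : IsDoublePlane k u r v := by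
    refine h.of_mem (fun S mu mm => ?_) fun S mu mm mv => ?_
    · have mw := wS S
      rw [hv]
      clear * - mu mm mw
      apply_rules (maxDepth := 400)
        [add_mem, sub_mem, neg_mem, mul_mem, div_mem, pow_mem, ofNat_mem, one_mem]
    · have mw := wS S
      have mn : n ∈ S := by
        rw [eq_div_of_mul_eq hr1 ((mul_comm _ _).trans hr0)]
        exact div_mem (one_mem S) mm
      have mm : m ∈ S := by
        rw [show m = (u - n) / (2 * w + 1) by rw [eq_div_iff hs, hn]; ring]
        apply_rules [add_mem, sub_mem, mul_mem, div_mem, ofNat_mem, one_mem]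
      have me : e ∈ S := by
        rw [he]
        apply_rules [add_mem, sub_mem, mul_mem, pow_mem, ofNat_mem, one_mem]
      have mp : p ∈ S := by
        rw [hp]
        apply_rules [add_mem, sub_mem, mul_mem, pow_mem, ofNat_mem, one_mem]
      have mx : x ∈ S := by
        rw [eq_div_of_mul_eq he0 hxe]
        apply_rules [sub_mem, mul_mem, div_mem, one_mem]
      have mz : z ∈ S := by
        rw [show z = m * x + 1 by linear_combination -hm]
        exact add_mem (mul_mem mm mx) (one_mem S)
      refine ⟨mx, mz, ?_⟩
      rw [eq_div_of_mul_eq (mul_ne_zero (mul_ne_zero hp0 hn0) (pow_ne_zero 2 hr1)) hv0.symm]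
      apply_rules [mul_mem, div_mem, pow_mem]
  have hu2 : -u ^ 2 - 3 * w * (2 * w + 1) * u - 6 * u ≠ 0 :=
    h'.ne_zero_of_eq (-X 0 ^ 2 - 3 * C ω * (2 * C ω + 1) * X 0 - 6 * X 0) 1 0
      (by simp; clear * - hω hk; grind) (by simp [hw])
  obtain ⟨h3, e3⟩ := h'.of_cubic hv (mul_ne_zero (mul_ne_zero (mul_ne_zero (neg_ne_zero.mpr
      (pow_ne_zero 2 hu0)) hu2) hs) (by norm_num)) fun S mu => by
    have mw := wS S
    clear * - mu mw
    apply_rules (maxDepth := 400)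
      [add_mem, sub_mem, neg_mem, mul_mem, div_mem, pow_mem, ofNat_mem, one_mem]
  obtain ⟨U, hU⟩ : ∃ U, u = 3 * w ^ 2 * U := ⟨u / (3 * w ^ 2), by field_simp⟩
  refine ⟨U, h3.rescale e3 l (-3 * (2 * w + 1) * (U * (U - w ^ 2) * (1 + U))) hl0 (fun S _ => lS S)
    (fun S mU => ?_) ?_ ?_ ?_⟩
  · have mw := wS S
    have mu : u ∈ S := by
      rw [hU]
      apply_rules [mul_mem, pow_mem, ofNat_mem]
    exact ⟨mu, by apply_rules [add_mem, sub_mem, neg_mem, mul_mem, pow_mem, ofNat_mem, one_mem]⟩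
  all_goals
    rw [hU]
    clear * - hl hw2 this
    grind

/-! ### Fibrations obtained from the fibration `j8` -/

/-- The parameter `m = x / u`, up to an affine transformation: the equation is cubic in `1 / u`. -/
lemma map_j9 [hk : CharZero k] [IsAlgClosed k] {u y : K} (h : IsDoublePlane k u x y)
    (hy : y ^ 2 = x ^ 3 + u * (3 * u + 2) * x ^ 2 +
      u ^ 2 * (1 + 3 * u + 3 * u ^ 2 + 2 * u ^ 3) * x + 0) :
    ∃ U X Y : K, IsDoublePlane k U X Y ∧ Y ^ 2 = X ^ 3 + 0 * X ^ 2 + 0 * X +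
      U * (U ^ 2 - 4) ^ 3 := by
  have : CharZero K := charZero_of_injective_algebraMap (algebraMap k K).injective
  obtain ⟨l, hl, lS⟩ := exists_const_pow_eq K (8192 : k) (n := 6) (by norm_num)
  simp only [map_ofNat] at hl
  have hl0 : l ≠ 0 := by rintro rfl; norm_num at hl
  have hu : u ≠ 0 := h.ne_zero_of_eq (X 0) 1 0 (by simp) (by simp)
  obtain ⟨m, rfl⟩ : ∃ m, x = m * u := ⟨x / u, by field_simp⟩
  have hv : (y / u ^ 3) ^ 2 = m * (m + 1) ^ 2 * u⁻¹ ^ 3 + 3 * m * (m + 1) * u⁻¹ ^ 2 +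
      3 * m * u⁻¹ + 2 * m := by
    rw [div_pow, hy]
    field_simp
    ring
  have h' : IsDoublePlane k m u⁻¹ (y / u ^ 3) := by
    refine h.of_mem (fun S mm mr => ?_) fun S mm mr mv => ?_
    · rw [hv]
      apply_rules [add_mem, mul_mem, pow_mem, ofNat_mem, one_mem]
    · have mu : u ∈ S := inv_mem_iff.mp mr
      refine ⟨mu, mul_mem mm mu, ?_⟩
      rw [show y = y / u ^ 3 * u ^ 3 by field_simp]
      exact mul_mem mv (pow_mem mu 3)
  have hm : m * (m + 1) ^ 2 ≠ 0 :=
    h'.ne_zero_of_eq (X 0 * (X 0 + 1) ^ 2) 1 0 (by simp) (by simp)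
  obtain ⟨h3, e3⟩ := h'.of_cubic hv hm fun S mm => by
    apply_rules [add_mem, mul_mem, pow_mem, one_mem]
  refine ⟨2 * (2 * m + 1), h3.rescale e3 l (-(m * (m + 1))) hl0 (fun S _ => lS S)
      (fun S mU => ?_) ?_ ?_ ?_⟩
  · have mm : m ∈ S := by
      rw [show m = (2 * (2 * m + 1) / 2 - 1) / 2 by ring]
      exact div_mem (sub_mem (div_mem mU (ofNat_mem S 2)) (one_mem S)) (ofNat_mem S 2)
    exact ⟨mm, by apply_rules [add_mem, neg_mem, mul_mem, one_mem]⟩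
  · ring
  · ring
  · rw [hl]
    ring

/-- The parameter `m = x / u²`: the equation is cubic in `u`. -/
lemma map_j10 [hk : CharZero k] {u y : K} (h : IsDoublePlane k u x y)
    (hy : y ^ 2 = x ^ 3 + u * (3 * u + 2) * x ^ 2 +
      u ^ 2 * (1 + 3 * u + 3 * u ^ 2 + 2 * u ^ 3) * x + 0) :
    ∃ U X Y : K, IsDoublePlane k U X Y ∧ Y ^ 2 = X ^ 3 + U ^ 2 * (U + 3) * X ^ 2 +
      U ^ 2 * (-2 * U ^ 2 - 2 * U + 3) * X + U ^ 4 * (U - 1) := by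
  have : CharZero K := charZero_of_injective_algebraMap (algebraMap k K).injective
  have hu : u ≠ 0 := h.ne_zero_of_eq (X 0) 1 0 (by simp) (by simp)
  obtain ⟨m, rfl⟩ : ∃ m, x = m * u ^ 2 := ⟨x / u ^ 2, by field_simp⟩
  have hv : (y / u ^ 2) ^ 2 = 2 * m * u ^ 3 + (m ^ 3 + 3 * m ^ 2 + 3 * m) * u ^ 2 +
      (2 * m ^ 2 + 3 * m) * u + m := by
    rw [div_pow, hy]
    field_simp
    ring
  have h' : IsDoublePlane k m u (y / u ^ 2) := by
    refine h.of_mem (fun S mm mu => ?_) fun S mm mu mv => ?_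
    · rw [hv]
      apply_rules [add_mem, mul_mem, pow_mem, ofNat_mem, one_mem]
    · refine ⟨mu, mul_mem mm (pow_mem mu 2), ?_⟩
      rw [show y = y / u ^ 2 * u ^ 2 by field_simp]
      exact mul_mem mv (pow_mem mu 2)
  have hm : m ≠ 0 := h'.ne_zero_of_eq (X 0) 1 0 (by simp) (by simp)
  obtain ⟨h3, e3⟩ := h'.of_cubic hv (mul_ne_zero two_ne_zero hm) fun S mm =>
    mul_mem (ofNat_mem S 2) mm
  exact ⟨m, h3.rescale e3 1 (-m) one_ne_zero (fun S _ => one_mem S)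
    (fun S mm => ⟨mm, neg_mem mm⟩) (by ring) (by ring) (by ring)⟩

/-- The fibration with parameter `m = x / D`, where `D` is a quadratic factor of
`u² (2 u + 1) (u² + u + 1)`. The substitution `x = m D` turns the equation of the fibration `j8`
into `y² = D² (2 m u³ + b u² + c u + d)`, with coefficients in `k(m)`. -/
lemma IsDoublePlane.of_pencil [hk : CharZero k] {u y : K} (h : IsDoublePlane k u x y) {D b c d : K}
    (hD : D ≠ 0) (hDS : ∀ S : IntermediateField k K, u ∈ S → D ∈ S)
    (hy : y ^ 2 = D ^ 2 * (2 * (x / D) * u ^ 3 + b * u ^ 2 + c * u + d))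
    (hS : ∀ S : IntermediateField k K, x / D ∈ S → b ∈ S ∧ c ∈ S ∧ d ∈ S) :
    ∃ P Q : K, IsDoublePlane k (x / D) P Q ∧ Q ^ 2 = P ^ 3 + b * P ^ 2 + 2 * (x / D) * c * P +
      (2 * (x / D)) ^ 2 * d := by
  have : CharZero K := charZero_of_injective_algebraMap (algebraMap k K).injective
  have hv : (y / D) ^ 2 = 2 * (x / D) * u ^ 3 + b * u ^ 2 + c * u + d := by
    rw [div_pow, hy, mul_div_cancel_left₀ _ (pow_ne_zero 2 hD)]
  have hx : x ≠ 0 := h.ne_zero_of_eq (X 1) 0 1 (by simp) (by simp)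
  have h' : IsDoublePlane k (x / D) u (y / D) := by
    refine h.of_mem (fun S mm mu => ?_) fun S mm mu mv => ?_
    · obtain ⟨mb, mc, md⟩ := hS S mm
      rw [hv]
      apply_rules [add_mem, mul_mem, pow_mem, ofNat_mem]
    · have mD := hDS S mu
      refine ⟨mu, ?_, ?_⟩
      · simpa [hD] using mul_mem mm mD
      · simpa [hD] using mul_mem mv mD
  obtain ⟨h3, e3⟩ := h'.of_cubic hv (mul_ne_zero two_ne_zero (div_ne_zero hx hD)) fun S mm =>
    mul_mem (ofNat_mem S 2) mm
  exact ⟨_, _, h3, e3⟩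

/-- The pencil with `D = u (u + 1 / 2)`. -/
lemma map_j7a [hk : CharZero k] [IsAlgClosed k] {u y : K} (h : IsDoublePlane k u x y)
    (hy : y ^ 2 = x ^ 3 + u * (3 * u + 2) * x ^ 2 +
      u ^ 2 * (1 + 3 * u + 3 * u ^ 2 + 2 * u ^ 3) * x + 0) :
    ∃ U X Y : K, IsDoublePlane k U X Y ∧ Y ^ 2 = X ^ 3 +
      (-(U * (U + 1) * (U + 2))) * X ^ 2 + U ^ 2 * (U + 2) ^ 2 * X + 0 := by
  have : CharZero K := charZero_of_injective_algebraMap (algebraMap k K).injective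
  obtain ⟨l, hl, lS⟩ := exists_const_pow_eq K (-1 : k) (n := 2) (by norm_num)
  simp only [map_neg, map_one] at hl
  have hl0 : l ≠ 0 := by rintro rfl; norm_num at hl
  have hD : u * (u + 1 / 2) ≠ 0 := h.ne_zero_of_eq (X 0 * (X 0 + C (1 / 2))) 1 0 (by simp; norm_num)
      (by simp [map_ofNat (algebraMap k K) 2])
  obtain ⟨m, hm⟩ : ∃ m, x = m * (u * (u + 1 / 2)) := ⟨_, (div_mul_cancel₀ x hD).symm⟩
  have hm' : x / (u * (u + 1 / 2)) = m := by rw [hm, mul_div_cancel_right₀ _ hD]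
  obtain ⟨P, Q, h3, e3⟩ := h.of_pencil (b := m ^ 3 + 3 * m ^ 2 + 2 * m)
      (c := m ^ 3 / 2 + 2 * m ^ 2 + 2 * m)
    (d := 0) hD (fun S mu => by
      apply_rules [add_mem, sub_mem, mul_mem, div_mem, pow_mem, ofNat_mem, one_mem])
    (by
      rw [hm', hy, hm]
      ring)
    (fun S mm => by
      rw [hm'] at mm
      refine ⟨?_, ?_, ?_⟩ <;>
      apply_rules [add_mem, sub_mem, neg_mem, mul_mem, div_mem, pow_mem, ofNat_mem, one_mem,
          zero_mem])
  rw [hm'] at h3 e3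
  refine ⟨m, h3.rescale e3 l 0 hl0 (fun S _ => lS S) (fun S mU => ?_) ?_ ?_ ?_⟩
  · have mm : m ∈ S := mU
    exact ⟨mm, by apply_rules [add_mem, sub_mem, neg_mem, mul_mem, div_mem, pow_mem, ofNat_mem,
        one_mem, zero_mem]⟩
  all_goals
    clear * - hl this
    grind

/-- The pencil with `D = u (u - ω²)`. -/
lemma map_j7b [hk : CharZero k] [IsAlgClosed k] {u y : K} (h : IsDoublePlane k u x y)
    (hy : y ^ 2 = x ^ 3 + u * (3 * u + 2) * x ^ 2 +
      u ^ 2 * (1 + 3 * u + 3 * u ^ 2 + 2 * u ^ 3) * x + 0) {ω : k} (hω : ω ^ 2 + ω + 1 = 0) :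
    ∃ U X Y : K, IsDoublePlane k U X Y ∧ Y ^ 2 = X ^ 3 +
      algebraMap k K ω * U * (U - 1) * (U - 3 * algebraMap k K ω - 2) * X ^ 2 +
      (-(2 * algebraMap k K ω ^ 2 * U ^ 2 * (U - 1) ^ 2)) * X + 0 := by
  have : CharZero K := charZero_of_injective_algebraMap (algebraMap k K).injective
  obtain ⟨w, hw, hw2, wS⟩ := exists_cubeRoot K hω
  rw [hw]
  have hD : u * (u - w ^ 2) ≠ 0 := h.ne_zero_of_eq (X 0 * (X 0 - C ω ^ 2)) 2 0
      (by simp; clear * - hω hk; grind) (by simp [hw])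
  obtain ⟨m, hm⟩ : ∃ m, x = m * (u * (u - w ^ 2)) := ⟨_, (div_mul_cancel₀ x hD).symm⟩
  have hm' : x / (u * (u - w ^ 2)) = m := by rw [hm, mul_div_cancel_right₀ _ hD]
  obtain ⟨P, Q, h3, e3⟩ := h.of_pencil (b := m ^ 3 + 3 * m ^ 2 + (1 - 2 * w) * m)
      (c := -w ^ 2 * m ^ 3 + 2 * m ^ 2 - w * m)
    (d := 0) hD (fun S mu => by
      have mw := wS S
      apply_rules [add_mem, sub_mem, mul_mem, div_mem, pow_mem, ofNat_mem, one_mem])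
    (by
      rw [hm', hy, hm]
      clear * - hw2 this; grind)
    (fun S mm => by
      rw [hm'] at mm
      have mw := wS S
      refine ⟨?_, ?_, ?_⟩ <;>
      apply_rules [add_mem, sub_mem, neg_mem, mul_mem, div_mem, pow_mem, ofNat_mem, one_mem,
          zero_mem])
  rw [hm'] at h3 e3
  refine ⟨w ^ 2 * m, h3.rescale e3 (w ^ 2) 0 (pow_ne_zero 2 (by grind))
      (fun S _ => pow_mem (wS S) 2) (fun S mU => ?_) ?_ ?_ ?_⟩
  · have mm : m ∈ S := by
      rw [show m = w * (w ^ 2 * m) by clear * - hw2; grind]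
      exact mul_mem (wS S) mU
    have mw := wS S
    exact ⟨mm, by apply_rules [add_mem, sub_mem, neg_mem, mul_mem, div_mem, pow_mem, ofNat_mem,
        one_mem, zero_mem]⟩
  all_goals
    clear * - hw2 this
    grind

/-- The pencil with `D = u² + u + 1`. -/
lemma map_j11a [hk : CharZero k] [IsAlgClosed k] {u y : K} (h : IsDoublePlane k u x y)
    (hy : y ^ 2 = x ^ 3 + u * (3 * u + 2) * x ^ 2 +
      u ^ 2 * (1 + 3 * u + 3 * u ^ 2 + 2 * u ^ 3) * x + 0) :
    ∃ U X Y : K, IsDoublePlane k U X Y ∧ Y ^ 2 = X ^ 3 + 0 * X ^ 2 +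
      (-27 * U ^ 2 * (U ^ 4 + 6 * U ^ 3 + 5 * U ^ 2 - 6 * U + 1)) * X +
      (-54 * U ^ 3 * (U ^ 2 + 1) * (U ^ 4 + 9 * U ^ 3 + 20 * U ^ 2 - 9 * U + 1)) := by
  have : CharZero K := charZero_of_injective_algebraMap (algebraMap k K).injective
  obtain ⟨l, hl, lS⟩ := exists_const_pow_eq K (-9 : k) (n := 2) (by norm_num)
  simp only [map_neg, map_ofNat] at hl
  have hl0 : l ≠ 0 := by rintro rfl; norm_num at hl
  have hD : u ^ 2 + u + 1 ≠ 0 := h.ne_zero_of_eq (X 0 ^ 2 + X 0 + 1) 0 0 (by simp) (by simp)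
  obtain ⟨m, hm⟩ : ∃ m, x = m * (u ^ 2 + u + 1) := ⟨_, (div_mul_cancel₀ x hD).symm⟩
  have hm' : x / (u ^ 2 + u + 1) = m := by rw [hm, mul_div_cancel_right₀ _ hD]
  obtain ⟨P, Q, h3, e3⟩ := h.of_pencil (b := m ^ 3 + 3 * m ^ 2 + m) (c := m ^ 3 + 2 * m ^ 2)
    (d := m ^ 3) hD (fun S mu => by
      apply_rules [add_mem, sub_mem, mul_mem, div_mem, pow_mem, ofNat_mem, one_mem])
    (by
      rw [hm', hy, hm]
      ring)
    (fun S mm => by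
      rw [hm'] at mm
      refine ⟨?_, ?_, ?_⟩ <;>
      apply_rules [add_mem, sub_mem, neg_mem, mul_mem, div_mem, pow_mem, ofNat_mem, one_mem,
          zero_mem])
  rw [hm'] at h3 e3
  refine ⟨m, h3.rescale e3 l (-(m * (m ^ 2 + 3 * m + 1)) / 3) hl0 (fun S _ => lS S)
      (fun S mU => ?_) ?_ ?_ ?_⟩
  · have mm : m ∈ S := mU
    exact ⟨mm, by apply_rules [add_mem, sub_mem, neg_mem, mul_mem, div_mem, pow_mem, ofNat_mem,
        one_mem, zero_mem]⟩
  all_goals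
    clear * - hl this
    grind

/-- The pencil with `D = (u + 1 / 2) (u - ω)`. -/
lemma map_j11b [hk : CharZero k] [IsAlgClosed k] {u y : K} (h : IsDoublePlane k u x y)
    (hy : y ^ 2 = x ^ 3 + u * (3 * u + 2) * x ^ 2 +
      u ^ 2 * (1 + 3 * u + 3 * u ^ 2 + 2 * u ^ 3) * x + 0) {ω : k} (hω : ω ^ 2 + ω + 1 = 0) :
    ∃ U X Y : K, IsDoublePlane k U X Y ∧ Y ^ 2 = X ^ 3 + 0 * X ^ 2 +
      (-27 * U ^ 2 * (4 * U ^ 4 - 12 * U ^ 3 + 10 * (algebraMap k K ω + 1) * U ^ 2 -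
        6 * algebraMap k K ω * U + algebraMap k K ω)) * X +
      27 * U ^ 3 * (16 * U ^ 6 - 72 * U ^ 5 + 6 * (19 + 10 * algebraMap k K ω) * U ^ 4 -
        63 * (1 + 2 * algebraMap k K ω) * U ^ 3 + 3 * (-9 + 10 * algebraMap k K ω) * U ^ 2 +
        18 * U - 2) := by
  have : CharZero K := charZero_of_injective_algebraMap (algebraMap k K).injective
  obtain ⟨w, hw, hw2, wS⟩ := exists_cubeRoot K hω
  rw [hw]
  obtain ⟨l, hl, lS⟩ := exists_const_pow_eq K (-9 / 4 : k) (n := 2) (by norm_num)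
  simp only [map_div₀, map_neg, map_ofNat] at hl
  have hl0 : l ≠ 0 := by rintro rfl; norm_num at hl
  have hD : (u + 1 / 2) * (u - w) ≠ 0 := h.ne_zero_of_eq ((X 0 + C (1 / 2)) * (X 0 - C ω)) 0 0
      (by simp; clear * - hω hk; grind) (by simp [hw, map_ofNat (algebraMap k K) 2])
  obtain ⟨m, hm⟩ : ∃ m, x = m * ((u + 1 / 2) * (u - w)) := ⟨_, (div_mul_cancel₀ x hD).symm⟩
  have hm' : x / ((u + 1 / 2) * (u - w)) = m := by rw [hm, mul_div_cancel_right₀ _ hD]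
  obtain ⟨P, Q, h3, e3⟩ := h.of_pencil (b := m ^ 3 + 3 * m ^ 2 - 2 * w ^ 2 * m)
      (c := m ^ 3 * (1 / 2 - w) + 2 * m ^ 2)
    (d := -w / 2 * m ^ 3) hD (fun S mu => by
      have mw := wS S
      apply_rules [add_mem, sub_mem, mul_mem, div_mem, pow_mem, ofNat_mem, one_mem])
    (by
      rw [hm', hy, hm]
      clear * - hw2 this; grind)
    (fun S mm => by
      rw [hm'] at mm
      have mw := wS S
      refine ⟨?_, ?_, ?_⟩ <;>
      apply_rules [add_mem, sub_mem, neg_mem, mul_mem, div_mem, pow_mem, ofNat_mem, one_mem,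
          zero_mem])
  rw [hm'] at h3 e3
  refine ⟨-m / 2, h3.rescale e3 l (-(m * (m ^ 2 + 3 * m - 2 * w ^ 2)) / 3) hl0 (fun S _ => lS S)
      (fun S mU => ?_) ?_ ?_ ?_⟩
  · have mm : m ∈ S := by
      rw [show m = -(2 * (-m / 2)) by ring]
      exact neg_mem (mul_mem (ofNat_mem S 2) mU)
    have mw := wS S
    exact ⟨mm, by apply_rules [add_mem, sub_mem, neg_mem, mul_mem, div_mem, pow_mem, ofNat_mem,
        one_mem, zero_mem]⟩
  all_goals
    clear * - hl hw2 this
    grind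

end Maps

end KummerFibrations

end

noncomputable section

open Polynomial

namespace KummerFibrations

/-! ### The function fields of the sixteen fibrations -/

section FunctionFields

variable {k K : Type*} [Field k] [Field K] [Algebra k K] {ω : k}

/-- A double plane with an equation `Y² = X³ + A(U) X² + B(U) X + D(U)` is the function field of the
corresponding elliptic curve over `k(u)`. -/
lemma nonempty_algEquiv_of_eq {W : WeierstrassCurve (RatFunc k)} {A B D : k[X]}
    (hW : W = polyModel A B D)
    (h : ∃ U X Y : K, IsDoublePlane k U X Y ∧
      Y ^ 2 = X ^ 3 + aeval U A * X ^ 2 + aeval U B * X + aeval U D) :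
    Nonempty (W.toAffine.FunctionField ≃ₐ[k] K) := by
  subst hW
  obtain ⟨U, X, Y, h, e⟩ := h
  exact ⟨(h.exists_algEquiv e).choose⟩

/-- All the sixteen fibrations live on the surface `x³ - x = t² (z³ - 1)`. -/
lemma nonempty_functionField_algEquiv [CharZero k] [IsAlgClosed k] {x z t : K}
    (h : IsDoublePlane k x z t) (hr : x ^ 3 - x = t ^ 2 * (z ^ 3 - 1)) (hω : ω ^ 2 + ω + 1 = 0)
    (i : Label) : Nonempty ((equation ω i).toAffine.FunctionField ≃ₐ[k] K) := by
  obtain ⟨u, x, y, h8, e8⟩ := map_j8 h hr hω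
  cases i
  case j1a =>
    refine nonempty_algEquiv_of_eq equation_j1a ?_
    obtain ⟨U, X, Y, h, e⟩ := map_j1a h hr hω
    exact ⟨U, X, Y, h, by rw [e]; simp [map_ofNat]⟩
  case j1b =>
    refine nonempty_algEquiv_of_eq equation_j1b ?_
    obtain ⟨U, X, Y, h, e⟩ := map_j1b h hr hω
    exact ⟨U, X, Y, h, by rw [e]; simp [map_ofNat]⟩
  case j2 =>
    refine nonempty_algEquiv_of_eq equation_j2 ?_
    obtain ⟨U, X, Y, h, e⟩ := map_j2 h hr hω
    exact ⟨U, X, Y, h, by rw [e]; simp [map_ofNat]⟩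
  case j3 =>
    refine nonempty_algEquiv_of_eq equation_j3 ?_
    obtain ⟨U, X, Y, h, e⟩ := map_j3 h hr hω
    exact ⟨U, X, Y, h, by rw [e]; simp⟩
  case j4a =>
    refine nonempty_algEquiv_of_eq equation_j4a ?_
    obtain ⟨X, Y, h, e⟩ := map_j4a h hr
    exact ⟨_, X, Y, h, by rw [e]; simp; ring⟩
  case j4b =>
    refine nonempty_algEquiv_of_eq equation_j4b ?_
    obtain ⟨X, Y, h, e⟩ := map_j4b h hr
    exact ⟨_, X, Y, h, by rw [e]; simp; ring⟩
  case j5 =>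
    refine nonempty_algEquiv_of_eq equation_j5 ?_
    obtain ⟨U, X, Y, h, e⟩ := map_j5 h hr hω
    exact ⟨U, X, Y, h, by rw [e]; simp only [map_zero, map_add, map_neg,
      map_mul, map_pow, map_ofNat, aeval_X]; ring⟩
  case j6a =>
    refine nonempty_algEquiv_of_eq equation_j6a ?_
    obtain ⟨U, X, Y, h, e⟩ := map_j6a h hr hω
    exact ⟨U, X, Y, h, by rw [e]; simp only [map_zero, map_one, map_add, map_sub, map_neg,
      map_mul, map_pow, map_ofNat, aeval_X]; ring⟩
  case j6b =>
    refine nonempty_algEquiv_of_eq equation_j6b ?_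
    obtain ⟨U, X, Y, h, e⟩ := map_j6b h hr hω
    exact ⟨U, X, Y, h, by rw [e]; simp only [map_zero, map_one, map_add, map_sub, map_neg,
      map_mul, map_pow, map_ofNat, aeval_X, aeval_C]; ring⟩
  case j7a =>
    refine nonempty_algEquiv_of_eq equation_j7a ?_
    obtain ⟨U, X, Y, h, e⟩ := map_j7a h8 e8
    exact ⟨U, X, Y, h, by rw [e]; simp [map_ofNat]⟩
  case j7b =>
    refine nonempty_algEquiv_of_eq equation_j7b ?_
    obtain ⟨U, X, Y, h, e⟩ := map_j7b h8 e8 hω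
    exact ⟨U, X, Y, h, by rw [e]; simp [map_ofNat]⟩
  case j8 =>
    refine nonempty_algEquiv_of_eq equation_j8 ?_
    exact ⟨u, x, y, h8, by rw [e8]; simp [map_ofNat]⟩
  case j9 =>
    refine nonempty_algEquiv_of_eq equation_j9 ?_
    obtain ⟨U, X, Y, h, e⟩ := map_j9 h8 e8
    exact ⟨U, X, Y, h, by rw [e]; simp [map_ofNat]⟩
  case j10 =>
    refine nonempty_algEquiv_of_eq equation_j10 ?_
    obtain ⟨U, X, Y, h, e⟩ := map_j10 h8 e8
    exact ⟨U, X, Y, h, by rw [e]; simp [map_ofNat]⟩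
  case j11a =>
    refine nonempty_algEquiv_of_eq equation_j11a ?_
    obtain ⟨U, X, Y, h, e⟩ := map_j11a h8 e8
    exact ⟨U, X, Y, h, by rw [e]; simp [map_ofNat]⟩
  case j11b =>
    refine nonempty_algEquiv_of_eq equation_j11b ?_
    obtain ⟨U, X, Y, h, e⟩ := map_j11b h8 e8 hω
    exact ⟨U, X, Y, h, by rw [e]; simp [map_ofNat]⟩

/-- The fibration `j4a` is induced by the second projection. -/
lemma exists_algEquiv_j4a [CharZero k] {x z t : K} (h : IsDoublePlane k x z t)
    (hr : x ^ 3 - x = t ^ 2 * (z ^ 3 - 1)) :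
    ∃ φ : (equation ω .j4a).toAffine.FunctionField ≃ₐ[k] K,
      φ (parameter (equation ω .j4a)) = z := by
  obtain ⟨X, Y, h, e⟩ := map_j4a h hr
  rw [equation_j4a]
  exact h.exists_algEquiv (by rw [e]; simp; ring)

/-- The fibration `j4b` is induced by the first projection. -/
lemma exists_algEquiv_j4b [CharZero k] {x z t : K} (h : IsDoublePlane k x z t)
    (hr : x ^ 3 - x = t ^ 2 * (z ^ 3 - 1)) :
    ∃ φ : (equation ω .j4b).toAffine.FunctionField ≃ₐ[k] K,
      φ (parameter (equation ω .j4b)) = x := by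
  obtain ⟨X, Y, h, e⟩ := map_j4b h hr
  rw [equation_j4b]
  exact h.exists_algEquiv (by rw [e]; simp; ring)

end FunctionFields

/-! ### Types, absolute invariants and nodal fibres -/

section Invariants

variable {k : Type*} [Field k] [IsAlgClosed k] [CharZero k] {ω : k}

lemma exists_hasReducibleFibres (hω : ω ^ 2 + ω + 1 = 0) (i : Label) :
    ∃ L, HasReducibleFibres (equation ω i) L ∧
      (L.map Prod.snd : Multiset KodairaSymbol) = i.type.reducibleFibres := by
  cases i
  · exact ⟨_, hasReducibleFibres_j1a, rfl⟩
  · exact ⟨_, hasReducibleFibres_j1b hω, rfl⟩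
  · exact ⟨_, hasReducibleFibres_j2, rfl⟩
  · exact ⟨_, hasReducibleFibres_j3, rfl⟩
  · exact ⟨_, hasReducibleFibres_j4a hω, rfl⟩
  · exact ⟨_, hasReducibleFibres_j4b, rfl⟩
  · exact ⟨_, hasReducibleFibres_j5 hω, rfl⟩
  · exact ⟨_, hasReducibleFibres_j6a hω, rfl⟩
  · exact ⟨_, hasReducibleFibres_j6b hω, rfl⟩
  · exact ⟨_, hasReducibleFibres_j7a, rfl⟩
  · exact ⟨_, hasReducibleFibres_j7b hω, rfl⟩
  · exact ⟨_, hasReducibleFibres_j8 hω, rfl⟩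
  · exact ⟨_, hasReducibleFibres_j9, rfl⟩
  · exact ⟨_, hasReducibleFibres_j10, rfl⟩
  · exact ⟨_, hasReducibleFibres_j11a, rfl⟩
  · exact ⟨_, hasReducibleFibres_j11b hω, rfl⟩

lemma Δ_equation_ne_zero (hω : ω ^ 2 + ω + 1 = 0) (i : Label) : (equation ω i).Δ ≠ 0 :=
  (exists_hasReducibleFibres hω i).choose_spec.1.Δ_ne_zero

lemma hasType_equation (hω : ω ^ 2 + ω + 1 = 0) (i : Label) : HasType (equation ω i) i.type :=
  (exists_hasReducibleFibres hω i).choose_spec.1.hasType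
    (exists_hasReducibleFibres hω i).choose_spec.2

lemma isElliptic_equation (hω : ω ^ 2 + ω + 1 = 0) (i : Label) : (equation ω i).IsElliptic :=
  ⟨isUnit_iff_ne_zero.mpr (Δ_equation_ne_zero hω i)⟩

/-- The absolute invariant `c₄³ / Δ`, where the common factor `e` of `c₄³` and `Δ` cancels. -/
lemma j_eq_mul_div {F : Type*} [Field F] (W : WeierstrassCurve F) [W.IsElliptic] {c N D : F}
    (e : F) (h₄ : W.c₄ ^ 3 = 1728 * c * N * e) (hΔ : W.Δ = e * D) : W.j = 1728 * (c * (N / D)) := by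
  have h : W.Δ ≠ 0 := W.isUnit_Δ.ne_zero
  have he : e ≠ 0 := by rintro rfl; simp [hΔ] at h
  have hD : D ≠ 0 := by rintro rfl; simp [hΔ] at h
  rw [WeierstrassCurve.j, Units.val_inv_eq_inv_val, WeierstrassCurve.coe_Δ', h₄, hΔ]
  field_simp

/-- The absolute invariants are as listed. -/
theorem j_equation (hω : ω ^ 2 + ω + 1 = 0) {i : Label} {J : RatFunc k}
    (hJ : absoluteInvariant ω i = some J) [(equation ω i).IsElliptic] :
    (equation ω i).j = 1728 * J := by
  have hw : RatFunc.C ω ^ 2 + RatFunc.C ω + 1 = 0 := by simpa using congrArg RatFunc.C hω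
  have : CharZero (RatFunc k) := charZero_of_injective_algebraMap (algebraMap k _).injective
  have hI : (equation ω i).IsElliptic := inferInstance
  have hΔ := Δ_equation_ne_zero hω i
  generalize hX : (RatFunc.X : RatFunc k) = u
  generalize hC : RatFunc.C ω = w at hw
  cases i <;> simp only [absoluteInvariant, Option.some.injEq, reduceCtorEq, hX, hC] at hJ <;>
    subst hJ
  case j1a =>
    refine j_eq_mul_div _ 256 ?_ ?_ <;>
      simp only [equation, c₄_cubicModel, Δ_cubicModel, cubicDisc, hX] <;> ring
  case j1b =>
    refine j_eq_mul_div _ 16384 ?_ ?_ <;>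
      simp only [equation, c₄_cubicModel, Δ_cubicModel, cubicDisc, hX, hC]
    all_goals clear * - hw this; grind
  case j2 =>
    refine j_eq_mul_div _ 16384 ?_ ?_ <;>
      simp only [equation, c₄_cubicModel, Δ_cubicModel, cubicDisc, hX] <;> ring
  case j3 =>
    have h4 : (equation ω .j3).c₄ = 0 := by
      simp only [equation, c₄_cubicModel]; ring
    rw [WeierstrassCurve.j, h4]; ring
  case j4a =>
    rw [← div_one (1 : RatFunc k), ← one_mul (1 / 1 : RatFunc k)]
    refine j_eq_mul_div _ (64 * (u ^ 3 - 1) ^ 6) ?_ ?_ <;>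
      simp only [equation, c₄_cubicModel, Δ_cubicModel, cubicDisc, hX] <;> ring
  case j4b =>
    have h4 : (equation ω .j4b).c₄ = 0 := by
      simp only [equation, c₄_cubicModel]; ring
    rw [WeierstrassCurve.j, h4]; ring
  case j5 =>
    refine j_eq_mul_div _ 4096 ?_ ?_ <;>
      simp only [equation, splitModel, c₄_cubicModel, Δ_cubicModel, cubicDisc, hX] <;> ring
  case j6a =>
    refine j_eq_mul_div _ (64 * u ^ 6) ?_ ?_ <;>
      simp only [equation, splitModel, c₄_cubicModel, Δ_cubicModel, cubicDisc, hX] <;> ring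
  case j6b =>
    have h4 : (w * u ^ 2 + -(u * (2 * u - 1) * (u + w ^ 2))) ^ 2 -
        3 * (w * u ^ 2 * -(u * (2 * u - 1) * (u + w ^ 2))) = u ^ 2 *
        ((2 * u ^ 2 - (w + 2) * u - w ^ 2) * (2 * u ^ 2 - 2 * (w + 2) * u - w ^ 2)) := by
      clear * - hw
      grind
    refine j_eq_mul_div _ (16 * w ^ 2 * u ^ 6) ?_ ?_ <;>
      simp only [equation, splitModel, c₄_cubicModel, Δ_cubicModel, cubicDisc, hX, hC]
    · rw [neg_sq, h4]
      linear_combination (-4096) * u ^ 6 * (w - 1) * (2 * u ^ 2 - (w + 2) * u - w ^ 2) ^ 3 *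
        (2 * u ^ 2 - 2 * (w + 2) * u - w ^ 2) ^ 3 * hw
    · clear * - hw this
      grind
  case j7a =>
    refine j_eq_mul_div _ (16 * u ^ 6 * (u + 2) ^ 6) ?_ ?_ <;>
      simp only [equation, c₄_cubicModel, Δ_cubicModel, cubicDisc, hX] <;> ring
  case j7b =>
    have h4 : (w * u * (u - 1) * (u - 3 * w - 2)) ^ 2 - 3 * -(2 * w ^ 2 * u ^ 2 * (u - 1) ^ 2) =
        w ^ 2 * u ^ 2 * (u - 1) ^ 2 * (u ^ 2 - 2 * (3 * w + 2) * u + 3 * w + 1) := by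
      clear * - hw
      grind
    refine j_eq_mul_div _ (64 * u ^ 6 * (u - 1) ^ 6) ?_ ?_ <;>
      simp only [equation, c₄_cubicModel, Δ_cubicModel, cubicDisc, hX, hC]
    · rw [h4]
      linear_combination 4096 * (w - 1) * (w ^ 3 + 1) *
        (u ^ 2 * (u - 1) ^ 2 * (u ^ 2 - 2 * (3 * w + 2) * u + 3 * w + 1)) ^ 3 * hw
    · clear * - hw this
      grind
  case j8 =>
    refine j_eq_mul_div _ (-16 * u ^ 6) ?_ ?_ <;>
      simp only [equation, c₄_cubicModel, Δ_cubicModel, cubicDisc, hX] <;> ring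
  case j9 =>
    have h4 : (equation ω .j9).c₄ = 0 := by
      simp only [equation, c₄_cubicModel]; ring
    rw [WeierstrassCurve.j, h4]; ring

end Invariants

section NodalFibres

variable {k : Type*} [Field k]

/-- The nodal fibres lie over the simple zeros of the discriminant. -/
lemma hasFibre_I_one_iff [CharZero k] {A B D F Q : k[X]} {L : List (OnePoint k × KodairaSymbol)}
    (h : HasReducibleFibres (polyModel A B D) L) (hL : ∀ e ∈ L, e.2 ≠ .I 1)
    (hD : cubicDisc A B D = F * Q) (hinf : OnePoint.infty ∈ L.map Prod.fst)
    (hF : ∀ a : k, (a : OnePoint k) ∉ L.map Prod.fst → F.eval a ≠ 0)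
    (hFQ : ∀ a : k, (a : OnePoint k) ∈ L.map Prod.fst → Q.eval a ≠ 0)
    (hQ : ∀ a : k, Q.eval a = 0 → (derivative Q).eval a ≠ 0) (p : OnePoint k) :
    HasFibre (polyModel A B D) p (.I 1) ↔ ∃ a : k, p = a ∧ Q.eval a = 0 := by
  constructor
  · intro hp
    have hpL : p ∉ L.map Prod.fst := fun hmem => by
      obtain ⟨e, he, rfl⟩ := List.mem_map.mp hmem
      exact hL e he ((h.hasFibre e he).unique h.Δ_ne_zero hp)
    induction p using OnePoint.rec with
    | infty => exact absurd hinf hpL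
    | coe a =>
      refine ⟨a, rfl, by_contra fun h0 => ?_⟩
      have := hp.unique h.Δ_ne_zero (hasFibre_I_zero (a := a) (by
        rw [hD, eval_mul]; exact mul_ne_zero (hF a hpL) h0))
      simp at this
  · rintro ⟨a, rfl, ha⟩
    have hFa : F.eval a ≠ 0 := hF a fun hmem => hFQ a hmem ha
    exact hasFibre_I_one (by rw [hD, eval_mul, ha, mul_zero])
      (eval_derivative_ne_zero hD hFa (hQ a) (by rw [hD, eval_mul, ha, mul_zero]))

/-- The smooth fibres lie over the points where the discriminant has no zero. -/
lemma hasFibre_I_zero_iff [CharZero k] {A B D F Q : k[X]} {L : List (OnePoint k × KodairaSymbol)}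
    (h : HasReducibleFibres (polyModel A B D) L) (hL : ∀ e ∈ L, e.2 ≠ .I 0)
    (hD : cubicDisc A B D = F * Q) (hinf : OnePoint.infty ∈ L.map Prod.fst)
    (hF : ∀ a : k, (a : OnePoint k) ∉ L.map Prod.fst → F.eval a ≠ 0)
    (hQ : ∀ a : k, Q.eval a = 0 → HasFibre (polyModel A B D) a (.I 1)) (p : OnePoint k) :
    HasFibre (polyModel A B D) p (.I 0) ↔ p ∉ L.map Prod.fst ∧ ∀ a : k, p = a → Q.eval a ≠ 0 := by
  constructor
  · refine fun hp => ⟨fun hmem => ?_, ?_⟩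
    · obtain ⟨e, he, rfl⟩ := List.mem_map.mp hmem
      exact hL e he ((h.hasFibre e he).unique h.Δ_ne_zero hp)
    · rintro a rfl h0
      simpa using hp.unique h.Δ_ne_zero (hQ a h0)
  · rintro ⟨hp, h0⟩
    induction p using OnePoint.rec with
    | infty => exact absurd hinf hp
    | coe a =>
      exact hasFibre_I_zero (by rw [hD, eval_mul]; exact mul_ne_zero (hF a hp) (h0 a rfl))

lemma nodup_roots_of_eval_derivative_ne_zero {Q : k[X]}
    (hQ : ∀ a : k, Q.eval a = 0 → (derivative Q).eval a ≠ 0) (h0 : Q ≠ 0) : Q.roots.Nodup := by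
  classical
  rw [Multiset.nodup_iff_count_le_one]
  intro a
  rw [count_roots]
  by_contra! hlt
  obtain ⟨h1, h2⟩ := (one_lt_rootMultiplicity_iff_isRoot h0).mp hlt
  exact hQ a h1 h2

lemma encard_setOf_eval_eq_zero [IsAlgClosed k] {Q : k[X]}
    (hQ : ∀ a : k, Q.eval a = 0 → (derivative Q).eval a ≠ 0) (h0 : Q ≠ 0) :
    {p : OnePoint k | ∃ a : k, p = a ∧ Q.eval a = 0}.encard = Q.natDegree := by
  classical
  have hnd := nodup_roots_of_eval_derivative_ne_zero hQ h0
  have hset : {p : OnePoint k | ∃ a : k, p = a ∧ Q.eval a = 0} =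
      (fun a : k => (a : OnePoint k)) '' (Q.roots.toFinset : Set k) := by
    ext p
    simp only [Set.mem_ofPred_eq, Set.mem_image, Finset.mem_coe, Multiset.mem_toFinset,
        mem_roots h0,
      IsRoot.def]
    exact ⟨fun ⟨a, ha, h⟩ => ⟨a, h, ha.symm⟩, fun ⟨a, h, ha⟩ => ⟨a, ha.symm, h⟩⟩
  rw [hset, (OnePoint.coe_injective).encard_image, Set.encard_coe_eq_coe_finsetCard,
    Multiset.toFinset_card_of_nodup hnd, (IsAlgClosed.splits Q).natDegree_eq_card_roots]

end NodalFibres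

/-! ### The singular fibres of the fibrations with two fibres `I₈` -/

section NodalFibres

variable {k : Type*} [Field k] [IsAlgClosed k] [CharZero k] {ω : k}

lemma hasFibre_I_one_j1a (p : OnePoint k) : HasFibre (equation ω .j1a) p (.I 1) ↔
    ∃ a : k, p = a ∧ (X ^ 8 - 14 * X ^ 4 + 1 : k[X]).eval a = 0 := by
  have h := hasReducibleFibres_j1a (ω := ω)
  rw [equation_j1a] at h ⊢
  refine hasFibre_I_one_iff h (by simp) cubicDisc_j1a (by simp) ?_ ?_ ?_ p <;> (simp; try grind)

lemma hasFibre_I_one_j1b (hω : ω ^ 2 + ω + 1 = 0) (p : OnePoint k) :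
    HasFibre (equation ω .j1b) p (.I 1) ↔ ∃ a : k, p = a ∧
      (X ^ 8 + 12 * (2 * C ω + 1) * X ^ 6 + 22 * X ^ 4 + 12 * (2 * C ω + 1) * X ^ 2 + 1).eval a =
        0 := by
  have h := hasReducibleFibres_j1b hω
  rw [equation_j1b] at h ⊢
  refine hasFibre_I_one_iff h (by simp) (cubicDisc_j1b hω) (by simp) ?_ ?_ ?_ p <;>
      (simp; try grind)

/-- Counting of singular fibres, for two fibres `I₈` and a discriminant whose other zeros are
simple. -/
lemma encard_hasFibre_of_two_I_eight {A B D F Q : k[X]}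
    (h : HasReducibleFibres (polyModel A B D) [(OnePoint.infty, .I 8),
        (((0 : k) : OnePoint k), .I 8)])
    (hD : cubicDisc A B D = F * Q) (hF : ∀ a, a ≠ 0 → F.eval a ≠ 0) (h0 : Q.eval 0 ≠ 0)
    (hQ : ∀ a, Q.eval a = 0 → (derivative Q).eval a ≠ 0) (hdeg : Q.natDegree = 8) :
    HasFibre (polyModel A B D) ((0 : k) : OnePoint k) (.I 8) ∧
      HasFibre (polyModel A B D) OnePoint.infty (.I 8) ∧
      {p : OnePoint k | HasFibre (polyModel A B D) p (.I 1)}.encard = 8 ∧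
      {p : OnePoint k | ¬ HasFibre (polyModel A B D) p (.I 0)}.encard = 10 := by
  have hQ0 : Q ≠ 0 := by rintro rfl; simp at h0
  have hF' : ∀ a : k, (a : OnePoint k) ∉ [(OnePoint.infty, KodairaSymbol.I 8),
      (((0 : k) : OnePoint k), .I 8)].map Prod.fst → F.eval a ≠ 0 := fun a ha =>
    hF a (by simpa using ha)
  have h1 := hasFibre_I_one_iff h (by simp) hD (by simp) hF' (by simpa using h0) hQ
  have h2 := hasFibre_I_zero_iff h (by simp) hD (by simp) hF'
    fun a ha => (h1 _).mpr ⟨a, rfl, ha⟩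
  have h3 := encard_setOf_eval_eq_zero hQ hQ0
  rw [hdeg] at h3
  have hI : (KodairaSymbol.I 8).IsReducible := by simp [KodairaSymbol.IsReducible]
  refine ⟨(h.hasFibre_iff hI _).mpr (by simp), (h.hasFibre_iff hI _).mpr (by simp), ?_, ?_⟩
  · simp only [h1]
    exact h3
  · have hset : {p : OnePoint k | ¬ HasFibre (polyModel A B D) p (.I 0)} =
        insert OnePoint.infty (insert ((0 : k) : OnePoint k)
          {p : OnePoint k | ∃ a : k, p = a ∧ Q.eval a = 0}) := by
      ext p
      simp only [h2, Set.mem_ofPred_eq, Set.mem_insert_iff, List.map_cons, List.map_nil,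
        List.mem_cons, List.not_mem_nil, or_false]
      grind
    rw [hset, Set.encard_insert_of_notMem, Set.encard_insert_of_notMem, h3]
    · norm_num
    · rintro ⟨a, ha, h⟩
      rw [← OnePoint.coe_eq_coe.mp ha] at h
      exact h0 h
    · simp

/-- The fibrations `j1a` and `j1b` have two fibres `I₈`, eight fibres `I₁` and no other singular
fibre. -/
theorem encard_hasFibre_equation (hω : ω ^ 2 + ω + 1 = 0) {i : Label} (hi : i.type = .J1) :
    HasFibre (equation ω i) ((0 : k) : OnePoint k) (.I 8) ∧
      HasFibre (equation ω i) OnePoint.infty (.I 8) ∧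
      {p : OnePoint k | HasFibre (equation ω i) p (.I 1)}.encard = 8 ∧
      {p : OnePoint k | ¬ HasFibre (equation ω i) p (.I 0)}.encard = 10 := by
  cases i <;> first | (simp [Label.type] at hi; done) | skip
  case j1a =>
    have h := hasReducibleFibres_j1a (ω := ω)
    rw [equation_j1a] at h ⊢
    refine encard_hasFibre_of_two_I_eight h cubicDisc_j1a ?_ ?_ ?_ (by compute_degree!)
    · simp
    · simp
    · simp; grind
  case j1b =>
    have h := hasReducibleFibres_j1b hω
    rw [equation_j1b] at h ⊢
    refine encard_hasFibre_of_two_I_eight h (cubicDisc_j1b hω) ?_ ?_ ?_ (by compute_degree!)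
    · simp
    · simp
    · simp; grind

end NodalFibres

/-! ### Isomorphisms of fibrations -/

section Isomorphisms

lemma IsomorphicFibrations.symm {k : Type*} [Field k] {W W' : WeierstrassCurve (RatFunc k)}
    (h : IsomorphicFibrations W W') : IsomorphicFibrations W' W := by
  obtain ⟨σ, τ, h⟩ := h
  refine ⟨σ.symm, τ.symm, fun f => ?_⟩
  rw [AlgEquiv.symm_apply_eq, h, AlgEquiv.apply_symm_apply]

lemma exists_equation_eq {k : Type*} [Field k] {ω : k} (i : Label) : ∃ a b c, equation ω i =
    cubicModel a b c := by
  cases i <;> exact ⟨_, _, _, rfl⟩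

/-- A projectivity that preserves the set `{0, ∞}` is of the form `x ↦ m x` or `x ↦ m / x`. -/
lemma exists_smul_coe_eq {k : Type*} [Field k] [DecidableEq k] {g : GL (Fin 2) k}
    (hinf : g • (OnePoint.infty : OnePoint k) = OnePoint.infty ∨
      g • (OnePoint.infty : OnePoint k) = ((0 : k) : OnePoint k))
    (h0 : g • ((0 : k) : OnePoint k) = OnePoint.infty ∨
      g • ((0 : k) : OnePoint k) = ((0 : k) : OnePoint k)) :
    ∃ m : k, m ≠ 0 ∧ ((∀ x : k, g • (x : OnePoint k) = ((m * x : k) : OnePoint k)) ∨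
      ∀ x : k, x ≠ 0 → g • (x : OnePoint k) = ((m / x : k) : OnePoint k)) := by
  have hdet := g.det_ne_zero
  rw [Matrix.det_fin_two] at hdet
  simp only [OnePoint.smul_infty_eq_ite, OnePoint.smul_some_eq_ite, mul_zero, zero_add] at hinf h0 ⊢
  by_cases hc : g 1 0 = 0
  · have hd : g 1 1 ≠ 0 := by rintro hd; simp [hc, hd] at hdet
    have ha : g 0 0 ≠ 0 := by rintro ha; simp [hc, ha] at hdet
    have hb : g 0 1 = 0 := by simpa [hd] using h0
    exact ⟨g 0 0 / g 1 1, div_ne_zero ha hd, Or.inl fun x => by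
      simp [hc, hd, hb, div_mul_eq_mul_div]⟩
  · have ha : g 0 0 = 0 := by simpa [hc] using hinf
    have hb : g 0 1 ≠ 0 := by rintro hb; simp [hb, ha] at hdet
    have hd : g 1 1 = 0 := by
      by_contra hd
      simp [hd, hb] at h0
    exact ⟨g 0 1 / g 1 0, div_ne_zero hb hc, Or.inr fun x hx => by
      simp [hc, hd, ha, hx, div_div]⟩

variable {k : Type*} [Field k] [IsAlgClosed k] [CharZero k] {ω : k}

/-- An isomorphism of two of the fibrations induces a projectivity of the base that respects the
types of the fibres. -/
lemma exists_smul_hasFibre_iff [DecidableEq k] (hω : ω ^ 2 + ω + 1 = 0) {i j : Label}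
    (h : IsomorphicFibrations (equation ω i) (equation ω j)) :
    ∃ g : GL (Fin 2) k, ∀ p T,
      HasFibre (equation ω j) p T ↔ HasFibre (equation ω i) (g • p) T := by
  have hi := Δ_equation_ne_zero hω i
  have hj := Δ_equation_ne_zero hω j
  obtain ⟨a, b, c, ei⟩ := exists_equation_eq (ω := ω) i
  obtain ⟨a', b', c', ej⟩ := exists_equation_eq (ω := ω) j
  generalize equation ω i = W at h hi ei ⊢
  generalize equation ω j = W' at h hj ej ⊢
  subst ei ej
  exact h.exists_hasFibre_iff hi hj

/-- A type is determined by its list of reducible fibres. -/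
lemma OguisoType.eq_of_count_eq {m n : OguisoType}
    (h : ∀ T : KodairaSymbol, T.IsReducible →
      m.reducibleFibres.count T = n.reducibleFibres.count T) : m = n := by
  have h1 := h (.I 8) (by simp [KodairaSymbol.IsReducible])
  have h2 := h (.I 12) (by simp [KodairaSymbol.IsReducible])
  have h3 := h .IVStar trivial
  have h4 := h (.IStar 0) trivial
  have h5 := h (.IStar 6) trivial
  have h6 := h (.IStar 2) trivial
  have h7 := h (.IStar 4) trivial
  have h8 := h .IIIStar trivial
  have h9 := h .IIStar trivial
  have h10 := h (.IStar 8) trivial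
  clear h
  cases m <;> cases n <;> first | rfl | (exfalso; revert h1 h2 h3 h4 h5 h6 h7 h8 h9 h10; decide)

/-- Isomorphic fibrations have the same type, since the projectivity of the base maps the fibres
with a given symbol bijectively to each other. -/
lemma type_eq_of_isomorphicFibrations (hω : ω ^ 2 + ω + 1 = 0) {i j : Label}
    (h : IsomorphicFibrations (equation ω i) (equation ω j)) : i.type = j.type := by
  classical
  obtain ⟨g, hg⟩ := exists_smul_hasFibre_iff hω h
  refine OguisoType.eq_of_count_eq fun T hT => ?_
  have hi := hasType_equation hω i T hT
  have hj := hasType_equation hω j T hT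
  have hset : {p : OnePoint k | HasFibre (equation ω i) p T} =
      (MulAction.toPerm g : OnePoint k ≃ OnePoint k) ''
        {p : OnePoint k | HasFibre (equation ω j) p T} := by
    ext p
    simp only [Set.mem_ofPred_eq, Set.mem_image, hg, MulAction.toPerm_apply]
    exact ⟨fun h => ⟨g⁻¹ • p, by rwa [smul_inv_smul], smul_inv_smul g p⟩, fun ⟨q, hq, e⟩ => e ▸ hq⟩
  rw [hset, (MulAction.toPerm g).injective.encard_image, hj] at hi
  exact_mod_cast hi.symm

end Isomorphisms

/-! ### Non-isomorphic fibrations of the same type -/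

section NonIsomorphic

/-- A polynomial that vanishes at the zeros of a separable polynomial of the same degree is
proportional to it. -/
lemma exists_eq_C_mul {k : Type*} [Field k] [IsAlgClosed k] {P Q : k[X]}
    (hQ : ∀ a, Q.eval a = 0 → (derivative Q).eval a ≠ 0)
    (h : ∀ a, Q.eval a = 0 → P.eval a = 0) (hP : P ≠ 0) (hdeg : P.natDegree ≤ Q.natDegree)
    (hQ0 : Q ≠ 0) : ∃ c : k, P = C c * Q := by
  have hnd := nodup_roots_of_eval_derivative_ne_zero hQ hQ0
  obtain ⟨R, rfl⟩ : Q ∣ P := (IsAlgClosed.splits Q).dvd_of_roots_le_roots hQ0 <|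
    (Multiset.le_iff_subset hnd).mpr fun a ha =>
      (mem_roots hP).mpr (h a ((mem_roots hQ0).mp ha))
  have hR0 : R ≠ 0 := right_ne_zero_of_mul hP
  rw [natDegree_mul hQ0 hR0] at hdeg
  obtain ⟨c, rfl⟩ := natDegree_eq_zero.mp (show R.natDegree = 0 by omega)
  exact ⟨c, mul_comm _ _⟩

/-- The quartic whose zeros are the positions of the nodal fibres of `j11b` is separable. -/
lemma eval_derivative_ne_zero_j11b {k : Type*} [Field k] [CharZero k] {ω : k}
    (hω : ω ^ 2 + ω + 1 = 0) (a : k)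
    (h : (12 * X ^ 4 + (16 * C ω - 20) * X ^ 3 - 13 * X ^ 2 - (18 + 8 * C ω) * X + 3).eval a = 0) :
    (derivative (12 * X ^ 4 + (16 * C ω - 20) * X ^ 3 - 13 * X ^ 2 -
      (18 + 8 * C ω) * X + 3)).eval a ≠ 0 := by
  simp at h ⊢
  grind

variable {k : Type*} [Field k] [IsAlgClosed k] [hk : CharZero k] {ω : k}

/-- In both cases the projectivity preserves `{0, ∞}`, the positions of the fibres `I₈`, so it is
`x ↦ m x` or `x ↦ m / x`. The positions of the nodal fibres are stable under `x ↦ i x`, `i² = -1`,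
in one case but not in the other. -/
lemma not_isomorphic_j1 (hω : ω ^ 2 + ω + 1 = 0) :
    ¬ IsomorphicFibrations (equation ω .j1a) (equation ω .j1b) := by
  classical
  intro h
  obtain ⟨g, hg⟩ := exists_smul_hasFibre_iff hω h
  have hI : (KodairaSymbol.I 8).IsReducible := by simp [KodairaSymbol.IsReducible]
  have h8 : ∀ p, p = OnePoint.infty ∨ p = ((0 : k) : OnePoint k) →
      g • p = OnePoint.infty ∨ g • p = ((0 : k) : OnePoint k) := fun p hp => by
    have := hg p (.I 8)
    rw [(hasReducibleFibres_j1a (ω := ω)).hasFibre_iff hI,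
      (hasReducibleFibres_j1b hω).hasFibre_iff hI] at this
    simpa using this.mp (by simpa using hp)
  obtain ⟨m, hm, hm'⟩ := exists_smul_coe_eq (h8 _ (Or.inl rfl)) (h8 _ (Or.inr rfl))
  have h1 : ∀ x y : k, g • (x : OnePoint k) = (y : OnePoint k) →
      (x ^ 8 + 12 * (2 * ω + 1) * x ^ 6 + 22 * x ^ 4 + 12 * (2 * ω + 1) * x ^ 2 + 1 = 0 ↔
        y ^ 8 - 14 * y ^ 4 + 1 = 0) := fun x y hxy => by
    have := hg x (.I 1)
    rw [hxy, hasFibre_I_one_j1a, hasFibre_I_one_j1b hω] at this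
    simpa using this
  -- the zeros in the first case are stable under multiplication by `i`, those in the second are not
  obtain ⟨i, hi⟩ := IsAlgClosed.exists_pow_nat_eq (-1 : k) (n := 2) (by norm_num)
  have hdeg : (X ^ 8 + 12 * (2 * C ω + 1) * X ^ 6 + 22 * X ^ 4 + 12 * (2 * C ω + 1) * X ^ 2 +
    1 : k[X]).natDegree = 8 := by compute_degree!
  obtain ⟨r, hr⟩ := IsAlgClosed.exists_root _
    (degree_ne_of_natDegree_ne (n := 0) (by rw [hdeg]; norm_num))
  simp only [IsRoot.def, eval_add, eval_mul, eval_pow, eval_X, eval_C, eval_ofNat, eval_one] at hr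
  have hr0 : r ≠ 0 := by rintro rfl; simp at hr
  have hi0 : i ≠ 0 := by rintro rfl; simp at hi
  have hir : (i * r) ^ 8 + 12 * (2 * ω + 1) * (i * r) ^ 6 + 22 * (i * r) ^ 4 +
      12 * (2 * ω + 1) * (i * r) ^ 2 + 1 = 0 := by
    have h4 : i ^ 4 = 1 := by linear_combination (i ^ 2 - 1) * hi
    rcases hm' with hm' | hm'
    · rw [h1 _ _ (hm' _)]
      have := (h1 _ _ (hm' r)).mp hr
      linear_combination this + (m ^ 8 * r ^ 8 * (i ^ 4 + 1) - 14 * m ^ 4 * r ^ 4) * h4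
    · rw [h1 _ _ (hm' _ (mul_ne_zero hi0 hr0))]
      have := (h1 _ _ (hm' r hr0)).mp hr
      have e4 : (m / (i * r)) ^ 4 = (m / r) ^ 4 := by
        rw [div_pow, mul_pow, h4, one_mul, div_pow]
      linear_combination this + ((m / (i * r)) ^ 4 + (m / r) ^ 4 - 14) * e4
  clear * - hr hir hi hr0 hω hk
  have e1 : i ^ 4 = 1 := by linear_combination (i ^ 2 - 1) * hi
  have e2 : (2 * ω + 1) * (r ^ 2 * (r ^ 4 + 1)) = 0 := by grind
  have hs : 2 * ω + 1 ≠ 0 := by grind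
  have e3 : r ^ 4 = -1 := by
    have := (mul_eq_zero.mp ((mul_eq_zero.mp e2).resolve_left hs)).resolve_left (pow_ne_zero 2 hr0)
    linear_combination this
  grind

/-- The condition `c₆ = 0` on a Weierstrass equation, that is `j = 1728`, is respected by
isomorphisms of fibrations. It holds for one of the two equations but not for the other. -/
lemma not_isomorphic_j4 (hω : ω ^ 2 + ω + 1 = 0) :
    ¬ IsomorphicFibrations (equation ω .j4b) (equation ω .j4a) := by
  intro h
  have h6 := h.c₆_eq_zero (Δ_equation_ne_zero hω .j4b) (Δ_equation_ne_zero hω .j4a)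
    (by rw [c₆_cubicModel]; ring)
  rw [c₆_cubicModel] at h6
  have hΔ := Δ_equation_ne_zero hω .j4b
  apply hΔ
  simp only [equation]
  rw [Δ_cubicModel, cubicDisc]
  have : CharZero (RatFunc k) := charZero_of_injective_algebraMap (algebraMap k _).injective
  have h7 : (RatFunc.X ^ 3 - RatFunc.X : RatFunc k) ^ 3 = 0 := by
    linear_combination (1 / 864) * h6
  rw [h7]
  ring

/-- The projectivity preserves `{0, ∞}`, the positions of the fibres `I₂*`. The positions of the
fibres `I₂` are stable under `x ↦ -x` in one case but not in the other. -/
lemma not_isomorphic_j6 (hω : ω ^ 2 + ω + 1 = 0) :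
    ¬ IsomorphicFibrations (equation ω .j6a) (equation ω .j6b) := by
  classical
  intro h
  obtain ⟨g, hg⟩ := exists_smul_hasFibre_iff hω h
  have hI : (KodairaSymbol.I 2).IsReducible := by simp [KodairaSymbol.IsReducible]
  have h2 : ∀ p, p = OnePoint.infty ∨ p = ((0 : k) : OnePoint k) →
      g • p = OnePoint.infty ∨ g • p = ((0 : k) : OnePoint k) := fun p hp => by
    have := hg p (.IStar 2)
    rw [(hasReducibleFibres_j6a hω).hasFibre_iff (T := .IStar 2) trivial,
      (hasReducibleFibres_j6b hω).hasFibre_iff (T := .IStar 2) trivial] at this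
    simpa using this.mp (by simpa using hp)
  obtain ⟨m, hm, hm'⟩ := exists_smul_coe_eq (h2 _ (Or.inl rfl)) (h2 _ (Or.inr rfl))
  have h1 : ∀ x y : k, g • (x : OnePoint k) = (y : OnePoint k) →
      (x = 1 ∨ x = 1 / 2 ∨ x = -ω ^ 2 ∨ x = -ω ^ 2 / 2 ↔
        y = ω ∨ y = ω ^ 2 ∨ y = -ω ∨ y = -ω ^ 2) := fun x y hxy => by
    have := hg x (.I 2)
    rw [hxy, (hasReducibleFibres_j6a hω).hasFibre_iff hI,
      (hasReducibleFibres_j6b hω).hasFibre_iff hI] at this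
    simpa using this
  -- the positions in the first case are stable under `x ↦ -x`, those in the second are not
  have hneg : (-1 : k) = 1 ∨ (-1 : k) = 1 / 2 ∨ -1 = -ω ^ 2 ∨ -1 = -ω ^ 2 / 2 := by
    rcases hm' with hm' | hm'
    · have := (h1 _ _ (hm' 1)).mp (Or.inl rfl)
      rw [h1 _ _ (hm' _), mul_neg]
      clear * - this
      grind
    · have := (h1 _ _ (hm' 1 one_ne_zero)).mp (Or.inl rfl)
      rw [h1 _ _ (hm' _ (neg_ne_zero.mpr one_ne_zero)), div_neg]
      clear * - this
      grind
  clear * - hneg hω hk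
  grind

lemma hasFibre_I_one_j7a (p : OnePoint k) : HasFibre (equation ω .j7a) p (.I 1) ↔
    ∃ a : k, p = a ∧ ((X - 1) * (X + 3) : k[X]).eval a = 0 := by
  have h := hasReducibleFibres_j7a (ω := ω)
  rw [equation_j7a] at h ⊢
  refine hasFibre_I_one_iff h (by simp) cubicDisc_j7a (by simp) ?_ ?_ ?_ p <;> (simp; try grind)

lemma hasFibre_I_one_j7b (hω : ω ^ 2 + ω + 1 = 0) (p : OnePoint k) :
    HasFibre (equation ω .j7b) p (.I 1) ↔ ∃ a : k, p = a ∧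
      (X ^ 2 - 2 * (3 * C ω + 2) * X + 3 * C ω + 3).eval a = 0 := by
  have h := hasReducibleFibres_j7b hω
  rw [equation_j7b] at h ⊢
  refine hasFibre_I_one_iff h (by simp) (cubicDisc_j7b hω) (by simp) ?_ ?_ ?_ p <;>
    (simp; try grind)

/-- The projectivity fixes `∞`, the position of the fibre `I₄*`, so it is affine. In one case the
two fibres `I₀*` and the two nodal fibres lie at pairs of points with the same midpoint, but not in
the other. -/
lemma not_isomorphic_j7 (hω : ω ^ 2 + ω + 1 = 0) :
    ¬ IsomorphicFibrations (equation ω .j7a) (equation ω .j7b) := by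
  classical
  intro h
  obtain ⟨g, hg⟩ := exists_smul_hasFibre_iff hω h
  have hinf : g 1 0 = 0 := by
    rw [← OnePoint.smul_infty_eq_self_iff]
    have := hg OnePoint.infty (.IStar 4)
    rw [(hasReducibleFibres_j7a (ω := ω)).hasFibre_iff (T := .IStar 4) trivial,
      (hasReducibleFibres_j7b hω).hasFibre_iff (T := .IStar 4) trivial] at this
    simpa using this
  have hdet := g.det_ne_zero
  rw [Matrix.det_fin_two, hinf, mul_zero, sub_zero] at hdet
  have hd : g 1 1 ≠ 0 := right_ne_zero_of_mul hdet
  -- in an affine coordinate the projectivity is `x ↦ α x + β`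
  obtain ⟨α, hα⟩ : ∃ α, α = g 0 0 / g 1 1 := ⟨_, rfl⟩
  obtain ⟨β, hβ⟩ : ∃ β, β = g 0 1 / g 1 1 := ⟨_, rfl⟩
  have hα0 : α ≠ 0 := hα ▸ div_ne_zero (left_ne_zero_of_mul hdet) hd
  have hgx : ∀ x : k, g • (x : OnePoint k) = ((α * x + β : k) : OnePoint k) := fun x => by
    rw [OnePoint.smul_some_eq_ite, hinf, zero_mul, zero_add, if_neg hd, hα, hβ]
    congr 1
    ring
  have h0 : ∀ x : k, x = 0 ∨ x = 1 ↔ α * x + β = 0 ∨ α * x + β = -2 := fun x => by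
    have := hg x (.IStar 0)
    rw [hgx, (hasReducibleFibres_j7a (ω := ω)).hasFibre_iff (T := .IStar 0) trivial,
      (hasReducibleFibres_j7b hω).hasFibre_iff (T := .IStar 0) trivial] at this
    simpa using this
  have h1 : ∀ x : k, x ^ 2 - 2 * (3 * ω + 2) * x + 3 * ω + 3 = 0 ↔
      α * x + β - 1 = 0 ∨ α * x + β + 3 = 0 := fun x => by
    have := hg x (.I 1)
    rw [hgx, hasFibre_I_one_j7a, hasFibre_I_one_j7b hω] at this
    simpa using this
  have hdeg : (X ^ 2 - 2 * (3 * C ω + 2) * X + 3 * C ω + 3 : k[X]).natDegree = 2 := by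
    compute_degree!
  obtain ⟨r, hr⟩ := IsAlgClosed.exists_root _
    (degree_ne_of_natDegree_ne (n := 0) (by rw [hdeg]; norm_num))
  simp only [IsRoot.def, eval_add, eval_sub, eval_mul, eval_pow, eval_X, eval_C, eval_ofNat] at hr
  have e0 := (h0 0).mp (Or.inl rfl)
  have e1 := (h0 1).mp (Or.inr rfl)
  have er := (h1 r).mp hr
  clear * - e0 e1 er hr hω hα0 hk
  have hβ : β = 0 ∧ α = -2 ∨ β = -2 ∧ α = 2 := by grind
  rcases hβ with ⟨rfl, rfl⟩ | ⟨rfl, rfl⟩ <;> rcases er with er | er <;> grind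

lemma hasFibre_I_one_j11a (p : OnePoint k) : HasFibre (equation ω .j11a) p (.I 1) ↔
    ∃ a : k, p = a ∧ (3 * X ^ 4 + 26 * X ^ 3 + 53 * X ^ 2 - 26 * X + 3 : k[X]).eval a = 0 := by
  have h := hasReducibleFibres_j11a (ω := ω)
  rw [equation_j11a] at h ⊢
  refine hasFibre_I_one_iff h (by simp) cubicDisc_j11a (by simp) ?_ ?_ ?_ p <;> (simp; try grind)

lemma hasFibre_I_one_j11b (hω : ω ^ 2 + ω + 1 = 0) (p : OnePoint k) :
    HasFibre (equation ω .j11b) p (.I 1) ↔ ∃ a : k, p = a ∧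
      (12 * X ^ 4 + (16 * C ω - 20) * X ^ 3 - 13 * X ^ 2 - (18 + 8 * C ω) * X + 3).eval a = 0 := by
  have h := hasReducibleFibres_j11b hω
  rw [equation_j11b] at h ⊢
  refine hasFibre_I_one_iff h (by simp) (cubicDisc_j11b hω) (by simp) ?_ ?_
    (eval_derivative_ne_zero_j11b hω) p <;> simp

/-- The projectivity preserves `{0, ∞}`, the positions of the fibres `I₄*`, so it is `x ↦ m x` or
`x ↦ m / x`. For no `m` does it carry the four positions of the nodal fibres to each other. -/
lemma not_isomorphic_j11 (hω : ω ^ 2 + ω + 1 = 0) :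
    ¬ IsomorphicFibrations (equation ω .j11a) (equation ω .j11b) := by
  classical
  intro h
  obtain ⟨g, hg⟩ := exists_smul_hasFibre_iff hω h
  have h4 : ∀ p, p = OnePoint.infty ∨ p = ((0 : k) : OnePoint k) →
      g • p = OnePoint.infty ∨ g • p = ((0 : k) : OnePoint k) := fun p hp => by
    have := hg p (.IStar 4)
    rw [(hasReducibleFibres_j11a (ω := ω)).hasFibre_iff (T := .IStar 4) trivial,
      (hasReducibleFibres_j11b hω).hasFibre_iff (T := .IStar 4) trivial] at this
    simpa using this.mp (by simpa using hp)
  obtain ⟨m, hm, hm'⟩ := exists_smul_coe_eq (h4 _ (Or.inl rfl)) (h4 _ (Or.inr rfl))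
  have h1 : ∀ x y : k, g • (x : OnePoint k) = (y : OnePoint k) →
      (12 * X ^ 4 + (16 * C ω - 20) * X ^ 3 - 13 * X ^ 2 - (18 + 8 * C ω) * X + 3).eval x = 0 →
        3 * y ^ 4 + 26 * y ^ 3 + 53 * y ^ 2 - 26 * y + 3 = 0 := fun x y hxy hx => by
    have := hg x (.I 1)
    rw [hxy, hasFibre_I_one_j11a, hasFibre_I_one_j11b hω] at this
    simpa using this.mp ⟨x, rfl, hx⟩
  have hdeg : (12 * X ^ 4 + (16 * C ω - 20) * X ^ 3 - 13 * X ^ 2 - (18 + 8 * C ω) * X +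
      3).natDegree = 4 := by compute_degree!
  have hQ0 : (12 * X ^ 4 + (16 * C ω - 20) * X ^ 3 - 13 * X ^ 2 - (18 + 8 * C ω) * X + 3) ≠ 0 := by
    intro h0
    simp [h0] at hdeg
  -- after the substitution `x ↦ m x` or `x ↦ m / x`, the quartics whose zeros are the positions
  -- of the nodal fibres are proportional
  obtain ⟨a, b, d, e, he, hP, hae⟩ : ∃ a b d e : k, e ≠ 0 ∧ (∀ x : k,
      (12 * X ^ 4 + (16 * C ω - 20) * X ^ 3 - 13 * X ^ 2 - (18 + 8 * C ω) * X + 3).eval x = 0 →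
        a * x ^ 4 + b * x ^ 3 + 53 * m ^ 2 * x ^ 2 + d * x + e = 0) ∧ a * e = 9 * m ^ 4 := by
    rcases hm' with hm' | hm'
    · refine ⟨3 * m ^ 4, 26 * m ^ 3, -26 * m, 3, three_ne_zero, fun x hx => ?_, by ring⟩
      linear_combination h1 _ _ (hm' x) hx
    · refine ⟨3, -26 * m, 26 * m ^ 3, 3 * m ^ 4, mul_ne_zero three_ne_zero (pow_ne_zero 4 hm),
        fun x hx => ?_, by ring⟩
      have hx0 : x ≠ 0 := by rintro rfl; simp at hx
      have := h1 _ _ (hm' x hx0) hx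
      field_simp at this
      linear_combination this
  obtain ⟨r, hr⟩ := exists_eq_C_mul (P := C a * X ^ 4 + C b * X ^ 3 + C (53 * m ^ 2) * X ^ 2 +
    C d * X + C e) (eval_derivative_ne_zero_j11b hω) (fun x hx => by simpa using hP x hx)
    (fun h0 => he (by simpa using congrArg (eval 0) h0)) (by rw [hdeg]; compute_degree) hQ0
  have hQ : (12 * X ^ 4 + (16 * C ω - 20) * X ^ 3 - 13 * X ^ 2 - (18 + 8 * C ω) * X + 3 : k[X]) =
      C 12 * X ^ 4 + C (16 * ω - 20) * X ^ 3 + C (-13) * X ^ 2 + C (-(18 + 8 * ω)) * X + C 3 := by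
    simp only [map_sub, map_neg, map_add, map_mul, map_ofNat]
    ring
  rw [hQ] at hr
  have c4 : a = r * 12 := by
    simpa only [coeff_add, coeff_C_mul, coeff_X_pow, coeff_X, coeff_C, reduceIte, mul_zero, mul_one,
      add_zero, zero_add, OfNat.ofNat_ne_zero, OfNat.one_ne_ofNat,
      Nat.reduceEqDiff] using congrArg (coeff · 4) hr
  have c2 : 53 * m ^ 2 = r * -13 := by
    simpa only [coeff_add, coeff_C_mul, coeff_X_pow, coeff_X, coeff_C, reduceIte, mul_zero, mul_one,
      add_zero, zero_add, OfNat.ofNat_ne_zero, OfNat.one_ne_ofNat,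
      Nat.reduceEqDiff] using congrArg (coeff · 2) hr
  have c0 : e = r * 3 := by simpa using congrArg (eval 0) hr
  -- the coefficients of `x⁴`, `x²` and `1` determine the invariant (product of the outer
  -- coefficients) / (middle coefficient)², which is `9 / 53²` for one quartic and `36 / 13²` for
  -- the other
  clear * - hm hae c4 c2 c0 hk
  have : (13 ^ 2 * 9 - 53 ^ 2 * 36) * m ^ 4 = 0 := by grind
  have : m ^ 4 = 0 := by
    refine (mul_eq_zero.mp this).resolve_left (by norm_num)
  exact pow_ne_zero 4 hm this

/-- The sixteen fibrations are pairwise non-isomorphic. -/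
theorem not_isomorphicFibrations (hω : ω ^ 2 + ω + 1 = 0) {i j : Label} (hij : i ≠ j) :
    ¬ IsomorphicFibrations (equation ω i) (equation ω j) := by
  intro h
  have ht := type_eq_of_isomorphicFibrations hω h
  cases i <;> cases j <;> simp [Label.type] at ht hij
  · exact not_isomorphic_j1 hω h
  · exact not_isomorphic_j1 hω h.symm
  · exact not_isomorphic_j4 hω h.symm
  · exact not_isomorphic_j4 hω h
  · exact not_isomorphic_j6 hω h
  · exact not_isomorphic_j6 hω h.symm
  · exact not_isomorphic_j7 hω h
  · exact not_isomorphic_j7 hω h.symm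
  · exact not_isomorphic_j11 hω h
  · exact not_isomorphic_j11 hω h.symm

end NonIsomorphic

end KummerFibrations

end

theorem mainTheorem10 {k : Type*} [Field k] [IsAlgClosed k] [CharZero k]
    (ω : k) (hω : ω ^ 2 + ω + 1 = 0) :
    -- every equation defines an elliptic fibration on the Kummer surface, of the stated type
    (∀ i : KummerFibrations.Label,
      (KummerFibrations.equation ω i).IsElliptic ∧
      Nonempty ((KummerFibrations.equation ω i).toAffine.FunctionField ≃ₐ[k]
        KummerFibrations.kummerField k) ∧
      KummerFibrations.HasType (KummerFibrations.equation ω i) i.type) ∧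
    -- the listed absolute invariants
    (∀ (i : KummerFibrations.Label) (J : RatFunc k),
      KummerFibrations.absoluteInvariant ω i = some J →
      ∃ _ : (KummerFibrations.equation ω i).IsElliptic,
        (KummerFibrations.equation ω i).j = 1728 * J) ∧
    -- the singular fibres of the two fibrations of the first type
    (∀ i : KummerFibrations.Label, i.type = .J1 →
      KummerFibrations.HasFibre (KummerFibrations.equation ω i) ((0 : k) : OnePoint k) (.I 8) ∧
      KummerFibrations.HasFibre (KummerFibrations.equation ω i) OnePoint.infty (.I 8) ∧
      {p : OnePoint k |
        KummerFibrations.HasFibre (KummerFibrations.equation ω i) p (.I 1)}.encard = 8 ∧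
      {p : OnePoint k |
        ¬ KummerFibrations.HasFibre (KummerFibrations.equation ω i) p (.I 0)}.encard = 10) ∧
    -- the two fibrations of the fourth type are induced by the two projections
    (∃ φ : (KummerFibrations.equation ω .j4a).toAffine.FunctionField ≃ₐ[k]
        KummerFibrations.kummerField k,
      (φ (KummerFibrations.parameter _) : KummerFibrations.ProductField k) =
        KummerFibrations.xTwo k) ∧
    (∃ φ : (KummerFibrations.equation ω .j4b).toAffine.FunctionField ≃ₐ[k]
        KummerFibrations.kummerField k,
      (φ (KummerFibrations.parameter _) : KummerFibrations.ProductField k) =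
        KummerFibrations.xOne k) ∧
    -- the fibrations are mutually non-isomorphic, in particular the two of the same type
    (∀ i j : KummerFibrations.Label, i ≠ j →
      ¬ KummerFibrations.IsomorphicFibrations (KummerFibrations.equation ω i)
        (KummerFibrations.equation ω j)) := by
  have h := KummerFibrations.isDoublePlane_kummer k
  have hr := KummerFibrations.kummer_relation k
  refine ⟨fun i => ⟨KummerFibrations.isElliptic_equation hω i,
      KummerFibrations.nonempty_functionField_algEquiv h hr hω i,
      KummerFibrations.hasType_equation hω i⟩, fun i J hJ =>
    have := KummerFibrations.isElliptic_equation hω i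
    ⟨this, KummerFibrations.j_equation hω hJ⟩,
    fun i hi => KummerFibrations.encard_hasFibre_equation hω hi, ?_, ?_,
    fun i j hij => KummerFibrations.not_isomorphicFibrations hω hij⟩
  · obtain ⟨φ, hφ⟩ := KummerFibrations.exists_algEquiv_j4a (ω := ω) h hr
    exact ⟨φ, congrArg Subtype.val hφ⟩
  · obtain ⟨φ, hφ⟩ := KummerFibrations.exists_algEquiv_j4b (ω := ω) h hr
    exact ⟨φ, congrArg Subtype.val hφ⟩
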